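/- **Setting.** Let $2\le m\le n$ and $n\ge 3$. The players are $0,\dots,n-1$; an honest issuer is not a player. The players are divided into three groups by their number modulo $3$; players $0,1,2$ are the *leaders* of their groups, and for a leader $i$ we write $i^+=i+1$ and $i^-=i-1$ modulo $3$. The players $k<m$ are *designated*. *Sharing.* In every sharing of the (fixed) secret each player gets one share, and the secret can be computed from any $m$ shares of the same sharing and not from fewer. Pieces are authenticated (unforgeable). If $m\ge 3$, shares are atomic, and they are the pieces that are sent. If $m=2$, each of the players $d=0,1$ splits its share into $n$ subshares $(d,0),\dots,(d,n-1)$, all of which are needed to recover it; $(d,k)$ belongs to player $k$, and only subshares are sent. *The game.* Play proceeds in synchronous rounds, possibly forever. In each round each player that has not stopped simultaneously does the following: it sends to each other player, over a private channel, optionally a bit and any set of pieces that it has (from any sharing so far) and may send to that player; and it may ask the issuer to restart. Alternatively it stops, for good. It may send: if $m\ge3$, its own share, and, if it is a leader, the shares of the designated players of its group; if $m=2$, the subshares that belong to it, the subshares belonging to members of its group if it is a leader, and, for $d=0,1$, player $d$ may send $(d,k)$ to player $k$. If all players ask in the same round, the issuer starts a new sharing of the same secret; issuing a sharing (also the first one)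 takes one round. A local state of a player is the sequence of its own actions, the messages it received, and the restarts. A strategy is an arbitrary randomized function from local states to available actions. A joint strategy $\vec\sigma$ determines a probability measure on infinite runs, and $U_i(\vec\sigma)$ is the expectation of $u_i(r)$. Player $i$ *learns the secret* in run $r$ ($\mathrm{info}_i(r)=1$, otherwise $0$) if at some time it can recover at least $m$ shares of one sharing. *Utilities.* Each player $i$ has a utility function $u_i$ on runs such that, for all runs $r,r'$: - U1: if $\mathrm{info}(r)=\mathrm{info}(r')$, then $u_i(r)=u_i(r')$; - U2: if $\mathrm{info}_i(r)=1$ and $\mathrm{info}_i(r')=0$, then $u_i(r)>u_i(r')$; - U3: if $\mathrm{info}_i(r)=\mathrm{info}_i(r')$, $\mathrm{info}_j(r)\le\mathrm{info}_j(r')$ for all $j\ne i$, and $\mathrm{info}_j(r)<\mathrm{info}_j(r')$ for some $j\neq i$, then $u_i(r)>u_i(r')$. *The mechanism $M(\alpha)$*, $0<\alpha\le 1$, consists of this game and the following recommended strategy. Every sharing is used for five rounds. - Step 0: the issuer issues the shares. - Step 1: each leader $i$ chooses a bit $c_i$ with $\Pr(c_i=1)=\alpha$ and an independent uniform bit $c_{(i,+)}$,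 puts $c_{(i,-)}=c_i\oplus c_{(i,+)}$, and sends $c_{(i,+)}$ to $i^+$ and $c_{(i,-)}$ to $i^-$. If $m=2$, each player $d\in\{0,1\}$ sends $(d,k)$ to each player $k\ne d$. - Step 2: each leader $i$ sends $c_{(i^+,-)}\oplus c_i$ to $i^-$. Each non-leader sends the pieces it contributes (if $m\ge3$: its share if it is designated, otherwise nothing; if $m=2$: its two subshares) to its leader. - Step 3: each leader $i$ computes $p=c_{(i^-,+)}\oplus(c_{(i^-,-)}\oplus c_{i^+})\oplus c_i$ and sends $p$ to all non-leaders. If $p=c_i=1$, it also sends all contributed pieces of its group to everyone. - Step 4: if $p=0$ and the pieces of no group were sent, or $p=1$ and the pieces of exactly one group were sent (its own group included), the player asks for a restart; otherwise it stops. (A non-leader uses the common value of the three bits $p$ it was sent, and stops if they differ.) A player that has received anything other than what this protocol can send to it (including a missing bit) stops. *Solution concept.* $\vec\sigma$ is a Nash equilibrium if no player gains by a unilateral deviation. Given sets $S_j$ of strategies, $\sigma\in S_i$ is weakly dominated by $\tau\in S_i$ if $U_i(\vec\sigma_{-i},\sigma)\le U_i(\vec\sigma_{-i},\tau)$ for all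 $\vec\sigma_{-i}\in S_{-i}$, with strict inequality for some. Starting from all strategies, in each deletion round all weakly dominated strategies of all players are deleted. A mechanism is *practical* if its recommended strategy is a Nash equilibrium each of whose components survives every finite number of deletion rounds. **Theorem.** For all utility functions satisfying U1–U3 there is an $\alpha^*>0$ such that, for every $\alpha\in(0,1]$ with $\alpha<\alpha^*$, $M(\alpha)$ is a practical mechanism for $m$-out-of-$n$ secret sharing: the recommended strategy is a Nash equilibrium that survives iterated deletion of weakly dominated strategies, and when it is played all players learn the secret with probability $1$. Moreover, the expected running time of the recommended strategy (the number of rounds until all players have stopped) is exactly $5/\alpha^3$. -/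

import Mathlib

open MeasureTheory ProbabilityTheory

/-! ### Solution concepts

A game is given through the strategy sets `S i` of its players and the expected utilities
`U i σ`. -/

section Solution

variable {ι : Type*} [DecidableEq ι] {S : ι → Type*}

/-- No player can gain by a unilateral change of strategy. -/
def IsNash (U : ι → (∀ i, S i) → ℝ) (σ : ∀ i, S i) : Prop :=
  ∀ (i : ι) (τ : S i), U i (Function.update σ i τ) ≤ U i σ

/-- `σ` is weakly dominated by `τ` with respect to the strategies `T j` of the players `j ≠ i`. -/
def WeaklyDominatedBy (U : ι → (∀ i, S i) → ℝ) (T : ∀ i, Set (S i)) (i : ι) (σ τ : S i) : Prop :=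
  (∃ ρ : ∀ j, S j, (∀ j, j ≠ i → ρ j ∈ T j) ∧
      U i (Function.update ρ i σ) < U i (Function.update ρ i τ)) ∧
  ∀ ρ : ∀ j, S j, (∀ j, j ≠ i → ρ j ∈ T j) →
      U i (Function.update ρ i σ) ≤ U i (Function.update ρ i τ)

/-- The strategies of player `i` in `T i` that are weakly dominated, by a strategy in `T i`,
with respect to the product of the sets `T j`. -/
def DOM (U : ι → (∀ i, S i) → ℝ) (T : ∀ i, Set (S i)) (i : ι) : Set (S i) :=
  {σ | σ ∈ T i ∧ ∃ τ ∈ T i, WeaklyDominatedBy U T i σ τ}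

/-- The strategies that survive `k` rounds of deletion; in each round all weakly dominated
strategies of all players are deleted. -/
def survivors (U : ι → (∀ i, S i) → ℝ) : ℕ → ∀ i, Set (S i)
  | 0 => fun _ => Set.univ
  | k + 1 => fun i => survivors U k i \ DOM U (survivors U k) i

/-- `σ` is a Nash equilibrium all of whose components survive iterated deletion of weakly
dominated strategies. -/
def IsPractical (U : ι → (∀ i, S i) → ℝ) (σ : ∀ i, S i) : Prop :=
  IsNash U σ ∧ ∀ i, σ i ∈ ⋂ k, survivors U k i

end Solution

/-! ### Shares

The players are the elements `0, …, n - 1` of `Fin n`. The honest issuer is not a player. -/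

/-- The pieces of one sharing of the secret. `share k` is the share issued to player `k`. When
`m = 2`, each of the players `d = 0, 1` moreover splits its share into the `n` subshares
`sub d 0, …, sub d (n - 1)`, all of which are needed to recover it. -/
inductive Piece (n : ℕ) where
  | share (k : Fin n)
  | sub (d : Fin 2) (k : Fin n)
  deriving DecidableEq, Countable

/-- The share of player `k` can be recovered from the pieces in `H`. -/
def Recovers {n : ℕ} (H : Set (Piece n)) (k : Fin n) : Prop :=
  Piece.share k ∈ H ∨ ∃ d : Fin 2, d.val = k.val ∧ ∀ l, Piece.sub d l ∈ H

/-- The pieces of a sharing that player `i` has once the shares have been issued. -/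
def Initial {n : ℕ} (m : ℕ) (i : Fin n) : Piece n → Prop
  | .share k => k = i
  | .sub d _ => m = 2 ∧ d.val = i.val

instance {n : ℕ} (m : ℕ) (i : Fin n) : DecidablePred (Initial m i) := fun x => by
  cases x <;> unfold Initial <;> infer_instance

/-! ### The game

The game proceeds in synchronous rounds. In each round every player that has not stopped sends
to each other player a message over a private channel, and may ask the issuer to restart. If all
players ask in the same round, the issuer begins a new sharing of the same secret. A newly begun
sharing (in particular the one begun at the start of the game) takes one round to issue. -/

/-- A message: possibly a bit, and a set of (authenticated, hence unforgeable) pieces, where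
`(s, x)` is the piece `x` of sharing number `s`. -/
structure Msg (n : ℕ) where
  bit : Option Bool
  pieces : Finset (ℕ × Piece n)
  deriving DecidableEq

/-- The empty message. -/
def Msg.empty {n : ℕ} : Msg n := ⟨none, ∅⟩

/-- The action of a player in one round: either it has stopped, or it sends message `msg j` to
each player `j` and asks the issuer to restart if `ask = true`. -/
inductive Move (n : ℕ) where
  | halt
  | play (msg : Fin n → Msg n) (ask : Bool)
  deriving DecidableEq

/-- The message that is sent to player `j`. -/
def Move.msgTo {n : ℕ} : Move n → Fin n → Msg n
  | .halt, _ => Msg.empty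
  | .play msg _, j => msg j

/-- Whether the issuer is asked to restart. -/
def Move.asks {n : ℕ} : Move n → Bool
  | .halt => false
  | .play _ ask => ask

instance (n : ℕ) : Countable (Msg n) :=
  Function.Injective.countable (f := fun x : Msg n => (x.bit, x.pieces)) (by
    rintro ⟨a, b⟩ ⟨c, d⟩ h
    simpa using h)

instance (n : ℕ) : Countable (Move n) :=
  Function.Injective.countable
    (f := fun a : Move n => match a with
      | .halt => (none : Option ((Fin n → Msg n) × Bool))
      | .play msg ask => some (msg, ask)) (by
    rintro (_ | ⟨a, b⟩) (_ | ⟨c, d⟩) h <;> simp_all)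

instance (n : ℕ) : MeasurableSpace (Move n) := ⊤

instance (n : ℕ) : DiscreteMeasurableSpace (Move n) := ⟨fun _ => trivial⟩

/-- The actions of all players in one round. -/
abbrev Profile (n : ℕ) := Fin n → Move n

/-- A run of infinitely many rounds. -/
abbrev Run (n : ℕ) := ℕ → Profile n

/-- What a player sees in one round: its own action, the messages that it receives, and whether
the issuer restarts. -/
structure Obs (n : ℕ) where
  own : Move n
  recv : Fin n → Msg n
  restart : Bool

/-- A local state of a player, in chronological order. -/
abbrev View (n : ℕ) := List (Obs n)

/-- What player `i` sees in a round. -/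
def observe {n : ℕ} (i : Fin n) (a : Profile n) : Obs n where
  own := a i
  recv := fun k => (a k).msgTo i
  restart := decide (∀ k, (a k).asks = true)

/-- The local state of player `i` after the rounds in `h`. -/
def view {n : ℕ} (i : Fin n) (h : List (Profile n)) : View n := h.map (observe i)

/-- The rounds of a local state that belong to the current sharing. -/
def current {n : ℕ} (v : View n) : View n :=
  v.foldl (fun w o => if o.restart then [] else w ++ [o]) []

/-- The number of the current sharing, counted from `0`. -/
def sharing {n : ℕ} (v : View n) : ℕ := v.countP (fun o => o.restart)

/-- Player `i` with local state `v` has received its share in sharing `s`. -/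
def Issued {n : ℕ} (v : View n) (s : ℕ) : Prop :=
  s < sharing v ∨ (s = sharing v ∧ current v ≠ [])

/-- Player `i` with local state `v` has the piece `x` of sharing `s`. -/
def Holds {n : ℕ} (m : ℕ) (i : Fin n) (v : View n) (s : ℕ) (x : Piece n) : Prop :=
  (Issued v s ∧ Initial m i x) ∨ ∃ o ∈ v, ∃ k, (s, x) ∈ (o.recv k).pieces

/-- Player `i` with local state `v` can compute the secret: it can recover at least `m` shares
of one sharing. -/
def Knows {n : ℕ} (m : ℕ) (i : Fin n) (v : View n) : Prop :=
  ∃ s, m ≤ {k | Recovers {x | Holds m i v s x} k}.ncard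

/-- The players are divided into three groups by their number modulo `3`, and players `0, 1, 2`
are the leaders of their groups. The pieces that `i` may send to `j`, provided that `i` has them:
for `m ≥ 3`, its own share, and, if `i` is a leader, the shares of the designated players
`k < m` of its group; for `m = 2`, the subshares belonging to `i`, or to a member of its group if
`i` is a leader, and the subshares of the share of `i` to the players to whom they belong. -/
def Permitted {n : ℕ} (m : ℕ) (i j : Fin n) : Piece n → Prop
  | .share k => 3 ≤ m ∧ (k = i ∨ (i.val < 3 ∧ k.val % 3 = i.val ∧ k.val < m))
  | .sub d k => m = 2 ∧ (k = i ∨ (i.val < 3 ∧ k.val % 3 = i.val) ∨ (d.val = i.val ∧ k = j))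

instance {n : ℕ} (m : ℕ) (i j : Fin n) : DecidablePred (Permitted m i j) := fun x => by
  cases x <;> unfold Permitted <;> infer_instance

instance {n : ℕ} (v : View n) (s : ℕ) : Decidable (Issued v s) := by
  unfold Issued
  have : Decidable (current v ≠ []) := decidable_of_iff (¬ (current v).isEmpty = true) (by simp)
  infer_instance

instance {n : ℕ} (m : ℕ) (i : Fin n) (v : View n) (s : ℕ) (x : Piece n) :
    Decidable (Holds m i v s x) := by
  unfold Holds
  infer_instance

/-- The actions that are available to player `i` with local state `v`. -/
def Legal {n : ℕ} (m : ℕ) (i : Fin n) (v : View n) : Move n → Prop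
  | .halt => True
  | .play msg _ => (∀ o ∈ v, o.own ≠ Move.halt) ∧ msg i = Msg.empty ∧
      ∀ j, ∀ y ∈ (msg j).pieces, Holds m i v y.1 y.2 ∧ Permitted m i j y.2

/-- A (randomized) strategy of player `i`: a function from local states to distributions over
available actions. -/
def Strategy (n m : ℕ) (i : Fin n) : Type :=
  {f : View n → PMF (Move n) // ∀ v, ∀ a ∈ (f v).support, Legal m i v a}

/-- The first `t` rounds of a run. -/
def hist {n : ℕ} (r : Run n) (t : ℕ) : List (Profile n) := (List.range t).map r

/-- `r` is a run of the game. -/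
def IsRun {n : ℕ} (m : ℕ) (r : Run n) : Prop :=
  ∀ t i, Legal m i (view i (hist r t)) (r t i)

/-- Player `i` learns the secret in the run `r`. -/
def Learns {n : ℕ} (m : ℕ) (r : Run n) (i : Fin n) : Prop :=
  ∃ t, Knows m i (view i (hist r t))

/-- The distribution of the action profile that `σ` chooses after the rounds in `h`; the players
randomize independently. -/
noncomputable def stepMeasure {n m : ℕ} (σ : ∀ i, Strategy n m i) (h : List (Profile n)) :
    Measure (Profile n) :=
  Measure.pi fun i => ((σ i).1 (view i h)).toMeasure

instance {n m : ℕ} (σ : ∀ i, Strategy n m i) (h : List (Profile n)) :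
    IsProbabilityMeasure (stepMeasure σ h) := by
  unfold stepMeasure
  infer_instance

/-- The transition from the rounds `0, …, t` to round `t + 1`. -/
noncomputable def stepKernel {n m : ℕ} (σ : ∀ i, Strategy n m i) (t : ℕ) :
    Kernel (∀ _ : Finset.Iic t, Profile n) (Profile n) where
  toFun x := stepMeasure σ
    ((List.finRange (t + 1)).map fun k => x ⟨k.val, Finset.mem_Iic.2 (Nat.lt_succ_iff.1 k.2)⟩)
  measurable' := Measurable.of_discrete

instance {n m : ℕ} (σ : ∀ i, Strategy n m i) (t : ℕ) : IsMarkovKernel (stepKernel σ t) :=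
  ⟨fun _ => by
    change IsProbabilityMeasure (stepMeasure σ _)
    infer_instance⟩

/-- The distribution over runs that is determined by a joint strategy. -/
noncomputable def runMeasure {n m : ℕ} (σ : ∀ i, Strategy n m i) : Measure (Run n) :=
  Kernel.trajMeasure (X := fun _ => Profile n) (stepMeasure σ []) (stepKernel σ)

/-- The expected utility of player `i` if `σ` is played and `u i r` is its utility of run `r`. -/
noncomputable def expectedUtility {n : ℕ} (m : ℕ) (u : Fin n → Run n → ℝ) (i : Fin n)
    (σ : ∀ i, Strategy n m i) : ℝ :=
  ∫ r, u i r ∂runMeasure σ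

/-- The number of rounds of a run up to and including the first round in which all players have
stopped. -/
noncomputable def runningTime {n : ℕ} (r : Run n) : ENNReal :=
  ⨅ (t : ℕ) (_ : ∀ i, r t i = Move.halt), ((t + 1 : ℕ) : ENNReal)

/-! ### Assumptions on the utilities -/

/-- The utility of a run depends only on which players learn the secret. -/
def U1 {n : ℕ} (m : ℕ) (u : Fin n → Run n → ℝ) : Prop :=
  ∀ i r r', IsRun m r → IsRun m r' → (∀ j, Learns m r j ↔ Learns m r' j) → u i r = u i r'

/-- Every player prefers learning the secret to not learning it. -/
def U2 {n : ℕ} (m : ℕ) (u : Fin n → Run n → ℝ) : Prop :=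
  ∀ i r r', IsRun m r → IsRun m r' → Learns m r i → ¬ Learns m r' i → u i r' < u i r

/-- Every player prefers that fewer of the other players learn the secret. -/
def U3 {n : ℕ} (m : ℕ) (u : Fin n → Run n → ℝ) : Prop :=
  ∀ i r r', IsRun m r → IsRun m r' → (Learns m r i ↔ Learns m r' i) →
    (∀ j, j ≠ i → Learns m r j → Learns m r' j) →
    (∃ j, j ≠ i ∧ ¬ Learns m r j ∧ Learns m r' j) → u i r' < u i r

/-! ### The recommended strategy

A sharing is used for five rounds, the steps `0, …, 4`. In step `0` the shares are issued. The
leaders `0, 1, 2` run the coin tossing protocol, where `i⁺` is `i + 1` modulo `3` and `i⁻` is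
`i + 2` modulo `3`. -/

/-- The pieces that player `k` contributes to sharing `s`. -/
def contribution {n : ℕ} (m s : ℕ) (k : Fin n) : Finset (ℕ × Piece n) :=
  if m = 2 then {(s, Piece.sub 0 k), (s, Piece.sub 1 k)}
  else if k.val < m then {(s, Piece.share k)} else ∅

/-- The pieces that the group of leader `i` contributes to sharing `s`. -/
def bundle {n : ℕ} (m s : ℕ) (i : Fin n) : Finset (ℕ × Piece n) :=
  (Finset.univ.filter fun k : Fin n => k.val % 3 = i.val).biUnion (contribution m s)

/-- The subshare of its share that player `i` deals to player `j` in sharing `s` when `m = 2`. -/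
def dealt {n : ℕ} (m s : ℕ) (i j : Fin n) : Finset (ℕ × Piece n) :=
  if h : m = 2 ∧ i.val < 2 ∧ j ≠ i then {(s, Piece.sub ⟨i.val, h.2.1⟩ j)} else ∅

/-- The bit received from player number `k` (`false` if there is none). -/
def Obs.bitFrom {n : ℕ} (o : Obs n) (k : ℕ) : Bool :=
  if h : k < n then ((o.recv ⟨k, h⟩).bit).getD false else false

/-- The bit sent to player number `k` (`false` if there is none). -/
def Obs.bitTo {n : ℕ} (o : Obs n) (k : ℕ) : Bool :=
  if h : k < n then ((o.own.msgTo ⟨k, h⟩).bit).getD false else false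

/-- The bit `c_i` of leader `i`: the exclusive or of the two bits that it sent in step `1`. -/
def coinOf {n : ℕ} (i : Fin n) (o₁ : Obs n) : Bool :=
  xor (o₁.bitTo ((i.val + 1) % 3)) (o₁.bitTo ((i.val + 2) % 3))

/-- The exclusive or of the three bits as computed by leader `i` from steps `1` and `2`. -/
def parityOf {n : ℕ} (i : Fin n) (o₁ o₂ : Obs n) : Bool :=
  xor (xor (o₁.bitFrom ((i.val + 2) % 3)) (o₂.bitFrom ((i.val + 1) % 3))) (coinOf i o₁)

/-- What player `i` may receive in step `c.length` of sharing `s` from players who follow the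
protocol, where `c` are the previous steps of this sharing. -/
def Expected {n : ℕ} (m : ℕ) (i : Fin n) (s : ℕ) (c : View n) (o : Obs n) : Prop :=
  ∀ k, k ≠ i →
    match c.length with
    | 1 => ((o.recv k).bit.isSome = true ↔ i.val < 3 ∧ k.val < 3) ∧
        (o.recv k).pieces = dealt m s k i
    | 2 => ((o.recv k).bit.isSome = true ↔
          i.val < 3 ∧ k.val < 3 ∧ k.val = (i.val + 1) % 3) ∧
        (o.recv k).pieces =
          if i.val < 3 ∧ k.val % 3 = i.val then contribution m s k else ∅
    | 3 => ((o.recv k).bit.isSome = true ↔ ¬ i.val < 3 ∧ k.val < 3) ∧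
        ((o.recv k).pieces = ∅ ∨ (k.val < 3 ∧ (o.recv k).pieces = bundle m s k))
    | _ => o.recv k = Msg.empty

instance {n : ℕ} (m : ℕ) (i : Fin n) (s : ℕ) (c : View n) (o : Obs n) :
    Decidable (Expected m i s c o) := by
  unfold Expected
  have h : ∀ k : Fin n, Decidable (
    match c.length with
    | 1 => ((o.recv k).bit.isSome = true ↔ i.val < 3 ∧ k.val < 3) ∧
        (o.recv k).pieces = dealt m s k i
    | 2 => ((o.recv k).bit.isSome = true ↔
          i.val < 3 ∧ k.val < 3 ∧ k.val = (i.val + 1) % 3) ∧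
        (o.recv k).pieces =
          if i.val < 3 ∧ k.val % 3 = i.val then contribution m s k else ∅
    | 3 => ((o.recv k).bit.isSome = true ↔ ¬ i.val < 3 ∧ k.val < 3) ∧
        ((o.recv k).pieces = ∅ ∨ (k.val < 3 ∧ (o.recv k).pieces = bundle m s k))
    | _ => o.recv k = Msg.empty) := fun k => by split <;> infer_instance
  infer_instance

/-- Every round recorded in `v` was as expected. -/
def Clean {n : ℕ} (m : ℕ) (i : Fin n) (v : View n) : Prop :=
  ∀ t : Fin v.length, Expected m i (sharing (v.take t)) (current (v.take t)) (v.get t)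

instance {n : ℕ} (m : ℕ) (i : Fin n) (v : View n) : Decidable (Clean m i v) := by
  unfold Clean
  infer_instance

/-- The number of groups whose pieces were sent in step `3`, as seen by player `i`; a leader
counts itself if it sent the pieces of its own group. -/
def bundlesSeen {n : ℕ} (i : Fin n) (o₁ o₂ o₃ : Obs n) : ℕ :=
  (Finset.univ.filter fun k : Fin n => k.val < 3 ∧
    if k = i then (coinOf i o₁ && parityOf i o₁ o₂) = true
    else (o₃.recv k).pieces ≠ ∅).card

/-- The request of player `i` in step `4`. A leader uses the exclusive or `p` that it has computed;
another player uses the common value of the bits that the three leaders sent to it in step `3`. -/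
def wantsRestart {n : ℕ} (i : Fin n) (o₁ o₂ o₃ : Obs n) : Bool :=
  let p := if i.val < 3 then parityOf i o₁ o₂ else o₃.bitFrom 0
  decide ((i.val < 3 ∨ (o₃.bitFrom 1 = p ∧ o₃.bitFrom 2 = p)) ∧
    bundlesSeen i o₁ o₂ o₃ = if p then 1 else 0)

/-- The action of sending `f j` to each other player `j`, without the pieces that `i` cannot
send; a player that has stopped does nothing. -/
def sendAll {n : ℕ} (m : ℕ) (i : Fin n) (v : View n) (f : Fin n → Msg n) (ask : Bool) :
    Move n :=
  if (∀ o ∈ v, o.own ≠ Move.halt) then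
    Move.play (fun j => if j = i then Msg.empty else
      ⟨(f j).bit, (f j).pieces.filter fun y => Holds m i v y.1 y.2 ∧ Permitted m i j y.2⟩) ask
  else Move.halt

theorem legal_sendAll {n : ℕ} (m : ℕ) (i : Fin n) (v : View n) (f : Fin n → Msg n)
    (ask : Bool) : Legal m i v (sendAll m i v f ask) := by
  unfold sendAll
  split_ifs with h
  · refine ⟨h, by simp, fun j y hy => ?_⟩
    by_cases hj : j = i
    · simp [hj, Msg.empty] at hy
    · simp only [hj, if_false, Finset.mem_filter] at hy
      exact hy.2
  · trivial

/-- The recommended action of player `i` with local state `v`, where `c` and `b` are the values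
of the random bits `c_i` and `c_(i,+)` of a leader; they are used in step `1` only. -/
def protocolAction {n : ℕ} (m : ℕ) (i : Fin n) (v : View n) (c b : Bool) : Move n :=
  let s := sharing v
  if Clean m i v then
    match current v with
    -- step 0: the issuer issues the shares
    | [] => sendAll m i v (fun _ => Msg.empty) false
    -- step 1: the leaders send their bits; if `m = 2`, players 0 and 1 deal their subshares
    | [_] => sendAll m i v (fun j =>
        ⟨if i.val < 3 ∧ j.val = (i.val + 1) % 3 then some b
          else if i.val < 3 ∧ j.val = (i.val + 2) % 3 then some (xor c b) else none,
          dealt m s i j⟩) false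
    -- step 2: leader `i` sends a bit to `i⁻`; the other players send their pieces to their leader
    | [_, o₁] => sendAll m i v (fun j =>
        ⟨if i.val < 3 ∧ j.val = (i.val + 2) % 3 then
            some (xor (o₁.bitFrom ((i.val + 1) % 3)) (coinOf i o₁)) else none,
          if ¬ i.val < 3 ∧ j.val = i.val % 3 then contribution m s i else ∅⟩) false
    -- step 3: a leader with `p = c_i = 1` sends the pieces of its group to everyone; the leaders
    -- tell the other players the value of `p`
    | [_, o₁, o₂] => sendAll m i v (fun j =>
        ⟨if i.val < 3 ∧ ¬ j.val < 3 then some (parityOf i o₁ o₂) else none,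
          if i.val < 3 ∧ (coinOf i o₁ && parityOf i o₁ o₂) = true then bundle m s i else ∅⟩)
        false
    -- step 4: ask for a restart, or stop
    | [_, o₁, o₂, o₃] =>
        if wantsRestart i o₁ o₂ o₃ then sendAll m i v (fun _ => Msg.empty) true else Move.halt
    | _ => Move.halt
  else Move.halt

theorem legal_protocolAction {n : ℕ} (m : ℕ) (i : Fin n) (v : View n) (c b : Bool) :
    Legal m i v (protocolAction m i v c b) := by
  unfold protocolAction
  dsimp only
  split_ifs
  · split
    any_goals exact legal_sendAll ..
    · split_ifs
      · exact legal_sendAll ..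
      · trivial
    · trivial
  · trivial

/-- A coin that shows `true` with probability `α`. -/
noncomputable def coin (α : unitInterval) : PMF Bool :=
  PMF.ofFintype (fun b => ENNReal.ofReal (if b then (α : ℝ) else 1 - α)) (by
    rw [Fintype.sum_bool]
    simp only [if_true, Bool.false_eq_true, if_false]
    rw [← ENNReal.ofReal_add α.2.1 (by linarith [α.2.2])]
    simp)

/-- The fair coin parameter. -/
noncomputable def half : unitInterval := ⟨1 / 2, by norm_num, by norm_num⟩

/-- The recommended joint strategy of the mechanism `M(α)` for `m` out of `n` secret sharing. -/
noncomputable def recommended (n m : ℕ) (α : unitInterval) (i : Fin n) : Strategy n m i :=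
  ⟨fun v => (coin α).bind fun c => (coin half).bind fun b => PMF.pure (protocolAction m i v c b),
    fun v a ha => by
      simp only [PMF.mem_support_bind_iff, PMF.mem_support_pure_iff] at ha
      obtain ⟨c, -, b, -, rfl⟩ := ha
      exact legal_protocolAction m i v c b⟩

/-! Survival. Call a strategy discreet if its player does nothing noticeable any more once it knows
the secret. All discreet strategies survive together, by induction on the number of deletion rounds
(`Discreet.survives`). The inductive step is a dichotomy (`Discreet.dichotomy`): compared with any
rival `τ`, a discreet `σ` is either at least as good whatever the others do, or strictly better
against some discreet strategies of the others, which are still available by the induction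
hypothesis.

The dichotomy rests on two ways to write a script for the others. Reward (`exists_reward`): if `σ`
shows some behaviour with higher probability than `τ` before `i` knows the secret, the others
provoke this behaviour, confirm to each other that they have seen it, and then reveal the secret to
`i` alone. If nothing can be rewarded, the behaviours of `σ` and `τ` have equal probabilities, since
they have the same sum, until `i` knows the secret and `τ` might be noisy. Punishment
(`exists_punishment`): if under `σ` others may still learn the secret after that point, a script
that answers the noise of `τ` by revealing all pieces to everybody but `i` hurts `τ` and never `σ`.
If neither is possible, stop the run where `τ` might be noisy: the stopped run has the same
distribution under both strategies, stopping does not change who learns under `σ`, and by U3 it is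
no worse for `i` than going on with `τ` (`expectedUtility_compare`). The scripts are safe because of
a combinatorial fact, `recovered_lt`: one's own pieces, the pieces that one may pass on, and those
from a single other source never suffice. The same fact shows that the recommended strategy is
discreet: whoever has seen the pieces of two groups stops.

Equilibrium. A deviator `i` learns the secret only if two leaders `a` and `b = a⁺` other than `i`
send the pieces of their groups in the same sharing, so both of their coins are `1` and `p = 1`.
Negate both coins by changing only bits exchanged between `a` and `b`. Then `p` and everything that
the other players see before step `3` stay the same, while the probability changes from a multiple
of `α ^ 2` to the same multiple of `(1 - α) ^ 2`. In the flipped run `a` and `b` send no pieces. If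
all players but `i` still ask for a restart, the third leader has sent its pieces, and then all of
them know the secret in the original run. Otherwise there is no further sharing and `i` never learns
the secret. So a success in which somebody else is left out is rarer than a failure by a factor of
order `α ^ 2` (`measure_gain_le`), and for small `α` a deviation does not pay.

Running time. In honest play a sharing is the last one exactly if all three coins show `1`, which
has probability `α ^ 3`. The number of sharings is geometric, and each takes five rounds. -/

/-! ### The distribution over runs, described by the weights of finite histories -/

section Trajectories

variable {n m : ℕ}

@[simp] theorem hist_length (r : Run n) (t : ℕ) : (hist r t).length = t := by simp [hist]

@[simp] theorem hist_zero (r : Run n) : hist r 0 = [] := rfl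

theorem hist_succ (r : Run n) (t : ℕ) : hist r (t + 1) = hist r t ++ [r t] := by
  simp [hist, List.range_succ]

theorem hist_take (r : Run n) {s t : ℕ} (h : s ≤ t) : (hist r t).take s = hist r s := by
  simp [hist, ← List.map_take, List.take_range, h]

theorem hist_getElem (r : Run n) {s t : ℕ} (h : s < t) :
    (hist r t)[s]'(by simpa using h) = r s := by
  simp [hist]

theorem measurableSet_hist (t : ℕ) (A : Set (List (Profile n))) :
    MeasurableSet {r : Run n | hist r t ∈ A} := by
  have h : {r : Run n | hist r t ∈ A} =
      (fun (r : Run n) (k : Fin t) => r k) ⁻¹'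
        {x | (List.finRange t).map x ∈ A} := by
    ext r
    have : hist r t = (List.finRange t).map fun k : Fin t => r k := by
      rw [hist]
      apply List.ext_getElem <;> simp
    simp [this]
  rw [h]
  exact (measurable_pi_lambda _ fun k => measurable_pi_apply _) (MeasurableSet.of_discrete)

/-- The probability that `σ` chooses the profile `p` after the rounds in `h`. -/
noncomputable def stepProb (σ : ∀ i, Strategy n m i) (h : List (Profile n)) (p : Profile n) :
    ENNReal := ∏ j, (σ j).1 (view j h) (p j)

theorem stepMeasure_singleton (σ : ∀ i, Strategy n m i) (h : List (Profile n)) (p : Profile n) :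
    stepMeasure σ h {p} = stepProb σ h p := by
  rw [stepMeasure, Measure.pi_singleton]
  simp [stepProb, PMF.toMeasure_apply_singleton]

instance (σ : ∀ i, Strategy n m i) : IsProbabilityMeasure (runMeasure σ) := by
  unfold runMeasure
  infer_instance

/-- The probability that the play begins with the rounds in `h`. -/
noncomputable def weight (σ : ∀ i, Strategy n m i) (h : List (Profile n)) : ENNReal :=
  runMeasure σ {r | hist r h.length = h}

theorem weight_nil (σ : ∀ i, Strategy n m i) : weight σ [] = 1 := by
  simp [weight]

theorem weight_singleton (σ : ∀ i, Strategy n m i) (p : Profile n) :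
    weight σ [p] = stepProb σ [] p := by
  have hmap : (runMeasure σ).map (fun r => r 0) = stepMeasure σ [] := by
    rw [runMeasure, Kernel.trajMeasure]
    have h0 : (fun r : Run n => r 0) =
        (fun x : (∀ _ : Finset.Iic 0, Profile n) => x ⟨0, by simp⟩) ∘ Preorder.frestrictLe 0 := by
      ext r; rfl
    rw [h0, ← Measure.map_map (by fun_prop) (by fun_prop), Measure.map_comp _ _ (by fun_prop),
      Kernel.traj_map_frestrictLe, Kernel.partialTraj_self, Measure.id_comp,
      Measure.map_map (by fun_prop) (by fun_prop)]
    convert Measure.map_id (μ := stepMeasure σ [])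
    ext r
    rfl
  rw [← stepMeasure_singleton, ← hmap, Measure.map_apply (by fun_prop) (.of_discrete)]
  simp [weight, hist]
  rfl

/-- The chain rule. The kernel with index `t` conditions on the `t + 1` rounds `0, …, t`, so the
empty history has no kernel and is treated separately. -/
theorem weight_append_singleton (σ : ∀ i, Strategy n m i) (h : List (Profile n)) (p : Profile n) :
    weight σ (h ++ [p]) = weight σ h * stepProb σ h p := by
  rcases Nat.eq_zero_or_pos h.length with h0 | h0
  · obtain rfl := List.length_eq_zero_iff.1 h0
    rw [List.nil_append, weight_singleton, weight_nil, one_mul]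
  obtain ⟨t, ht⟩ : ∃ t, h.length = t + 1 := ⟨h.length - 1, by omega⟩
  let x : ∀ _ : Finset.Iic t, Profile n := fun k =>
    h[k.1]'(by have := Finset.mem_Iic.1 k.2; omega)
  have key := @Kernel.map_frestrictLe_trajMeasure_compProd_eq_map_trajMeasure
    (fun _ => Profile n) _ (stepKernel σ) _ (stepMeasure σ []) _ t
  have key2 := congrArg (fun μ => μ ({x} ×ˢ {p})) key
  rw [Measure.compProd_apply_prod (.of_discrete) (.of_discrete),
    Measure.map_apply (by fun_prop) (.of_discrete), lintegral_singleton,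
    Measure.map_apply (by fun_prop) (.of_discrete)] at key2
  have hx : ∀ r : Run n, Preorder.frestrictLe (π := fun _ => Profile n) t r = x ↔
      hist r (t + 1) = h := by
    intro r
    constructor
    · intro hr
      apply List.ext_getElem (by simp [ht])
      intro k h1 h2
      have := congrFun hr ⟨k, Finset.mem_Iic.2 (by omega)⟩
      rw [hist_getElem r (by omega)]
      exact this
    · rintro hr
      ext1 ⟨k, hk⟩
      have := Finset.mem_Iic.1 hk
      have h3 : r k = h[k]'(by omega) := by
        rw [← hist_getElem r (s := k) (t := t + 1) (by omega)]
        simp [hr]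
      exact h3
  have hstep : stepKernel σ t x = stepMeasure σ h := by
    change stepMeasure σ _ = _
    congr 1
    apply List.ext_getElem (by simp [ht])
    intro k h1 h2
    simp [x]
  rw [hstep, stepMeasure_singleton, mul_comm] at key2
  rw [weight, weight]
  have e1 : {r : Run n | hist r (h ++ [p]).length = h ++ [p]} =
      (fun r : Run n => (Preorder.frestrictLe (π := fun _ => Profile n) t r, r (t + 1))) ⁻¹'
        {x} ×ˢ {p} := by
    ext r
    simp only [Set.mem_ofPred_eq, Set.mem_preimage, Set.mem_prod, Set.mem_singleton_iff, hx]
    rw [List.length_append, ht, List.length_singleton, hist_succ]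
    constructor
    · intro h
      have := List.append_inj h (by simp [ht])
      simpa using this
    · rintro ⟨h, h'⟩
      rw [h, h']
  have e2 : {r : Run n | hist r h.length = h} =
      Preorder.frestrictLe (π := fun _ => Profile n) t ⁻¹' {x} := by
    ext r
    simp [hx, ht]
  rw [e1, e2]
  exact key2.symm

theorem weight_eq (σ : ∀ i, Strategy n m i) {t : ℕ} {h : List (Profile n)} (ht : h.length = t) :
    runMeasure σ {r | hist r t = h} = weight σ h := by
  rw [weight, ht]

open Classical in
theorem measure_hist_mem (σ : ∀ i, Strategy n m i) (t : ℕ) (A : Set (List (Profile n))) :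
    runMeasure σ {r | hist r t ∈ A} =
      ∑' h, if h.length = t ∧ h ∈ A then weight σ h else 0 := by
  have : {r : Run n | hist r t ∈ A} = ⋃ h : List (Profile n), {r | hist r t = h ∧ h ∈ A} := by
    ext r; simp
  rw [this, measure_iUnion]
  · congr 1
    ext h
    split_ifs with hh
    · simp [hh.2, weight_eq σ hh.1]
    · convert measure_empty (μ := runMeasure σ)
      ext r
      simp only [Set.mem_ofPred_eq, Set.mem_empty_iff_false, iff_false]
      rintro ⟨h1, h2⟩
      exact hh ⟨by rw [← h1]; simp, h2⟩
  · intro h h' hne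
    refine Set.disjoint_left.2 ?_
    rintro r ⟨h1, -⟩ ⟨h2, -⟩
    exact hne (h1.symm.trans h2)
  · intro h
    have := measurableSet_hist (n := n) t {h' | h' = h ∧ h ∈ A}
    convert this using 1
    ext r
    simp

/-- The events that depend on an initial segment form a π-system that generates the product
σ-algebra. As there are only countably many histories, single histories are enough. -/
theorem runMeasure_ext {μ ν : Measure (Run n)} [IsProbabilityMeasure μ] [IsProbabilityMeasure ν]
    (h : ∀ t (g : List (Profile n)), g.length = t →
      μ {r | hist r t = g} = ν {r | hist r t = g}) : μ = ν := by
  have hA : ∀ t (A : Set (List (Profile n))),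
      μ {r | hist r t ∈ A} = ν {r | hist r t ∈ A} := by
    intro t A
    have e : {r : Run n | hist r t ∈ A} = ⋃ g : A, {r | hist r t = g.1} := by
      ext r; simp
    have hd : Pairwise (Function.onFun Disjoint fun g : A => {r : Run n | hist r t = g.1}) := by
      intro g g' hne
      refine Set.disjoint_left.2 fun r h1 h2 => hne (Subtype.ext (h1.symm.trans h2))
    have hm : ∀ g : A, MeasurableSet {r : Run n | hist r t = g.1} :=
      fun g => measurableSet_hist t {g.1}
    rw [e, measure_iUnion hd hm, measure_iUnion hd hm]
    congr 1
    ext g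
    by_cases hg : g.1.length = t
    · exact h t g.1 hg
    · have : {r : Run n | hist r t = g.1} = ∅ := by
        ext r
        simp only [Set.mem_ofPred_eq, Set.mem_empty_iff_false, iff_false]
        rintro h1
        exact hg (by rw [← h1]; simp)
      simp [this]
  refine ext_of_generate_finite {S : Set (Run n) |
    ∃ (t : ℕ) (A : Set (List (Profile n))), S = {r : Run n | hist r t ∈ A}} ?_ ?_ ?_ ?_
  · apply le_antisymm
    · refine iSup_le fun k => ?_
      rintro _ ⟨B, -, rfl⟩
      refine MeasurableSpace.measurableSet_generateFrom
        ⟨k + 1, {g : List (Profile n) | ∃ p ∈ B, g.getLast? = some p}, ?_⟩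
      ext r
      simp [hist_succ]
    · refine MeasurableSpace.generateFrom_le ?_
      rintro _ ⟨t, A, rfl⟩
      exact measurableSet_hist t A
  · rintro _ ⟨t, A, rfl⟩ _ ⟨t', A', rfl⟩ -
    refine ⟨max t t', {g : List (Profile n) | g.take t ∈ A ∧ g.take t' ∈ A'}, ?_⟩
    ext r
    simp [hist_take]
  · rintro _ ⟨t, A, rfl⟩
    exact hA t A
  · simp

/-- Every initial segment of the run has positive probability. -/
def Positive (σ : ∀ i, Strategy n m i) (r : Run n) : Prop := ∀ t, weight σ (hist r t) ≠ 0

/-- There are countably many histories, so those of weight zero form a null set. Almost sure claims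
thus become claims about individual runs that are legal and in which every move lies in the support
of the strategy. -/
theorem ae_positive (σ : ∀ i, Strategy n m i) : ∀ᵐ r ∂runMeasure σ, Positive σ r := by
  rw [Positive.eq_1 (σ := σ) |> funext, ae_all_iff]
  intro t
  rw [ae_iff]
  have := measure_hist_mem σ t {h | ¬ weight σ h ≠ 0}
  refine this.trans ?_
  simp

theorem Positive.step {σ : ∀ i, Strategy n m i} {r : Run n} (h : Positive σ r) (t : ℕ) (j : Fin n) :
    r t j ∈ ((σ j).1 (view j (hist r t))).support := by
  have h1 := h (t + 1)
  rw [hist_succ, weight_append_singleton] at h1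
  have h2 := right_ne_zero_of_mul h1
  rw [stepProb, Finset.prod_ne_zero_iff] at h2
  exact (PMF.mem_support_iff _ _).2 (h2 j (Finset.mem_univ _))

theorem Positive.isRun {σ : ∀ i, Strategy n m i} {r : Run n} (h : Positive σ r) : IsRun m r :=
  fun t i => (σ i).2 _ _ (h.step t i)

end Trajectories

/-! ### Which pieces a player can have, and when they do not suffice -/

section Knowledge

variable {n m : ℕ}

/-- The pieces that player `i` may send to somebody. -/
def Sendable (m : ℕ) (i : Fin n) (x : Piece n) : Prop := ∃ j, Permitted m i j x

/-- Whether the issuer restarts when the actions are `p`. -/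
def restarts (p : Profile n) : Bool := decide (∀ k, (p k).asks = true)

/-- The number of restarts in the first `t` rounds. -/
def sharingAt (r : Run n) (t : ℕ) : ℕ := (hist r t).countP restarts

/-- The rounds before round `t` that belong to the current sharing. -/
def currentAt (r : Run n) (t : ℕ) : List (Profile n) :=
  (hist r t).foldl (fun w p => if restarts p then [] else w ++ [p]) []

/-- Sharing `s` has been issued before round `t`. -/
def IssuedAt (r : Run n) (t s : ℕ) : Prop :=
  s < sharingAt r t ∨ (s = sharingAt r t ∧ currentAt r t ≠ [])

/-- Player `i` has received the piece `x` of sharing `s` before round `t`. -/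
def Got (r : Run n) (i : Fin n) (t s : ℕ) (x : Piece n) : Prop :=
  ∃ t' < t, ∃ k, (s, x) ∈ ((r t' k).msgTo i).pieces

theorem view_append (i : Fin n) (h h' : List (Profile n)) :
    view i (h ++ h') = view i h ++ view i h' := by simp [view]

theorem view_singleton (i : Fin n) (p : Profile n) : view i [p] = [observe i p] := rfl

@[simp] theorem view_length (i : Fin n) (h : List (Profile n)) : (view i h).length = h.length := by
  simp [view]

theorem sharing_view (i : Fin n) (r : Run n) (t : ℕ) :
    sharing (view i (hist r t)) = sharingAt r t := by
  simp only [sharing, view, sharingAt, List.countP_map]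
  rfl

theorem current_nil : current ([] : View n) = [] := rfl

theorem current_append_singleton (v : View n) (o : Obs n) :
    current (v ++ [o]) = if o.restart then [] else current v ++ [o] := by
  simp [current]

theorem sharing_append_singleton (v : View n) (o : Obs n) :
    sharing (v ++ [o]) = sharing v + if o.restart then 1 else 0 := by
  simp [sharing, List.countP_append, List.countP_singleton]

theorem currentAt_zero (r : Run n) : currentAt r 0 = [] := rfl

theorem currentAt_succ (r : Run n) (t : ℕ) :
    currentAt r (t + 1) = if restarts (r t) then [] else currentAt r t ++ [r t] := by
  simp [currentAt, hist_succ]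

theorem sharingAt_zero (r : Run n) : sharingAt r 0 = 0 := rfl

theorem sharingAt_succ (r : Run n) (t : ℕ) :
    sharingAt r (t + 1) = sharingAt r t + if restarts (r t) then 1 else 0 := by
  simp [sharingAt, hist_succ, List.countP_append, List.countP_singleton]

theorem sharingAt_mono (r : Run n) : Monotone (sharingAt r) :=
  monotone_nat_of_le_succ fun t => by rw [sharingAt_succ]; omega

theorem current_view (i : Fin n) (r : Run n) (t : ℕ) :
    current (view i (hist r t)) = (currentAt r t).map (observe i) := by
  induction t with
  | zero => rfl
  | succ t ih =>
    rw [hist_succ, view_append, view_singleton, current_append_singleton, currentAt_succ, ih]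
    change (if restarts (r t) then _ else _) = _
    split_ifs <;> simp

theorem issued_view (i : Fin n) (r : Run n) (t s : ℕ) :
    Issued (view i (hist r t)) s ↔ IssuedAt r t s := by
  simp [Issued, IssuedAt, sharing_view, current_view]

theorem IssuedAt.succ {r : Run n} {t s : ℕ} (h : IssuedAt r t s) : IssuedAt r (t + 1) s := by
  unfold IssuedAt at *
  rw [sharingAt_succ, currentAt_succ]
  split_ifs
  · left; omega
  · simpa [and_comm] using h.imp_right fun h => h.1

theorem IssuedAt.mono {r : Run n} {t t' s : ℕ} (h : IssuedAt r t s) (htt : t ≤ t') :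
    IssuedAt r t' s := by
  induction t', htt using Nat.le_induction with
  | base => exact h
  | succ t' _ ih => exact ih.succ

theorem Got.mono {r : Run n} {i : Fin n} {t t' s : ℕ} {x : Piece n} (h : Got r i t s x)
    (htt : t ≤ t') : Got r i t' s x := by
  obtain ⟨u, hu, h⟩ := h
  exact ⟨u, by omega, h⟩

theorem holds_view (i : Fin n) (r : Run n) (t s : ℕ) (x : Piece n) :
    Holds m i (view i (hist r t)) s x ↔ (IssuedAt r t s ∧ Initial m i x) ∨ Got r i t s x := by
  unfold Holds Got
  rw [issued_view]
  refine or_congr_right ?_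
  simp only [view, hist, List.map_map, List.mem_map, List.mem_range, Function.comp]
  constructor
  · rintro ⟨_, ⟨t', ht', rfl⟩, k, hk⟩
    exact ⟨t', ht', k, hk⟩
  · rintro ⟨t', ht', k, hk⟩
    exact ⟨_, ⟨t', ht', rfl⟩, k, hk⟩

theorem holds_mono {i : Fin n} {r : Run n} {t t' s : ℕ} {x : Piece n}
    (h : Holds m i (view i (hist r t)) s x) (htt : t ≤ t') :
    Holds m i (view i (hist r t')) s x := by
  rw [holds_view] at *
  exact h.imp (fun h => ⟨h.1.mono htt, h.2⟩) fun h => h.mono htt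

theorem Recovers.mono {H H' : Set (Piece n)} (hH : H ⊆ H') {k : Fin n} (h : Recovers H k) :
    Recovers H' k :=
  h.imp (fun h => hH h) fun ⟨d, hd, h⟩ => ⟨d, hd, fun l => hH (h l)⟩

theorem recovered_mono {H H' : Set (Piece n)} (hH : H ⊆ H')
    (h : m ≤ {k | Recovers H k}.ncard) : m ≤ {k | Recovers H' k}.ncard :=
  h.trans (Set.ncard_le_ncard (fun _ hk => Recovers.mono hH hk) (Set.toFinite _))

theorem knows_mono {i : Fin n} {r : Run n} {t t' : ℕ}
    (h : Knows m i (view i (hist r t))) (htt : t ≤ t') : Knows m i (view i (hist r t')) := by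
  obtain ⟨s, hs⟩ := h
  exact ⟨s, recovered_mono (fun x hx => holds_mono hx htt) hs⟩

theorem sendable_share {i k : Fin n} : Sendable m i (.share k) ↔
    3 ≤ m ∧ (k = i ∨ (i.val < 3 ∧ k.val % 3 = i.val ∧ k.val < m)) :=
  ⟨fun ⟨_, h⟩ => h, fun h => ⟨i, h⟩⟩

theorem sendable_sub {i k : Fin n} {d : Fin 2} : Sendable m i (.sub d k) ↔
    m = 2 ∧ (k = i ∨ (i.val < 3 ∧ k.val % 3 = i.val) ∨ d.val = i.val) := by
  constructor
  · rintro ⟨j, h, h'⟩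
    exact ⟨h, by tauto⟩
  · rintro ⟨h, h'⟩
    exact ⟨k, h, by tauto⟩

/-- Player `i` cannot recover the secret from its own pieces, the pieces that it may send, and those
that one other player may send to it. -/
theorem recovered_lt (hn : 3 ≤ n) (hm : 2 ≤ m) (hmn : m ≤ n) {i c : Fin n} (hc : c ≠ i)
    {H : Set (Piece n)}
    (hH : ∀ x ∈ H, Initial m i x ∨ Sendable m i x ∨ Permitted m c i x) :
    {k | Recovers H k}.ncard < m := by
  rcases hm.eq_or_lt with rfl | hm3
  · have hsub : {k | Recovers H k} ⊆ {i} := by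
      rintro k (hk | ⟨d, hd, hk⟩)
      · rcases hH _ hk with h | h | h
        · exact h
        · exact absurd (sendable_share.1 h).1 (by norm_num)
        · exact absurd h.1 (by norm_num)
      · obtain ⟨e, he3, hei, hec⟩ : ∃ e, e < 3 ∧ e ≠ i.val % 3 ∧ e ≠ c.val % 3 := by
          by_cases h0 : 0 ≠ i.val % 3 ∧ 0 ≠ c.val % 3
          · exact ⟨0, by omega⟩
          by_cases h1 : 1 ≠ i.val % 3 ∧ 1 ≠ c.val % 3
          · exact ⟨1, by omega⟩
          · exact ⟨2, by omega⟩
        have hdi : d.val = i.val := by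
          rcases hH _ (hk ⟨e, by omega⟩) with h | h | h
          · exact h.2
          · have := (sendable_sub.1 h).2
            simp only [Fin.ext_iff] at this
            omega
          · have := h.2
            simp only [Fin.ext_iff] at this
            omega
        exact Fin.ext (by rw [← hd, hdi])
    have := Set.ncard_le_ncard hsub (Set.toFinite _)
    rw [Set.ncard_singleton] at this
    omega
  · have hshare : ∀ k, Recovers H k → k = i ∨ (i.val < 3 ∧ k.val % 3 = i.val ∧ k.val < m) ∨
        k = c ∨ (c.val < 3 ∧ k.val % 3 = c.val ∧ k.val < m) := by
      rintro k (hk | ⟨d, hd, hk⟩)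
      · rcases hH _ hk with h | h | h
        · exact Or.inl h
        · have := (sendable_share.1 h).2
          tauto
        · have := h.2
          tauto
      · rcases hH _ (hk k) with h | h | h
        · exact absurd h.1 (by omega)
        · exact absurd (sendable_sub.1 h).1 (by omega)
        · exact absurd h.1 (by omega)
    -- As `m ≥ 3`, the leaders are designated. Without two of them, and with one additional player
    -- `x` (possibly one of these two), at most `m - 2 + 1` shares remain.
    have hcard : ∀ (x : Fin n) (e₁ e₂ : ℕ), e₁ < 3 → e₂ < 3 → e₁ ≠ e₂ →
        (∀ k, Recovers H k → k = x ∨ (k.val < m ∧ k.val ≠ e₁ ∧ k.val ≠ e₂)) →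
        {k | Recovers H k}.ncard < m := by
      intro x e₁ e₂ h1 h2 hne hk
      have hsub : Fin.val '' {k | Recovers H k} ⊆
          ((insert x.val (((Finset.range m).erase e₁).erase e₂) : Finset ℕ) : Set ℕ) := by
        rintro _ ⟨k, hkk, rfl⟩
        rcases hk k hkk with rfl | h
        · simp
        · simp [h]
      have hle := Set.ncard_le_ncard hsub (Finset.finite_toSet _)
      rw [Set.ncard_image_of_injective _ Fin.val_injective, Set.ncard_coe_finset] at hle
      have h3 := Finset.card_insert_le x.val (((Finset.range m).erase e₁).erase e₂)
      rw [Finset.card_erase_of_mem (by simp; omega), Finset.card_erase_of_mem (by simp; omega),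
        Finset.card_range] at h3
      omega
    by_cases hi : i.val < 3
    · obtain ⟨e₁, e₂, h⟩ : ∃ e₁ e₂, e₁ < 3 ∧ e₂ < 3 ∧ e₁ ≠ e₂ ∧ e₁ ≠ i.val ∧ e₂ ≠ i.val :=
        ⟨(i.val + 1) % 3, (i.val + 2) % 3, by omega⟩
      refine hcard c e₁ e₂ h.1 h.2.1 h.2.2.1 fun k hk => ?_
      have := hshare k hk
      simp only [Fin.ext_iff] at this hc ⊢
      omega
    · by_cases hc3 : c.val < 3
      · obtain ⟨e₁, e₂, h⟩ : ∃ e₁ e₂, e₁ < 3 ∧ e₂ < 3 ∧ e₁ ≠ e₂ ∧ e₁ ≠ c.val ∧ e₂ ≠ c.val :=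
          ⟨(c.val + 1) % 3, (c.val + 2) % 3, by omega⟩
        refine hcard i e₁ e₂ h.1 h.2.1 h.2.2.1 fun k hk => ?_
        have := hshare k hk
        simp only [Fin.ext_iff] at this hc ⊢
        omega
      · have hsub : {k | Recovers H k} ⊆ {i, c} := by
          intro k hk
          have := hshare k hk
          simp only [Set.mem_insert_iff, Set.mem_singleton_iff]
          tauto
        have := Set.ncard_le_ncard hsub (Set.toFinite _)
        rw [Set.ncard_pair hc.symm] at this
        omega

/-- A player who holds only its own initial pieces of a sharing cannot recover the secret. -/
theorem recovered_initial_lt (hn : 3 ≤ n) (hm : 2 ≤ m) (hmn : m ≤ n) {i : Fin n}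
    {H : Set (Piece n)} (hH : ∀ x ∈ H, Initial m i x) : {k | Recovers H k}.ncard < m := by
  obtain ⟨c, hc⟩ : ∃ c : Fin n, c ≠ i := by
    have : Nontrivial (Fin n) := Fin.nontrivial_iff_two_le.2 (by omega)
    exact exists_ne i
  exact recovered_lt hn hm hmn hc fun x hx => Or.inl (hH x hx)

theorem IsRun.legal_play {r : Run n} (hr : IsRun m r) {t : ℕ} {i j : Fin n} {y : ℕ × Piece n}
    (hy : y ∈ ((r t i).msgTo j).pieces) :
    Holds m i (view i (hist r t)) y.1 y.2 ∧ Permitted m i j y.2 := by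
  have h := hr t i
  cases hh : r t i with
  | halt => simp [hh, Move.msgTo, Msg.empty] at hy
  | play msg ask =>
    rw [hh] at h hy
    exact h.2.2 j y hy

theorem IsRun.msgTo_self {r : Run n} (hr : IsRun m r) (t : ℕ) (i : Fin n) :
    (r t i).msgTo i = Msg.empty := by
  have h := hr t i
  cases hh : r t i with
  | halt => rfl
  | play msg ask =>
    rw [hh] at h
    exact h.2.1

theorem IsRun.halt_succ {r : Run n} (hr : IsRun m r) {t : ℕ} {i : Fin n} (h : r t i = .halt)
    {t' : ℕ} (ht : t ≤ t') : r t' i = .halt := by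
  rcases ht.eq_or_lt with rfl | ht
  · exact h
  have h' := hr t' i
  cases hh : r t' i with
  | halt => rfl
  | play msg ask =>
    rw [hh] at h'
    refine absurd h (h'.1 (observe i (r t)) ?_)
    exact List.mem_map_of_mem (List.mem_map_of_mem (List.mem_range.2 ht))

/-- The pieces that the players hold belong to sharings that have been issued. -/
theorem IsRun.issued {r : Run n} (hr : IsRun m r) {t s : ℕ} : ∀ {i : Fin n} {x : Piece n},
    Holds m i (view i (hist r t)) s x → IssuedAt r t s := by
  induction t using Nat.strong_induction_on with
  | _ t ih =>
    intro i x h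
    rw [holds_view] at h
    rcases h with h | ⟨t', ht', k, hk⟩
    · exact h.1
    · exact (ih t' ht' (hr.legal_play hk).1).mono ht'.le

/-- Whether a player knows the secret depends only on the pieces that it has received. -/
theorem IsRun.knows_of_got (hn : 3 ≤ n) (hm : 2 ≤ m) (hmn : m ≤ n) {r : Run n} (hr : IsRun m r)
    {t s : ℕ} {i : Fin n}
    (h : m ≤ {k | Recovers {x | Initial m i x ∨ Got r i t s x} k}.ncard) :
    Knows m i (view i (hist r t)) := by
  refine ⟨s, recovered_mono ?_ h⟩
  -- Nobody holds a piece of a sharing that has not been issued. Then the set in `h` would contain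
  -- initial pieces only, which are too few.
  have : IssuedAt r t s := by
    by_contra hs
    refine (recovered_initial_lt hn hm hmn (i := i) ?_).not_ge h
    rintro x (hx | hx)
    · exact hx
    · exact absurd (hr.issued ((holds_view (m := m) ..).2 (Or.inr hx))) hs
  intro x hx
  change Holds m i _ s x
  rw [holds_view]
  exact hx.imp_left fun h => ⟨this, h⟩

end Knowledge

/-! ### What the other players can see of a player, and its probability -/

section Visible

variable {n m : ℕ}

/-- The action profile `p`, where the action of player `i` is reduced to what the other players can
see of it: its messages, and whether all players asked for a restart. -/
def canon (i : Fin n) (p : Profile n) : Profile n :=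
  Function.update p i (.play (p i).msgTo (restarts p))

theorem canon_self (i : Fin n) (p : Profile n) : canon i p i = .play (p i).msgTo (restarts p) := by
  simp [canon]

theorem canon_of_ne {i j : Fin n} (h : j ≠ i) (p : Profile n) : canon i p j = p j := by
  simp [canon, h]

@[simp] theorem canon_msgTo (i j : Fin n) (p : Profile n) :
    (canon i p j).msgTo = (p j).msgTo := by
  by_cases h : j = i
  · subst h; rw [canon_self]; rfl
  · rw [canon_of_ne h]

theorem asks_of_restarts {p : Profile n} (h : restarts p = true) (k : Fin n) :
    (p k).asks = true := by
  simp only [restarts, decide_eq_true_eq] at h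
  exact h k

@[simp] theorem restarts_canon (i : Fin n) (p : Profile n) : restarts (canon i p) = restarts p := by
  rw [Bool.eq_iff_iff]
  constructor
  · intro h
    have := asks_of_restarts h i
    rwa [canon_self] at this
  · intro h
    simp only [restarts, decide_eq_true_eq]
    intro k
    by_cases hk : k = i
    · subst hk; rw [canon_self]; exact h
    · rw [canon_of_ne hk]; exact asks_of_restarts h k

@[simp] theorem canon_canon (i : Fin n) (p : Profile n) : canon i (canon i p) = canon i p := by
  ext1 j
  by_cases h : j = i
  · subst h; rw [canon_self, restarts_canon, canon_msgTo, canon_self]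
  · rw [canon_of_ne h]

theorem observe_canon {i j : Fin n} (h : j ≠ i) (p : Profile n) :
    observe j (canon i p) = observe j p := by
  unfold observe
  congr 1
  · exact canon_of_ne h p
  · funext k; simp
  · exact restarts_canon i p

theorem view_congr_canon {i j : Fin n} (hj : j ≠ i) {h h' : List (Profile n)}
    (hh : h.map (canon i) = h'.map (canon i)) : view j h = view j h' := by
  have : ∀ g : List (Profile n), view j g = view j (g.map (canon i)) := by
    intro g
    simp [view, observe_canon hj]
  rw [this h, hh, ← this]

theorem map_canon_hist (i : Fin n) (r : Run n) (t : ℕ) :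
    (hist r t).map (canon i) = hist (fun t => canon i (r t)) t := by
  simp [hist]

theorem sharingAt_canon (i : Fin n) (r : Run n) (t : ℕ) :
    sharingAt (fun t => canon i (r t)) t = sharingAt r t := by
  induction t with
  | zero => rfl
  | succ t ih => rw [sharingAt_succ, sharingAt_succ, ih, restarts_canon]

theorem currentAt_canon (i : Fin n) (r : Run n) (t : ℕ) :
    currentAt (fun t => canon i (r t)) t = (currentAt r t).map (canon i) := by
  induction t with
  | zero => rfl
  | succ t ih => rw [currentAt_succ, currentAt_succ, ih, restarts_canon]; split_ifs <;> simp

theorem issuedAt_canon (i : Fin n) (r : Run n) (t s : ℕ) :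
    IssuedAt (fun t => canon i (r t)) t s ↔ IssuedAt r t s := by
  simp [IssuedAt, sharingAt_canon, currentAt_canon]

theorem holds_canon (i j : Fin n) (r : Run n) (t s : ℕ) (x : Piece n) :
    Holds m j (view j ((hist r t).map (canon i))) s x ↔ Holds m j (view j (hist r t)) s x := by
  rw [map_canon_hist, holds_view, holds_view, issuedAt_canon]
  simp [Got]

theorem knows_canon (i j : Fin n) (r : Run n) (t : ℕ) :
    Knows m j (view j ((hist r t).map (canon i))) ↔ Knows m j (view j (hist r t)) := by
  simp only [Knows, holds_canon]

theorem exists_run_hist (h : List (Profile n)) : ∃ r : Run n, hist r h.length = h :=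
  ⟨fun t => h.getD t fun _ => .halt, by
    apply List.ext_getElem (by simp)
    intro k h1 h2
    simp [hist, h2]⟩

/-- Holding a piece depends on messages and restarts only. Therefore `j = i` is not excluded:
whether `i` itself knows the secret can be read off from its visible behaviour and that of the
others. -/
theorem knows_congr_canon {i j : Fin n} {h h' : List (Profile n)}
    (hh : h.map (canon i) = h'.map (canon i)) :
    Knows m j (view j h) ↔ Knows m j (view j h') := by
  obtain ⟨r, hr⟩ := exists_run_hist h
  obtain ⟨r', hr'⟩ := exists_run_hist h'
  have h1 := knows_canon (m := m) i j r h.length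
  have h2 := knows_canon (m := m) i j r' h'.length
  rw [hr] at h1
  rw [hr'] at h2
  rw [← h1, ← h2, hh]

open Classical in
/-- The probability that a player `i` with local state `v` who follows `f` shows the behaviour
recorded in `h` when it observes what is recorded in `h`. -/
noncomputable def outProb (f : View n → PMF (Move n)) (i : Fin n) :
    View n → List (Profile n) → ENNReal
  | _, [] => 1
  | v, p :: h => ∑' a, if canon i (Function.update p i a) = canon i p then
      f v a * outProb f i (v ++ [observe i (Function.update p i a)]) h else 0

/-- The probability that a player `j` with local state `v` who follows `f` plays as in `h`. -/
noncomputable def moveProb (f : View n → PMF (Move n)) (j : Fin n) :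
    View n → List (Profile n) → ENNReal
  | _, [] => 1
  | v, p :: h => f v (p j) * moveProb f j (v ++ [observe j p]) h

/-- The probability that the play continues with `h` after the rounds in `g`. -/
noncomputable def weightFrom (σ : ∀ i, Strategy n m i) :
    List (Profile n) → List (Profile n) → ENNReal
  | _, [] => 1
  | g, p :: h => stepProb σ g p * weightFrom σ (g ++ [p]) h

theorem weight_append (σ : ∀ i, Strategy n m i) (g h : List (Profile n)) :
    weight σ (g ++ h) = weight σ g * weightFrom σ g h := by
  induction h generalizing g with
  | nil => simp [weightFrom]
  | cons p h ih =>
    have := ih (g ++ [p])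
    rw [List.append_assoc, List.singleton_append] at this
    rw [this, weight_append_singleton, weightFrom, mul_assoc]

theorem moveProb_append_singleton (f : View n → PMF (Move n)) (j : Fin n) (v : View n)
    (h : List (Profile n)) (p : Profile n) :
    moveProb f j v (h ++ [p]) = moveProb f j v h * f (v ++ view j h) (p j) := by
  induction h generalizing v with
  | nil => simp [moveProb, view]
  | cons q h ih => simp [moveProb, ih, view, mul_assoc]

/-- The players randomize independently, so the weight separates into one factor for each strategy.
-/
theorem weight_eq_prod (σ : ∀ i, Strategy n m i) (h : List (Profile n)) :
    weight σ h = ∏ j, moveProb (σ j).1 j [] h := by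
  induction h using List.reverseRecOn with
  | nil => simp [weight_nil, moveProb]
  | append_singleton h p ih =>
    rw [weight_append_singleton, ih, stepProb, ← Finset.prod_mul_distrib]
    simp [moveProb_append_singleton]

-- Histories with the same visible part differ in the moves of `i` alone, and the others have the
-- same local states in all of them. The sum therefore runs over the moves of `i`, and the factors
-- of the others can be taken out.
open Classical in
theorem tsum_weightFrom (σ : ∀ i, Strategy n m i) (i : Fin n) (g h : List (Profile n)) :
    ∑' h' : List (Profile n),
        (if h'.map (canon i) = h.map (canon i) then weightFrom σ g h' else 0) =
      outProb (σ i).1 i (view i g) h *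
        ∏ j ∈ Finset.univ.erase i, moveProb (σ j).1 j (view j g) h := by
  induction h generalizing g with
  | nil =>
    rw [tsum_eq_single []]
    · simp [weightFrom, outProb, moveProb]
    · intro h' hh'
      simp [hh']
  | cons p h ih =>
    have hinj : Function.Injective fun x : Profile n × List (Profile n) => x.1 :: x.2 := by
      rintro ⟨a, b⟩ ⟨c, d⟩ h
      simpa using h
    rw [← hinj.tsum_eq, ENNReal.tsum_prod']
    swap
    · intro h' hh'
      cases h' with
      | nil => simp at hh'
      | cons q h' => exact ⟨(q, h'), rfl⟩
    have hinj2 : Function.Injective fun a : Move n => Function.update p i a :=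
      Function.update_injective p i
    rw [← hinj2.tsum_eq]
    swap
    · intro q hq
      refine ⟨q i, ?_⟩
      have hq2 : canon i q = canon i p := by
        by_contra hne
        apply hq
        simp [hne]
      ext1 j
      change Function.update p i (q i) j = q j
      by_cases hj : j = i
      · subst hj; simp
      · rw [Function.update_of_ne hj, ← canon_of_ne hj p, ← hq2, canon_of_ne hj]
    rw [outProb, ← ENNReal.tsum_mul_right]
    congr 1
    ext a
    split_ifs with ha
    · have h1 : ∀ h' : List (Profile n),
          (if (Function.update p i a :: h').map (canon i) = (p :: h).map (canon i)
            then weightFrom σ g (Function.update p i a :: h') else 0) =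
          stepProb σ g (Function.update p i a) * (if h'.map (canon i) = h.map (canon i) then
            weightFrom σ (g ++ [Function.update p i a]) h' else 0) := by
        intro h'
        simp [ha, weightFrom]
      simp only [h1]
      rw [ENNReal.tsum_mul_left, ih, view_append, view_singleton, stepProb,
        ← Finset.mul_prod_erase _ _ (Finset.mem_univ i), Function.update_self]
      have h2 : ∏ j ∈ Finset.univ.erase i, moveProb (σ j).1 j (view j g) (p :: h) =
          (∏ j ∈ Finset.univ.erase i, (σ j).1 (view j g) (Function.update p i a j)) *
          ∏ j ∈ Finset.univ.erase i,
            moveProb (σ j).1 j (view j (g ++ [Function.update p i a])) h := by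
        rw [← Finset.prod_mul_distrib]
        refine Finset.prod_congr rfl fun j hj => ?_
        have hj := Finset.ne_of_mem_erase hj
        rw [moveProb, Function.update_of_ne hj, view_append, view_singleton, ← observe_canon hj p,
          ← ha, observe_canon hj]
      rw [h2]
      ring
    · simp [ha]

/-- The strategy of `i` enters the law of the visible history through `outProb` only. Two strategies
of `i` with the same `outProb` cannot be told apart by the others. -/
theorem measure_canon_hist (σ : ∀ i, Strategy n m i) (i : Fin n) (h : List (Profile n)) :
    runMeasure σ {r | (hist r h.length).map (canon i) = h.map (canon i)} =
      outProb (σ i).1 i [] h * ∏ j ∈ Finset.univ.erase i, moveProb (σ j).1 j [] h := by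
  classical
  have h1 := measure_hist_mem σ h.length {h' | h'.map (canon i) = h.map (canon i)}
  simp only [Set.mem_ofPred_eq] at h1
  refine h1.trans (Eq.trans ?_ (tsum_weightFrom σ i [] h))
  congr 1
  ext h'
  have h2 := weight_append σ [] h'
  rw [List.nil_append, weight_nil, one_mul] at h2
  rw [h2]
  congr 1
  rw [eq_iff_iff, and_iff_right_iff_imp]
  intro h3
  simpa using congrArg List.length h3

/-- The behaviour of player `i` and its observations agree in `p` and `q`. -/
def SameTrace (i : Fin n) (p q : Profile n) : Prop :=
  (p i).msgTo = (q i).msgTo ∧ (∀ k, k ≠ i → (p k).msgTo i = (q k).msgTo i) ∧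
  restarts p = restarts q ∧
  ((∀ k, k ≠ i → (p k).asks = true) ↔ ∀ k, k ≠ i → (q k).asks = true)

theorem restarts_update (i : Fin n) (p : Profile n) (a : Move n) :
    restarts (Function.update p i a) = true ↔ a.asks = true ∧ ∀ k, k ≠ i → (p k).asks = true := by
  simp only [restarts, decide_eq_true_eq]
  constructor
  · intro h
    refine ⟨by simpa using h i, fun k hk => by simpa [hk] using h k⟩
  · rintro ⟨h1, h2⟩ k
    by_cases hk : k = i
    · subst hk; simpa using h1
    · simpa [hk] using h2 k hk

theorem canon_update_eq_iff (i : Fin n) (p : Profile n) (a : Move n) :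
    canon i (Function.update p i a) = canon i p ↔
      a.msgTo = (p i).msgTo ∧ (restarts (Function.update p i a) = restarts p) := by
  constructor
  · intro h
    have := congrFun h i
    rw [canon_self, canon_self] at this
    simpa using this
  · rintro ⟨h1, h2⟩
    ext1 j
    by_cases hj : j = i
    · subst hj; rw [canon_self, canon_self, h2]; simp [h1]
    · rw [canon_of_ne hj, canon_of_ne hj, Function.update_of_ne hj]

/-- Which moves of `i` fit a round depends on the messages to and from `i`, on the restart, and on
whether all others ask, since this decides if a request of `i` has an effect. What the others send
among themselves is irrelevant, and the scripts below make use of this freedom. -/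
theorem outProb_congr {i : Fin n} (f : View n → PMF (Move n)) {h h' : List (Profile n)}
    (hh : List.Forall₂ (SameTrace i) h h') (v : View n) : outProb f i v h = outProb f i v h' := by
  induction hh generalizing v with
  | nil => rfl
  | @cons p q h h' hp _ ih =>
    rw [outProb, outProb]
    congr 1
    ext a
    obtain ⟨h1, h2, h3, h4⟩ := hp
    have hrs : restarts (Function.update p i a) = restarts (Function.update q i a) := by
      rw [Bool.eq_iff_iff, restarts_update, restarts_update, h4]
    have hobs : observe i (Function.update p i a) = observe i (Function.update q i a) := by
      unfold observe
      congr 1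
      · simp
      · funext k
        by_cases hk : k = i
        · subst hk; simp
        · simp [hk, h2 k hk]
    simp only [canon_update_eq_iff, hrs, h1, h3, hobs, ih]

end Visible

/-! ### Comparing two strategies by stopping the run -/

section Payoffs

variable {n m : ℕ}

/-- The players who learn the secret. -/
def learners (m : ℕ) (r : Run n) : Set (Fin n) := {j | Learns m r j}

/-- By U1 the utility is a function of the finite set of learners. This also makes it measurable and
bounded on legal runs. -/
theorem exists_value {u : Fin n → Run n → ℝ} (hU1 : U1 m u) :
    ∃ w : Fin n → Set (Fin n) → ℝ, ∀ i r, IsRun m r → u i r = w i (learners m r) := by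
  classical
  refine ⟨fun i S => if h : ∃ r, IsRun m r ∧ learners m r = S then u i h.choose else 0,
    fun i r hr => ?_⟩
  have h : ∃ r', IsRun m r' ∧ learners m r' = learners m r := ⟨r, hr, rfl⟩
  beta_reduce
  rw [dif_pos h]
  refine hU1 i _ _ hr h.choose_spec.1 fun j => ?_
  have := Set.ext_iff.1 h.choose_spec.2 j
  exact this.symm

theorem measurableSet_learns (j : Fin n) : MeasurableSet {r : Run n | Learns m r j} := by
  have : {r : Run n | Learns m r j} =
      ⋃ t, {r : Run n | hist r t ∈ {h | Knows m j (view j h)}} := by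
    ext r; simp [Learns]
  rw [this]
  exact MeasurableSet.iUnion fun t => measurableSet_hist t _

theorem measurable_learners : Measurable (learners m : Run n → Set (Fin n)) :=
  measurable_set_iff.2 fun j => measurableSet_setOfPred.1 (measurableSet_learns j)

theorem measurable_value (w : Set (Fin n) → ℝ) : Measurable fun r : Run n => w (learners m r) :=
  (Measurable.of_discrete (f := w)).comp measurable_learners

theorem integrable_value (w : Set (Fin n) → ℝ) (μ : Measure (Run n)) [IsFiniteMeasure μ] :
    Integrable (fun r : Run n => w (learners m r)) μ := by
  obtain ⟨C, hC⟩ : ∃ C : ℝ, ∀ S, ‖w S‖ ≤ C := by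
    obtain ⟨C, hC⟩ := (Set.finite_range fun S => ‖w S‖).bddAbove
    exact ⟨C, fun S => hC ⟨S, rfl⟩⟩
  exact Integrable.of_bound (measurable_value w).aestronglyMeasurable C (.of_forall fun r => hC _)

theorem expectedUtility_eq {u : Fin n → Run n → ℝ} {w : Fin n → Set (Fin n) → ℝ}
    (hw : ∀ i r, IsRun m r → u i r = w i (learners m r)) (i : Fin n) (σ : ∀ i, Strategy n m i) :
    expectedUtility m u i σ = ∫ r, w i (learners m r) ∂runMeasure σ := by
  refine integral_congr_ae ?_
  filter_upwards [ae_positive σ] with r hr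
  exact hw i r hr.isRun

theorem exists_positive_of_measure_ne_zero {σ : ∀ i, Strategy n m i} {A : Set (Run n)}
    (hA : runMeasure σ A ≠ 0) : ∃ r ∈ A, Positive σ r := by
  by_contra hcon
  push Not at hcon
  apply hA
  rw [← nonpos_iff_eq_zero, ← ae_iff.1 (ae_positive σ)]
  exact measure_mono fun r hr hr' => hcon r hr hr'

theorem issuedAt_succ_iff (r : Run n) (t s : ℕ) : IssuedAt r (t + 1) s ↔ s ≤ sharingAt r t := by
  unfold IssuedAt
  rw [sharingAt_succ, currentAt_succ]
  split_ifs
  · simp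
    try omega
  · simp
    omega

theorem not_issuedAt_zero (r : Run n) (s : ℕ) : ¬ IssuedAt r 0 s := by
  simp [IssuedAt, sharingAt_zero, currentAt_zero]

theorem sharingAt_le {r r' : Run n} (hs : ∀ t, restarts (r t) = true → restarts (r' t) = true)
    (t : ℕ) : sharingAt r t ≤ sharingAt r' t := by
  induction t with
  | zero => exact le_rfl
  | succ t ih =>
    rw [sharingAt_succ, sharingAt_succ]
    have := hs t
    split_ifs with h1 h2 h2
    · omega
    · exact absurd (this h1) h2
    · omega
    · omega

theorem holds_mono_run {r r' : Run n}
    (hp : ∀ t j k x, x ∈ ((r t j).msgTo k).pieces → x ∈ ((r' t j).msgTo k).pieces)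
    (hs : ∀ t, restarts (r t) = true → restarts (r' t) = true) {i : Fin n} {t s : ℕ} {x : Piece n}
    (h : Holds m i (view i (hist r t)) s x) : Holds m i (view i (hist r' t)) s x := by
  rw [holds_view] at *
  refine h.imp (fun h => ⟨?_, h.2⟩) ?_
  · cases t with
    | zero => exact absurd h.1 (not_issuedAt_zero r s)
    | succ t =>
      exact (issuedAt_succ_iff ..).2 (((issuedAt_succ_iff ..).1 h.1).trans (sharingAt_le hs t))
  · rintro ⟨t', h1, k, h2⟩
    exact ⟨t', h1, k, hp _ _ _ _ h2⟩

/-- A move that no other player can ever notice. -/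
def Silent (a : Move n) : Prop := (∀ k, a.msgTo k = Msg.empty) ∧ a.asks = false

/-- In the course of `h` a player `i` who follows `f` knew the secret and, as far as the other
players can tell, might not have been silent in the next round. -/
def Noisy (m : ℕ) (f : View n → PMF (Move n)) (i : Fin n) (h : List (Profile n)) : Prop :=
  ∃ s ≤ h.length, Knows m i (view i (h.take s)) ∧
    ∃ h', h'.map (canon i) = (h.take s).map (canon i) ∧ moveProb f i [] h' ≠ 0 ∧
      ∃ a ∈ (f (view i h')).support, ¬ Silent a

open Classical in
/-- The run `r` up to the point where player `i` might be noisy. -/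
noncomputable def haltRun (m : ℕ) (f : View n → PMF (Move n)) (i : Fin n) (r : Run n) : Run n :=
  fun t => if Noisy m f i (hist r t) then fun _ => .halt else canon i (r t)

variable {f : View n → PMF (Move n)} {i : Fin n}

/-- `Noisy` quantifies over all local states of `i` that look alike from outside, so that the
stopping time of `haltRun` is visible to everybody. -/
theorem noisy_congr {h h' : List (Profile n)} (hh : h.map (canon i) = h'.map (canon i)) :
    Noisy m f i h ↔ Noisy m f i h' := by
  have hl : h.length = h'.length := by simpa using congrArg List.length hh
  unfold Noisy
  rw [hl]
  have ht : ∀ s, (h.take s).map (canon i) = (h'.take s).map (canon i) := fun s => by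
    rw [List.map_take, hh, List.map_take]
  have hk : ∀ s, Knows m i (view i (h.take s)) ↔ Knows m i (view i (h'.take s)) :=
    fun s => knows_congr_canon (ht s)
  simp only [hk, ht]

theorem Noisy.append {h : List (Profile n)} (hh : Noisy m f i h) (h' : List (Profile n)) :
    Noisy m f i (h ++ h') := by
  obtain ⟨s, hs, hh⟩ := hh
  refine ⟨s, by simp; omega, ?_⟩
  rwa [List.take_append_of_le_length hs]

theorem Noisy.mono {r : Run n} {s t : ℕ} (h : Noisy m f i (hist r s)) (hst : s ≤ t) :
    Noisy m f i (hist r t) := by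
  rw [← List.take_append_drop s (hist r t), hist_take r hst]
  exact h.append _

theorem hist_haltRun {r : Run n} {t : ℕ} (h : ∀ s < t, ¬ Noisy m f i (hist r s)) :
    hist (haltRun m f i r) t = (hist r t).map (canon i) := by
  rw [map_canon_hist]
  unfold hist
  refine List.map_congr_left fun s hs => ?_
  simp [haltRun, h s (List.mem_range.1 hs)]

theorem exists_first_noisy {r : Run n} {t : ℕ} (h : Noisy m f i (hist r t)) :
    ∃ s ≤ t, Noisy m f i (hist r s) ∧ ∀ s' < s, ¬ Noisy m f i (hist r s') := by
  classical
  have hex : ∃ s, Noisy m f i (hist r s) := ⟨t, h⟩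
  exact ⟨Nat.find hex, Nat.find_min' hex h, Nat.find_spec hex, fun s' => Nat.find_min hex⟩

/-- Up to the first noisy moment the stopped run is visibly equal to the original one, so it shows
by itself when it was stopped. -/
theorem noisy_haltRun (r : Run n) (t : ℕ) :
    Noisy m f i (hist (haltRun m f i r) t) ↔ Noisy m f i (hist r t) := by
  constructor
  · intro h
    by_contra hcon
    rw [hist_haltRun fun s hs hn => hcon (hn.mono hs.le)] at h
    exact hcon ((noisy_congr (by simp [Function.comp_def])).1 h)
  · intro h
    obtain ⟨s, hs, hn, hmin⟩ := exists_first_noisy h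
    have h2 : Noisy m f i (hist (haltRun m f i r) s) := by
      rw [hist_haltRun hmin]
      exact (noisy_congr (by simp [Function.comp_def])).1 hn
    exact h2.mono hs

theorem measurable_haltRun : Measurable (haltRun m f i : Run n → Run n) := by
  refine measurable_pi_iff.2 fun t B _ => ?_
  classical
  have : (fun r : Run n => haltRun m f i r t) ⁻¹' B = {r : Run n | hist r (t + 1) ∈
      {h : List (Profile n) | ∃ p ∈ h.getLast?, (if Noisy m f i h.dropLast then fun _ => Move.halt
        else canon i p) ∈ B}} := by
    ext r
    simp [haltRun, hist_succ]
  rw [this]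
  exact measurableSet_hist _ _

theorem restarts_halt [NeZero n] : restarts (fun _ : Fin n => Move.halt) = false := by
  simp only [restarts, decide_eq_false_iff_not]
  intro h
  simpa [Move.asks] using h 0

theorem haltRun_pieces {r : Run n} {t : ℕ} {j k : Fin n} {x : ℕ × Piece n}
    (h : x ∈ ((haltRun m f i r t j).msgTo k).pieces) : x ∈ ((r t j).msgTo k).pieces := by
  unfold haltRun at h
  split_ifs at h
  · simp [Move.msgTo, Msg.empty] at h
  · simpa using h

theorem restarts_haltRun {r : Run n} {t : ℕ} (h : restarts (haltRun m f i r t) = true) :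
    restarts (r t) = true := by
  have : NeZero n := ⟨by rintro rfl; exact i.elim0⟩
  unfold haltRun at h
  split_ifs at h
  · simp [restarts_halt] at h
  · simpa using h

theorem learns_of_haltRun {r : Run n} {j : Fin n} (h : Learns m (haltRun m f i r) j) :
    Learns m r j := by
  obtain ⟨t, s, hs⟩ := h
  exact ⟨t, s, recovered_mono (fun x hx => holds_mono_run
    (r := haltRun m f i r) (fun _ _ _ _ => haltRun_pieces) (fun _ => restarts_haltRun) hx) hs⟩

theorem learns_haltRun_of_hist {r : Run n} {t : ℕ} {j : Fin n}
    (h : ∀ s < t, ¬ Noisy m f i (hist r s)) (hk : Knows m j (view j (hist r t))) :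
    Learns m (haltRun m f i r) j :=
  ⟨t, by rw [hist_haltRun h]; exact (knows_canon i j r t).2 hk⟩

theorem Noisy.knows {r : Run n} {t : ℕ} (h : Noisy m f i (hist r t)) :
    Knows m i (view i (hist r t)) := by
  obtain ⟨s, hs, hk, -⟩ := h
  rw [hist_length] at hs
  rw [hist_take r hs] at hk
  exact knows_mono hk hs

/-- Stopping does not cost `i` anything, as by definition it knew the secret before it might have
been noisy. -/
theorem learns_haltRun_self (r : Run n) : Learns m (haltRun m f i r) i ↔ Learns m r i := by
  refine ⟨learns_of_haltRun, fun ⟨t, hk⟩ => ?_⟩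
  by_cases hn : ∃ s < t, Noisy m f i (hist r s)
  · obtain ⟨s, -, hs⟩ := hn
    obtain ⟨s', -, hs', hmin⟩ := exists_first_noisy hs
    exact learns_haltRun_of_hist hmin hs'.knows
  · push Not at hn
    exact learns_haltRun_of_hist hn hk

theorem holds_haltRun_of_hist {r : Run n} {t : ℕ} (h : ∀ s < t, ¬ Noisy m f i (hist r s))
    {j : Fin n} {s : ℕ} {x : Piece n} : Holds m j (view j (hist (haltRun m f i r) t)) s x ↔
      Holds m j (view j (hist r t)) s x := by
  rw [hist_haltRun h, holds_canon]

/-- The assumptions on the utilities apply to legal runs only. Before the stop, `canon` replaces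
every move of `i`, even a halt, by a `play`, so no later move of `i` becomes illegal. -/
theorem IsRun.haltRun {r : Run n} (hr : IsRun m r) : IsRun m (haltRun m f i r) := by
  intro t j
  by_cases hn : Noisy m f i (hist r t)
  · have : _root_.haltRun m f i r t j = .halt := by simp [_root_.haltRun, hn]
    rw [this]
    trivial
  have hn' : ∀ s ≤ t, ¬ Noisy m f i (hist r s) := fun s hs h => hn (h.mono hs)
  have hval : ∀ s ≤ t, _root_.haltRun m f i r s = canon i (r s) := fun s hs => by
    simp [_root_.haltRun, hn' s hs]
  rw [hval t le_rfl]
  have hpieces : ∀ k, ∀ y ∈ ((canon i (r t) j).msgTo k).pieces,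
      Holds m j (view j (hist (_root_.haltRun m f i r) t)) y.1 y.2 ∧ Permitted m j k y.2 := by
    intro k y hy
    rw [canon_msgTo] at hy
    rw [holds_haltRun_of_hist fun s hs => hn' s hs.le]
    exact hr.legal_play hy
  have hself : (canon i (r t) j).msgTo j = Msg.empty := by
    rw [canon_msgTo, hr.msgTo_self]
  have hhalt : canon i (r t) j ≠ .halt →
      ∀ o ∈ view j (hist (_root_.haltRun m f i r) t), o.own ≠ .halt := by
    intro hne o ho
    simp only [view, hist, List.map_map, List.mem_map, List.mem_range, Function.comp] at ho
    obtain ⟨s, hs, rfl⟩ := ho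
    change _root_.haltRun m f i r s j ≠ _
    rw [hval s hs.le]
    by_cases hj : j = i
    · subst hj
      rw [canon_self]
      simp
    · rw [canon_of_ne hj] at hne ⊢
      exact fun h => hne (hr.halt_succ h hs.le)
  cases hc : canon i (r t) j with
  | halt => trivial
  | play msg ask =>
    rw [hc] at hpieces hself hhalt
    exact ⟨hhalt (by simp), hself, hpieces⟩

theorem sameTrace_canon (i : Fin n) (p q : Profile n) (h : canon i p = canon i q) :
    SameTrace i p q := by
  have h1 : ∀ k, (p k).msgTo = (q k).msgTo := fun k => by
    rw [← canon_msgTo i k p, h, canon_msgTo]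
  refine ⟨h1 i, fun k _ => by rw [h1], ?_, ?_⟩
  · rw [← restarts_canon i p, h, restarts_canon]
  · refine forall₂_congr fun k hk => ?_
    rw [← canon_of_ne hk p, h, canon_of_ne hk]

theorem outProb_congr_canon {h h' : List (Profile n)} (hh : h.map (canon i) = h'.map (canon i))
    (v : View n) : outProb f i v h = outProb f i v h' := by
  refine outProb_congr f ?_ v
  have : List.Forall₂ (fun p q => canon i p = canon i q) h h' := by
    have := List.forall₂_eq_eq_eq (α := Profile n) ▸ hh
    rwa [← List.forall₂_eq_eq_eq, List.forall₂_map_left_iff, List.forall₂_map_right_iff] at hh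
  exact this.imp fun p q h => sameTrace_canon i p q h

/-- The coupling behind the comparison: strategies that show the same behaviour until `τ` might be
noisy lead to the same distribution of the stopped run. -/
theorem map_haltRun_eq (ρ : ∀ j, Strategy n m j) (σ τ : Strategy n m i)
    (hQ : ∀ r t, IsRun m r → ¬ Noisy m τ.1 i (hist r t) →
      outProb σ.1 i [] (hist r (t + 1)) = outProb τ.1 i [] (hist r (t + 1))) :
    (runMeasure (Function.update ρ i σ)).map (haltRun m τ.1 i) =
      (runMeasure (Function.update ρ i τ)).map (haltRun m τ.1 i) := by
  have h1 := Measure.isProbabilityMeasure_map (μ := runMeasure (Function.update ρ i σ))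
    (measurable_haltRun (m := m) (f := τ.1) (i := i)).aemeasurable
  have h2 := Measure.isProbabilityMeasure_map (μ := runMeasure (Function.update ρ i τ))
    (measurable_haltRun (m := m) (f := τ.1) (i := i)).aemeasurable
  refine runMeasure_ext fun t => ?_
  have hmeas : ∀ t (g : List (Profile n)), MeasurableSet {r : Run n | hist r t = g} :=
    fun t g => measurableSet_hist t {g}
  simp only [Measure.map_apply measurable_haltRun (hmeas _ _), Set.preimage_ofPred_eq]
  induction t with
  | zero =>
    intro g hg
    obtain rfl := List.length_eq_zero_iff.1 hg
    simp
  | succ t ih =>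
    intro g hg
    obtain ⟨g, p, rfl⟩ := List.eq_nil_or_concat' g |>.resolve_left (by rintro rfl; simp at hg)
    have hgt : g.length = t := by simpa using hg
    have hsplit : ∀ r : Run n, hist (haltRun m τ.1 i r) (t + 1) = g ++ [p] ↔
        hist (haltRun m τ.1 i r) t = g ∧ haltRun m τ.1 i r t = p := by
      intro r
      rw [hist_succ]
      constructor
      · intro h
        simpa using List.append_inj h (by simp [hgt])
      · rintro ⟨h, h'⟩
        rw [h, h']
    have hnoisy : ∀ r : Run n, hist (haltRun m τ.1 i r) t = g →
        (Noisy m τ.1 i (hist r t) ↔ Noisy m τ.1 i g) := by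
      rintro r rfl
      exact (noisy_haltRun r t).symm
    -- After a noisy history the next profile is forced. Otherwise the stopped run is a visible
    -- history: its event is given by `measure_canon_hist` if `g ++ [p]` is in canonical form, and
    -- is empty if not.
    by_cases hn : Noisy m τ.1 i g
    · have hset : {r : Run n | hist (haltRun m τ.1 i r) (t + 1) = g ++ [p]} =
          {r : Run n | hist (haltRun m τ.1 i r) t = g ∧ p = fun _ => .halt} := by
        ext r
        simp only [Set.mem_ofPred_eq, hsplit]
        refine and_congr_right fun h => ?_
        simp [haltRun, (hnoisy r h).2 hn, eq_comm]
      rw [hset]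
      by_cases hp : p = fun _ => .halt
      · simpa [hp] using ih g hgt
      · simp [hp]
    · by_cases hc : (g ++ [p]).map (canon i) = g ++ [p]
      · have hset : {r : Run n | hist (haltRun m τ.1 i r) (t + 1) = g ++ [p]} =
            {r : Run n | (hist r (g ++ [p]).length).map (canon i) = (g ++ [p]).map (canon i)} := by
          ext r
          simp only [Set.mem_ofPred_eq]
          rw [hc, hg]
          constructor
          · intro h
            have hnr : ¬ Noisy m τ.1 i (hist r t) := by
              rw [hnoisy r ((hsplit r).1 h).1]; exact hn
            rw [← hist_haltRun fun s hs hh => hnr (hh.mono (Nat.lt_succ_iff.1 hs))]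
            exact h
          · intro h
            have hnr : ¬ Noisy m τ.1 i (hist r t) := by
              have h3 : (hist r t).map (canon i) = g.map (canon i) := by
                rw [hist_succ, List.map_append] at h
                rw [List.map_append] at hc
                have h4 := List.append_inj h (by simp [hgt])
                have h5 := List.append_inj hc (by simp)
                rw [h4.1, h5.1]
              rw [noisy_congr h3]
              exact hn
            rw [hist_haltRun fun s hs hh => hnr (hh.mono (Nat.lt_succ_iff.1 hs))]
            exact h
        rw [hset]
        -- If the two probabilities differ, one of them is positive, and this provides the legal run
        -- to which `hQ` applies.
        by_contra hne
        have hex : ∃ r, IsRun m r ∧ (hist r (t + 1)).map (canon i) = (g ++ [p]).map (canon i) := by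
          rw [← hg]
          by_cases h0 : runMeasure (Function.update ρ i σ)
              {r | (hist r (g ++ [p]).length).map (canon i) = (g ++ [p]).map (canon i)} = 0
          · rw [h0] at hne
            obtain ⟨r, hr, hp⟩ := exists_positive_of_measure_ne_zero (Ne.symm hne)
            exact ⟨r, hp.isRun, hr⟩
          · obtain ⟨r, hr, hp⟩ := exists_positive_of_measure_ne_zero h0
            exact ⟨r, hp.isRun, hr⟩
        obtain ⟨r, hr, hrg⟩ := hex
        apply hne
        have hrt : ¬ Noisy m τ.1 i (hist r t) := by
          have h3 : (hist r t).map (canon i) = g.map (canon i) := by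
            rw [hist_succ, List.map_append, List.map_append] at hrg
            exact (List.append_inj hrg (by simp [hgt])).1
          rw [noisy_congr h3]
          exact hn
        rw [measure_canon_hist, measure_canon_hist, Function.update_self, Function.update_self,
          ← outProb_congr_canon hrg, ← outProb_congr_canon hrg, hQ r t hr hrt]
        congr 1
        refine Finset.prod_congr rfl fun j hj => ?_
        rw [Function.update_of_ne (Finset.ne_of_mem_erase hj),
          Function.update_of_ne (Finset.ne_of_mem_erase hj)]
      · have hset : {r : Run n | hist (haltRun m τ.1 i r) (t + 1) = g ++ [p]} = ∅ := by
          ext r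
          simp only [Set.mem_ofPred_eq, Set.mem_empty_iff_false, iff_false]
          intro h
          have hnr : ¬ Noisy m τ.1 i (hist r t) := by
            rw [hnoisy r ((hsplit r).1 h).1]; exact hn
          rw [hist_haltRun fun s hs hh => hnr (hh.mono (Nat.lt_succ_iff.1 hs))] at h
          apply hc
          rw [← h]
          simp [Function.comp_def]
        rw [hset]
        simp

variable {u : Fin n → Run n → ℝ}

/-- In the stopped run the set of other learners can only shrink, while `i` itself learns exactly as
before. -/
theorem le_haltRun (hU1 : U1 m u) (hU3 : U3 m u) {r : Run n} (hr : IsRun m r) :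
    u i r ≤ u i (haltRun m f i r) := by
  by_cases h : learners m r = learners m (haltRun m f i r)
  · exact (hU1 i _ _ hr hr.haltRun fun j => Set.ext_iff.1 h j).le
  · refine (hU3 i _ _ hr.haltRun hr (learns_haltRun_self r) (fun j _ => learns_of_haltRun) ?_).le
    by_contra hcon
    push Not at hcon
    apply h
    ext j
    refine ⟨fun hj => ?_, learns_of_haltRun⟩
    by_cases hji : j = i
    · subst hji; exact (learns_haltRun_self r).2 hj
    · by_contra hj'
      exact hcon j hji hj' hj

theorem lt_haltRun (hU3 : U3 m u) {r : Run n} (hr : IsRun m r) {j : Fin n} (hj : j ≠ i)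
    (h1 : Learns m r j) (h2 : ¬ Learns m (haltRun m f i r) j) :
    u i r < u i (haltRun m f i r) :=
  hU3 i _ _ hr.haltRun hr (learns_haltRun_self r) (fun _ _ => learns_of_haltRun) ⟨j, hj, h2, h1⟩

/-- A strategy `σ` for `i` is at least as good as `τ` if it shows the same behaviour until `τ` might
be noisy, and afterwards nobody learns the secret if `i` follows `σ`. It is better if with positive
probability somebody else learns the secret then if `i` follows `τ`. -/
theorem expectedUtility_compare (hU1 : U1 m u) (hU3 : U3 m u) (ρ : ∀ j, Strategy n m j)
    (σ τ : Strategy n m i)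
    (hQ : ∀ r t, IsRun m r → ¬ Noisy m τ.1 i (hist r t) →
      outProb σ.1 i [] (hist r (t + 1)) = outProb τ.1 i [] (hist r (t + 1)))
    (hσ : ∀ r, Positive (Function.update ρ i σ) r → ∀ j, Learns m r j →
      Learns m (haltRun m τ.1 i r) j) :
    expectedUtility m u i (Function.update ρ i τ) ≤
      expectedUtility m u i (Function.update ρ i σ) ∧
    (runMeasure (Function.update ρ i τ)
      {r | ∃ j, j ≠ i ∧ Learns m r j ∧ ¬ Learns m (haltRun m τ.1 i r) j} ≠ 0 →
      expectedUtility m u i (Function.update ρ i τ) <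
        expectedUtility m u i (Function.update ρ i σ)) := by
  obtain ⟨w, hw⟩ := exists_value hU1
  have hmeas := measurable_haltRun (m := m) (f := τ.1) (i := i)
  -- Under `σ` stopping changes nothing for the learners by `hσ`, and the law of the stopped run may
  -- be computed with `τ` instead.
  have hS : expectedUtility m u i (Function.update ρ i σ) =
      ∫ r, w i (learners m (haltRun m τ.1 i r)) ∂runMeasure (Function.update ρ i τ) := by
    rw [expectedUtility_eq hw,
      ← integral_map (f := fun r => w i (learners m r)) hmeas.aemeasurable
        (measurable_value _).aestronglyMeasurable, ← map_haltRun_eq ρ σ τ hQ,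
      integral_map (f := fun r => w i (learners m r)) hmeas.aemeasurable
        (measurable_value _).aestronglyMeasurable]
    refine integral_congr_ae ?_
    filter_upwards [ae_positive (Function.update ρ i σ)] with r hr
    congr 1
    ext j
    exact ⟨hσ r hr j, learns_of_haltRun⟩
  have hint : Integrable (fun r => w i (learners m (haltRun m τ.1 i r)))
      (runMeasure (Function.update ρ i τ)) := by
    have := Measure.isProbabilityMeasure_map (μ := runMeasure (Function.update ρ i τ))
      hmeas.aemeasurable
    exact (integrable_map_measure (measurable_value _).aestronglyMeasurable
      hmeas.aemeasurable).1 (integrable_value (w i) _)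
  have hle : (fun r => w i (learners m r)) ≤ᵐ[runMeasure (Function.update ρ i τ)]
      fun r => w i (learners m (haltRun m τ.1 i r)) := by
    filter_upwards [ae_positive (Function.update ρ i τ)] with r hr
    have := le_haltRun (f := τ.1) (i := i) hU1 hU3 hr.isRun
    rwa [hw i _ hr.isRun, hw i _ hr.isRun.haltRun] at this
  rw [hS, expectedUtility_eq hw]
  refine ⟨integral_mono_ae (integrable_value _ _) hint hle, fun hpos => ?_⟩
  refine lt_of_le_of_ne (integral_mono_ae (integrable_value _ _) hint hle) fun heq => hpos ?_
  have hae := (integral_eq_iff_of_ae_le (integrable_value _ _) hint hle).1 heq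
  have hae2 : ∀ᵐ r ∂runMeasure (Function.update ρ i τ),
      ¬ ∃ j, j ≠ i ∧ Learns m r j ∧ ¬ Learns m (haltRun m τ.1 i r) j := by
    filter_upwards [hae, ae_positive (Function.update ρ i τ)] with r hr hp
    rintro ⟨j, hj, h1, h2⟩
    have := lt_haltRun (f := τ.1) hU3 hp.isRun hj h1 h2
    rw [hw i _ hp.isRun, hw i _ hp.isRun.haltRun] at this
    exact this.ne hr
  simpa using ae_iff.1 hae2

end Payoffs

/-! ### Discreet strategies and the equality of visible behaviours -/

section Discreet

variable {n m : ℕ} {i : Fin n}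

@[simp] theorem msgTo_play (msg : Fin n → Msg n) (ask : Bool) :
    (Move.play msg ask).msgTo = msg := rfl

@[simp] theorem asks_play (msg : Fin n → Msg n) (ask : Bool) : (Move.play msg ask).asks = ask := rfl

/-- A player who follows `f` does nothing that others could notice once it knows the secret. -/
def Discreet (m : ℕ) (i : Fin n) (f : View n → PMF (Move n)) : Prop :=
  ∀ h : List (Profile n), Knows m i (view i h) → moveProb f i [] h ≠ 0 →
    ∀ a ∈ (f (view i h)).support, Silent a

open Classical in
/-- The expectation of `g` at the local state that is reached with the behaviour recorded in `h`. -/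
noncomputable def outExp (f : View n → PMF (Move n)) (i : Fin n) (g : View n → ENNReal) :
    View n → List (Profile n) → ENNReal
  | v, [] => g v
  | v, p :: h => ∑' a, if canon i (Function.update p i a) = canon i p then
      f v a * outExp f i g (v ++ [observe i (Function.update p i a)]) h else 0

variable {f : View n → PMF (Move n)}

theorem outProb_append (v : View n) (h h' : List (Profile n)) :
    outProb f i v (h ++ h') = outExp f i (fun v => outProb f i v h') v h := by
  induction h generalizing v with
  | nil => rfl
  | cons p h ih => simp [outProb, outExp, ih]

theorem outExp_const_one (v : View n) (h : List (Profile n)) :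
    outExp f i (fun _ => 1) v h = outProb f i v h := by
  induction h generalizing v with
  | nil => rfl
  | cons p h ih => simp [outProb, outExp, ih]

theorem outExp_const_mul (c : ENNReal) (g : View n → ENNReal) (v : View n)
    (h : List (Profile n)) :
    outExp f i (fun v => c * g v) v h = c * outExp f i g v h := by
  induction h generalizing v with
  | nil => rfl
  | cons p h ih =>
    rw [outExp, outExp, ← ENNReal.tsum_mul_left]
    congr 1
    ext a
    rw [ih]
    split_ifs
    · ring
    · simp

theorem outExp_tsum {ι : Type*} (g : ι → View n → ENNReal) (v : View n) (h : List (Profile n)) :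
    outExp f i (fun v => ∑' y, g y v) v h = ∑' y, outExp f i (g y) v h := by
  induction h generalizing v with
  | nil => rfl
  | cons p h ih =>
    simp only [outExp]
    rw [ENNReal.tsum_comm]
    congr 1
    ext a
    split_ifs
    · rw [ih, ENNReal.tsum_mul_left]
    · simp

/-- Only local states that `f` reaches with positive probability and that look like `h` contribute.
-/
theorem outExp_congr {g g' : View n → ENNReal} (v : View n) (h : List (Profile n))
    (hg : ∀ h', h'.map (canon i) = h.map (canon i) → moveProb f i v h' ≠ 0 →
      g (v ++ view i h') = g' (v ++ view i h')) :
    outExp f i g v h = outExp f i g' v h := by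
  induction h generalizing v with
  | nil => simpa [outExp, view] using hg [] rfl (by simp [moveProb])
  | cons p h ih =>
    rw [outExp, outExp]
    congr 1
    ext a
    split_ifs with ha
    · by_cases h0 : f v a = 0
      · simp [h0]
      rw [ih]
      intro h' hh' hne
      have := hg (Function.update p i a :: h') (by simp [ha, hh'])
        (by simpa [moveProb] using ⟨h0, hne⟩)
      simpa [view] using this
    · rfl

theorem outProb_le_one (v : View n) (h : List (Profile n)) : outProb f i v h ≤ 1 := by
  induction h generalizing v with
  | nil => simp [outProb]
  | cons p h ih =>
    rw [outProb, ← (f v).tsum_coe]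
    refine ENNReal.tsum_le_tsum fun a => ?_
    split_ifs
    · exact mul_le_of_le_one_right' (ih _)
    · exact zero_le

theorem outProb_ne_zero {v : View n} {h h' : List (Profile n)}
    (hh : h'.map (canon i) = h.map (canon i)) (h0 : moveProb f i v h' ≠ 0) :
    outProb f i v h ≠ 0 := by
  induction h generalizing v h' with
  | nil => simp [outProb]
  | cons p h ih =>
    cases h' with
    | nil => simp at hh
    | cons p' h' =>
      simp only [List.map_cons, List.cons.injEq] at hh
      have hp : Function.update p i (p' i) = p' := by
        ext1 j
        by_cases hj : j = i
        · subst hj; simp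
        · rw [Function.update_of_ne hj, ← canon_of_ne hj p, ← hh.1, canon_of_ne hj]
      rw [outProb]
      refine (ENNReal.tsum_eq_zero.not.2 ?_)
      push Not
      refine ⟨p' i, ?_⟩
      rw [hp, if_pos hh.1]
      rw [moveProb] at h0
      exact mul_ne_zero (left_ne_zero_of_mul h0) (ih hh.2 (right_ne_zero_of_mul h0))

/-- All players but `i` send nothing and ask for a restart; player `i` acts visibly. -/
def exposed (i : Fin n) (y : (Fin n → Msg n) × Bool) : Profile n :=
  fun j => if j = i then .play y.1 y.2 else .play (fun _ => Msg.empty) true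

theorem exposed_self (y : (Fin n → Msg n) × Bool) : exposed i y i = .play y.1 y.2 := by
  simp [exposed]

theorem exposed_of_ne {j : Fin n} (hj : j ≠ i) (y : (Fin n → Msg n) × Bool) :
    exposed i y j = .play (fun _ => Msg.empty) true := by
  simp [exposed, hj]

theorem restarts_exposed (y : (Fin n → Msg n) × Bool) : restarts (exposed i y) = y.2 := by
  have := restarts_update i (exposed i y) (exposed i y i)
  rw [Function.update_eq_self, exposed_self] at this
  rw [Bool.eq_iff_iff, this]
  refine and_iff_left fun k hk => ?_
  rw [exposed_of_ne hk]
  rfl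

theorem restarts_update_exposed (y : (Fin n → Msg n) × Bool) (a : Move n) :
    restarts (Function.update (exposed i y) i a) = a.asks := by
  rw [Bool.eq_iff_iff, restarts_update]
  refine and_iff_left fun k hk => ?_
  rw [exposed_of_ne hk]
  rfl

open Classical in
theorem outProb_exposed (v : View n) (y : (Fin n → Msg n) × Bool) :
    outProb f i v [exposed i y] = ∑' a, if a.msgTo = y.1 ∧ a.asks = y.2 then f v a else 0 := by
  rw [outProb]
  congr 1
  ext a
  simp only [canon_update_eq_iff, restarts_update_exposed, restarts_exposed, exposed_self]
  simp [outProb]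

/-- If all others ask for a restart, a request of `i` becomes visible too. So the exposed rounds
distinguish moves by messages and request, and every move belongs to exactly one of them. -/
theorem tsum_outProb_exposed (v : View n) : ∑' y, outProb f i v [exposed i y] = 1 := by
  classical
  simp only [outProb_exposed]
  rw [ENNReal.tsum_comm, ← (f v).tsum_coe]
  congr 1
  ext a
  rw [tsum_eq_single (a.msgTo, a.asks)]
  · simp
  · rintro ⟨b, c⟩ hne
    rw [if_neg]
    rintro ⟨rfl, rfl⟩
    exact hne rfl

theorem tsum_outProb_append_exposed (v : View n) (h : List (Profile n)) :
    ∑' y, outProb f i v (h ++ [exposed i y]) = outProb f i v h := by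
  simp only [outProb_append]
  rw [← outExp_tsum]
  simp only [tsum_outProb_exposed]
  exact outExp_const_one v h

/-- In any other round the visible behaviour is coarser than in an exposed one, so its probability
is a sum of exposed probabilities. It is enough to compare strategies on exposed rounds. -/
theorem outProb_singleton (v : View n) (q : Profile n) :
    outProb f i v [q] = ∑' ask : Bool,
      (if restarts (Function.update q i (.play (q i).msgTo ask)) = restarts q then 1 else 0) *
        outProb f i v [exposed i ((q i).msgTo, ask)] := by
  classical
  simp only [outProb_exposed]
  simp only [← ENNReal.tsum_mul_left]
  rw [ENNReal.tsum_comm, outProb]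
  congr 1
  ext a
  rw [tsum_eq_single a.asks]
  · simp only [canon_update_eq_iff]
    have : restarts (Function.update q i (.play (q i).msgTo a.asks)) =
        restarts (Function.update q i a) := by
      rw [Bool.eq_iff_iff, restarts_update, restarts_update]
      rfl
    rw [this]
    by_cases h1 : a.msgTo = (q i).msgTo <;>
      by_cases h2 : restarts (Function.update q i a) = restarts q <;> simp [h1, h2, outProb]
  · intro b hb
    simp [hb.symm]

theorem outProb_append_singleton (v : View n) (h : List (Profile n)) (q : Profile n) :
    outProb f i v (h ++ [q]) = ∑' ask : Bool,
      (if restarts (Function.update q i (.play (q i).msgTo ask)) = restarts q then 1 else 0) *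
        outProb f i v (h ++ [exposed i ((q i).msgTo, ask)]) := by
  simp only [outProb_append, outProb_singleton _ q]
  rw [outExp_tsum]
  simp only [outExp_const_mul]

theorem outProb_append_of_silent (v : View n) (h : List (Profile n)) (q : Profile n)
    (hs : ∀ h', h'.map (canon i) = h.map (canon i) → moveProb f i v h' ≠ 0 →
      ∀ a ∈ (f (v ++ view i h')).support, Silent a) :
    outProb f i v (h ++ [q]) =
      (if (∀ k, (q i).msgTo k = Msg.empty) ∧ restarts q = false then 1 else 0) *
        outProb f i v h := by
  classical
  rw [outProb_append, ← outExp_const_one (f := f) v h, ← outExp_const_mul]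
  refine outExp_congr v h fun h' hh' hne => ?_
  have hsil := hs h' hh' hne
  rw [mul_one, outProb]
  split_ifs with hq
  · rw [← (f (v ++ view i h')).tsum_coe]
    congr 1
    ext a
    by_cases ha : a ∈ (f (v ++ view i h')).support
    · rw [if_pos, outProb, mul_one]
      refine (canon_update_eq_iff ..).2 ⟨?_, ?_⟩
      · funext k
        rw [(hsil a ha).1, hq.1]
      · rw [hq.2, ← Bool.not_eq_true, restarts_update, (hsil a ha).2]
        simp
    · rw [PMF.mem_support_iff, not_not] at ha
      simp [ha]
  · rw [ENNReal.tsum_eq_zero]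
    intro a
    by_cases ha : a ∈ (f (v ++ view i h')).support
    · rw [if_neg]
      intro hc
      obtain ⟨h1, h2⟩ := (canon_update_eq_iff ..).1 hc
      refine hq ⟨fun k => by rw [← h1, (hsil a ha).1], ?_⟩
      rw [← h2, ← Bool.not_eq_true, restarts_update, (hsil a ha).2]
      simp
    · rw [PMF.mem_support_iff, not_not] at ha
      simp [ha]

theorem tsum_eq_of_le {ι : Type*} {g g' : ι → ENNReal} (hle : ∀ y, g y ≤ g' y)
    (hsum : ∑' y, g y = ∑' y, g' y) (hfin : ∑' y, g y ≠ ⊤) (y : ι) : g y = g' y := by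
  by_contra hne
  exact (ENNReal.tsum_lt_tsum hfin hle (lt_of_le_of_ne (hle y) hne)).ne hsum

/-- If `σ` shows no behaviour with a higher probability than `τ` while the player does not know the
secret, then the behaviours agree until `τ` might be noisy. -/
theorem outProb_eq_of_le {σ τ : Strategy n m i} (hσ : Discreet m i σ.1)
    (hle : ∀ r t, IsRun m r → ¬ Knows m i (view i (hist r t)) → ∀ y,
      outProb σ.1 i [] (hist r t ++ [exposed i y]) ≤ outProb τ.1 i [] (hist r t ++ [exposed i y]))
    (r : Run n) (t : ℕ) (hr : IsRun m r) (hn : ¬ Noisy m τ.1 i (hist r t)) :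
    outProb σ.1 i [] (hist r (t + 1)) = outProb τ.1 i [] (hist r (t + 1)) := by
  have hstep : ∀ t, outProb σ.1 i [] (hist r t) = outProb τ.1 i [] (hist r t) →
      ¬ Noisy m τ.1 i (hist r t) →
      outProb σ.1 i [] (hist r (t + 1)) = outProb τ.1 i [] (hist r (t + 1)) := by
    intro t ih hn
    -- If `i` knows the secret, both strategies are silent: `σ` as it is discreet, `τ` as it is not
    -- noisy yet. If not, `hle` compares the terms of two series that have the same finite sum, so
    -- that all terms agree.
    by_cases hk : Knows m i (view i (hist r t))
    · rw [hist_succ, outProb_append_of_silent, outProb_append_of_silent, ih]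
      · intro h' hh' hne a ha
        by_contra hs
        refine hn ⟨t, by simp, ?_, h', ?_, hne, a, ha, hs⟩
        · rwa [hist_take r le_rfl]
        · rwa [hist_take r le_rfl]
      · intro h' hh' hne
        exact hσ h' ((knows_congr_canon hh').2 hk) hne
    · have hy := tsum_eq_of_le (hle r t hr hk)
        (by rw [tsum_outProb_append_exposed, tsum_outProb_append_exposed, ih])
        (by rw [tsum_outProb_append_exposed]
            exact ((outProb_le_one _ _).trans_lt ENNReal.one_lt_top).ne)
      rw [hist_succ, outProb_append_singleton, outProb_append_singleton]
      simp only [hy]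
  induction t with
  | zero => exact hstep 0 rfl hn
  | succ t ih => exact hstep (t + 1) (ih fun h => hn (h.mono (Nat.le_succ t))) hn

end Discreet

/-! ### Scripts by which the other players react to a given behaviour of `i` -/

section Scripts

variable {n m : ℕ}

/-- The form in which `recovered_lt` is applied to the scripts, with `c` the unpredictable player
`i`: what comes from `i` is a single source, and all others send only what `j` could pass on itself.
-/
theorem not_knows_of_sources (hn : 3 ≤ n) (hm : 2 ≤ m) (hmn : m ≤ n) {j c : Fin n} (hc : c ≠ j)
    {r : Run n} {t : ℕ}
    (h : ∀ t' < t, ∀ k, ∀ y ∈ ((r t' k).msgTo j).pieces, Sendable m j y.2 ∨ Permitted m c j y.2) :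
    ¬ Knows m j (view j (hist r t)) := by
  rintro ⟨s, hs⟩
  refine (recovered_lt hn hm hmn hc fun x hx => ?_).not_ge hs
  have hx : Holds m j (view j (hist r t)) s x := hx
  rw [holds_view] at hx
  rcases hx with hx | ⟨t', ht', k, hk⟩
  · exact Or.inl hx.2
  · exact Or.inr (h t' ht' k _ hk)

/-- All pieces of a sharing. -/
def allPieces (n : ℕ) : Finset (Piece n) :=
  Finset.univ.image Piece.share ∪
    Finset.univ.image fun x : Fin 2 × Fin n => Piece.sub x.1 x.2

theorem mem_allPieces (x : Piece n) : x ∈ allPieces n := by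
  cases x <;> simp [allPieces]

/-- Player `j` with local state `v` has seen player `i` act as in the first rounds `0, …, T` of
`pl`, and in round `T + 1` all others confirmed that they have seen the same. -/
def Matched (i j : Fin n) (pl : Run n) (T : ℕ) (v : View n) : Prop :=
  ∀ s (hs : s < v.length),
    (s ≤ T → v[s].recv i = (pl s i).msgTo j ∧ v[s].restart = restarts (pl s)) ∧
    (s = T + 1 → ∀ k, k ≠ i → k ≠ j → (v[s].recv k).bit = some true)

open Classical in
/-- Player `j` plays as in the rounds `0, …, T` of `pl`, but to players other than `i` it sends only
such pieces as they can pass on. Then it confirms that `i` has acted as in `pl`. If so, it sends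
for `R` rounds to each player `k` the pieces that satisfy `Z k`. -/
noncomputable def scriptMove (m : ℕ) (i : Fin n) (pl : Run n) (T R : ℕ)
    (Z : Fin n → Piece n → Prop) (j : Fin n) (v : View n) : Move n :=
  if Knows m j v ∨ ¬ Matched i j pl T v then .halt
  else if v.length ≤ T then sendAll m j v (fun k => ⟨((pl v.length j).msgTo k).bit,
      ((pl v.length j).msgTo k).pieces.filter fun y => k = i ∨ Sendable m k y.2⟩)
      (pl v.length j).asks
  else if v.length = T + 1 then
    sendAll m j v (fun k => ⟨if k = i then none else some true, ∅⟩) false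
  else if v.length ≤ T + 1 + R then
    sendAll m j v (fun k => ⟨none, (Finset.range (sharing v + 1) ×ˢ allPieces n).filter
      fun y => Z k y.2⟩) false
  else .halt

theorem legal_scriptMove (i : Fin n) (pl : Run n) (T R : ℕ)
    (Z : Fin n → Piece n → Prop) (j : Fin n) (v : View n) :
    Legal m j v (scriptMove m i pl T R Z j v) := by
  unfold scriptMove
  split_ifs
  · trivial
  · exact legal_sendAll ..
  · exact legal_sendAll ..
  · exact legal_sendAll ..
  · trivial

/-- The deterministic strategy of player `j` given by `scriptMove`. -/
noncomputable def script (m : ℕ) (i : Fin n) (pl : Run n) (T R : ℕ)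
    (Z : Fin n → Piece n → Prop) (j : Fin n) : Strategy n m j :=
  ⟨fun v => PMF.pure (scriptMove m i pl T R Z j v), fun v a ha => by
    rw [PMF.mem_support_pure_iff] at ha
    subst ha
    exact legal_scriptMove ..⟩

/-- Rewards and punishments have to be carried out by strategies that survive. For this reason a
script halts as soon as its player knows the secret. -/
theorem discreet_script (i : Fin n) (pl : Run n) (T R : ℕ)
    (Z : Fin n → Piece n → Prop) (j : Fin n) : Discreet m j (script m i pl T R Z j).1 := by
  intro h hk _ a ha
  rw [script, PMF.mem_support_pure_iff] at ha
  subst ha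
  rw [scriptMove, if_pos (Or.inl hk)]
  exact ⟨fun _ => rfl, rfl⟩

theorem sendAll_pieces {j k : Fin n} {v : View n} {f : Fin n → Msg n} {ask : Bool}
    {y : ℕ × Piece n} (h : y ∈ ((sendAll m j v f ask).msgTo k).pieces) : y ∈ (f k).pieces := by
  unfold sendAll at h
  split_ifs at h with h1
  · rw [msgTo_play] at h
    split_ifs at h with h2
    · simp [Msg.empty] at h
    · exact (Finset.mem_filter.1 h).1
  · simp [Move.msgTo, Msg.empty] at h

theorem sendAll_eq {j : Fin n} {v : View n} {f : Fin n → Msg n} {ask : Bool}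
    (hv : ∀ o ∈ v, o.own ≠ Move.halt) : sendAll m j v f ask =
      .play (fun k => if k = j then Msg.empty else
      ⟨(f k).bit, (f k).pieces.filter fun y => Holds m j v y.1 y.2 ∧ Permitted m j k y.2⟩) ask := by
  rw [sendAll, if_pos hv]

theorem sendAll_asks {j : Fin n} {v : View n} {f : Fin n → Msg n} {ask : Bool}
    (h : (sendAll m j v f ask).asks = true) : ask = true := by
  unfold sendAll at h
  split_ifs at h
  · exact h
  · simp [Move.asks] at h

/-- `Matched` for the first `t` rounds of a run. -/
def MatchedAt (i : Fin n) (pl : Run n) (T : ℕ) (r : Run n) (j : Fin n) (t : ℕ) : Prop :=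
  ∀ s < t, (s ≤ T → (r s i).msgTo j = (pl s i).msgTo j ∧ restarts (r s) = restarts (pl s)) ∧
    (s = T + 1 → ∀ k, k ≠ i → k ≠ j → ((r s k).msgTo j).bit = some true)

theorem view_hist_getElem (j : Fin n) (r : Run n) {s t : ℕ} (hs : s < (view j (hist r t)).length) :
    (view j (hist r t))[s] = observe j (r s) := by
  simp [view, hist]

theorem forall_own_hist {j : Fin n} {r : Run n} {t : ℕ} :
    (∀ o ∈ view j (hist r t), o.own ≠ .halt) ↔ ∀ s < t, r s j ≠ .halt := by
  simp only [view, hist, List.map_map, List.mem_map, List.mem_range, Function.comp]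
  constructor
  · intro h s hs
    exact h _ ⟨s, hs, rfl⟩
  · rintro h _ ⟨s, hs, rfl⟩
    exact h s hs

variable {i : Fin n} {pl : Run n} {T R : ℕ} {Z : Fin n → Piece n → Prop} {r : Run n}

theorem matched_view_iff {j : Fin n} {t : ℕ} :
    Matched i j pl T (view j (hist r t)) ↔ MatchedAt i pl T r j t := by
  unfold Matched MatchedAt
  simp only [view_length, hist_length, view_hist_getElem]
  rfl

theorem MatchedAt.mono {j : Fin n} {s t : ℕ} (h : MatchedAt i pl T r j t) (hst : s ≤ t) :
    MatchedAt i pl T r j s := fun s' hs' => h s' (by omega)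

/-- All players but `i` follow the script in the run `r`. -/
def FollowsScript (m : ℕ) (i : Fin n) (pl : Run n) (T R : ℕ) (Z : Fin n → Piece n → Prop)
    (r : Run n) : Prop :=
  ∀ t j, j ≠ i → r t j = scriptMove m i pl T R Z j (view j (hist r t))

theorem FollowsScript.alive (hr : FollowsScript m i pl T R Z r) {j : Fin n} (hj : j ≠ i)
    {t : ℕ} (ht : t ≤ T + 1 + R) (hk : ¬ Knows m j (view j (hist r t)))
    (hM : MatchedAt i pl T r j t) : ∀ o ∈ view j (hist r t), o.own ≠ .halt := by
  rw [forall_own_hist]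
  intro s
  induction s using Nat.strong_induction_on with
  | _ s ih =>
    intro hs
    have hown : ∀ o ∈ view j (hist r s), o.own ≠ .halt :=
      forall_own_hist.2 fun s' hs' => ih s' hs' (by omega)
    have hk' : ¬ Knows m j (view j (hist r s)) := fun h => hk (knows_mono h hs.le)
    have hM' : Matched i j pl T (view j (hist r s)) := matched_view_iff.2 (hM.mono hs.le)
    rw [hr s j hj, scriptMove, if_neg (by tauto), view_length, hist_length]
    split_ifs
    · rw [sendAll_eq hown]; simp
    · rw [sendAll_eq hown]; simp
    · rw [sendAll_eq hown]; simp
    · omega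

open Classical in
theorem FollowsScript.early (hr : FollowsScript m i pl T R Z r) {j : Fin n} (hj : j ≠ i)
    {t : ℕ} (ht : t ≤ T) (hk : ¬ Knows m j (view j (hist r t)))
    (hM : MatchedAt i pl T r j t) : r t j = .play (fun k => if k = j then Msg.empty else
      ⟨((pl t j).msgTo k).bit,
      (((pl t j).msgTo k).pieces.filter fun y => k = i ∨ Sendable m k y.2).filter fun y =>
        Holds m j (view j (hist r t)) y.1 y.2 ∧ Permitted m j k y.2⟩) (pl t j).asks := by
  have hown := hr.alive hj (by omega) hk hM
  have hM' := matched_view_iff.2 hM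
  rw [hr t j hj, scriptMove, if_neg (by tauto), view_length, hist_length, if_pos ht,
    sendAll_eq hown]

theorem FollowsScript.confirm (hr : FollowsScript m i pl T R Z r) {j : Fin n} (hj : j ≠ i)
    (hk : ¬ Knows m j (view j (hist r (T + 1)))) (hM : MatchedAt i pl T r j (T + 1))
    {k : Fin n} (hkj : k ≠ j) (hki : k ≠ i) : ((r (T + 1) j).msgTo k).bit = some true := by
  have hown := hr.alive hj (by omega) hk hM
  have hM' := matched_view_iff.2 hM
  rw [hr _ j hj, scriptMove, if_neg (by tauto), view_length, hist_length, if_neg (by omega),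
    if_pos rfl, sendAll_eq hown, msgTo_play, if_neg hkj]
  simp [hki]

theorem FollowsScript.reveal (hr : FollowsScript m i pl T R Z r) (hrun : IsRun m r) {j : Fin n}
    (hj : j ≠ i) {t : ℕ} (ht : T + 1 < t) (ht' : t ≤ T + 1 + R)
    (hk : ¬ Knows m j (view j (hist r t))) (hM : MatchedAt i pl T r j t)
    {k : Fin n} (hkj : k ≠ j) {s : ℕ} {x : Piece n} (hx : Holds m j (view j (hist r t)) s x)
    (hp : Permitted m j k x) (hZ : Z k x) : (s, x) ∈ ((r t j).msgTo k).pieces := by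
  have hown := hr.alive hj (by omega) hk hM
  have hM' := matched_view_iff.2 hM
  rw [hr _ j hj, scriptMove, if_neg (by tauto), view_length, hist_length, if_neg (by omega),
    if_neg (by omega), if_pos ht', sendAll_eq hown, msgTo_play, if_neg hkj]
  have hs : s ≤ sharingAt r t := by
    rcases hrun.issued hx with h | h
    · exact h.le
    · exact h.1.le
  simp only [Finset.mem_filter, Finset.mem_product, Finset.mem_range, mem_allPieces, and_true,
    sharing_view]
  exact ⟨⟨by omega, hZ⟩, hx, hp⟩

theorem FollowsScript.pieces (hr : FollowsScript m i pl T R Z r) {j : Fin n} (hj : j ≠ i)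
    {t : ℕ} {k : Fin n} {y : ℕ × Piece n} (hy : y ∈ ((r t j).msgTo k).pieces) :
    MatchedAt i pl T r j t ∧ ((t ≤ T ∧ y ∈ ((pl t j).msgTo k).pieces ∧ (k = i ∨ Sendable m k y.2)) ∨
      (T + 1 < t ∧ Z k y.2)) := by
  rw [hr t j hj, scriptMove, view_length, hist_length, matched_view_iff] at hy
  split_ifs at hy with h1 h2 h3 h4
  · simp [Move.msgTo, Msg.empty] at hy
  · have := sendAll_pieces hy
    simp only [Finset.mem_filter] at this
    exact ⟨not_not.1 fun h => h1 (Or.inr h), Or.inl ⟨h2, this⟩⟩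
  · simpa using sendAll_pieces hy
  · have := sendAll_pieces hy
    simp only [Finset.mem_filter] at this
    exact ⟨not_not.1 fun h => h1 (Or.inr h), Or.inr ⟨by omega, this.2⟩⟩
  · simp [Move.msgTo, Msg.empty] at hy

/-- A player that has noticed a discrepancy halts, so each bit that it sends is a testimony. -/
theorem FollowsScript.matched_of_bit (hr : FollowsScript m i pl T R Z r) {j : Fin n} (hj : j ≠ i)
    {t : ℕ} {k : Fin n} {b : Bool} (hb : ((r t j).msgTo k).bit = some b) :
    MatchedAt i pl T r j t := by
  rw [hr t j hj, scriptMove, matched_view_iff] at hb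
  by_contra hcon
  rw [if_pos (Or.inr hcon)] at hb
  simp [Move.msgTo, Msg.empty] at hb

theorem FollowsScript.asks (hr : FollowsScript m i pl T R Z r) {j : Fin n} (hj : j ≠ i)
    {t : ℕ} (ht : T < t) : (r t j).asks = false := by
  rw [← Bool.not_eq_true]
  intro h
  rw [hr t j hj, scriptMove, view_length, hist_length] at h
  split_ifs at h with h1 h2 h3 h4
  · simp [Move.asks] at h
  · omega
  · simpa using sendAll_asks h
  · simpa using sendAll_asks h
  · simp [Move.asks] at h

/-- All players but `i` have seen `i` act as in `pl`. -/
def AllMatched (i : Fin n) (pl : Run n) (T : ℕ) (r : Run n) : Prop :=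
  ∀ j, j ≠ i → MatchedAt i pl T r j (T + 1)

/-- The confirmations of round `T + 1` turn the private observation of `j` into knowledge about all
others. Without them `i` could show the planned behaviour to only some of the players. -/
theorem FollowsScript.allMatched (hr : FollowsScript m i pl T R Z r) {j : Fin n} (hj : j ≠ i)
    {t : ℕ} (ht : T + 1 < t) (hM : MatchedAt i pl T r j t) : AllMatched i pl T r := by
  intro k hk
  by_cases hkj : k = j
  · subst hkj; exact hM.mono (by omega)
  · exact hr.matched_of_bit hk ((hM (T + 1) ht).2 rfl k hk hkj)

/-- Unless everybody has seen `i` act as in `pl`, the other players do not learn the secret; and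
neither do they if pieces are revealed to `i` only. -/
theorem FollowsScript.not_knows (hn : 3 ≤ n) (hm : 2 ≤ m) (hmn : m ≤ n)
    (hr : FollowsScript m i pl T R Z r) (hrun : IsRun m r) {j : Fin n} (hj : j ≠ i) {t : ℕ}
    (h : T + 1 < t → ¬ AllMatched i pl T r ∨ ∀ x, Z j x → Sendable m j x) :
    ¬ Knows m j (view j (hist r t)) := by
  refine not_knows_of_sources hn hm hmn hj.symm fun t' ht' k y hy => ?_
  by_cases hk : k = i
  · subst hk
    exact Or.inr (hrun.legal_play hy).2
  · left
    obtain ⟨h1, h2 | h2⟩ := hr.pieces hk hy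
    · exact h2.2.2.resolve_left hj
    · rcases h (by omega) with h | h
      · exact absurd (hr.allMatched hk h2.1 h1) h
      · exact h _ h2.2

/-- Nobody but `i` knows the secret up to round `T + 1`, so no player is kept from confirming. -/
theorem AllMatched.matchedAt (hn : 3 ≤ n) (hm : 2 ≤ m) (hmn : m ≤ n)
    (hr : FollowsScript m i pl T R Z r) (hrun : IsRun m r) (hE : AllMatched i pl T r)
    {j : Fin n} (hj : j ≠ i) (t : ℕ) : MatchedAt i pl T r j t := by
  intro s _
  refine ⟨fun h => (hE j hj s (by omega)).1 h, ?_⟩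
  rintro rfl k hki hkj
  exact hr.confirm hki (hr.not_knows hn hm hmn hrun hki fun h => by omega) (hE k hki) hkj.symm hj

theorem exists_ne_of_three (hn : 3 ≤ n) (i : Fin n) : ∃ j : Fin n, j ≠ i := by
  have : Nontrivial (Fin n) := Fin.nontrivial_iff_two_le.2 (by omega)
  exact exists_ne i

/-- The scripts do not ask for a restart after round `T`, so the sharing that is current then
remains available for the revelation. -/
theorem FollowsScript.sharingAt (hn : 3 ≤ n) (hr : FollowsScript m i pl T R Z r) {t : ℕ}
    (ht : T + 1 ≤ t) : sharingAt r t = _root_.sharingAt r (T + 1) := by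
  induction t, ht using Nat.le_induction with
  | base => rfl
  | succ t ht ih =>
    rw [sharingAt_succ, ih]
    obtain ⟨j, hj⟩ := exists_ne_of_three hn i
    have : restarts (r t) ≠ true := by
      intro h
      have := asks_of_restarts h j
      rw [hr.asks hj (by omega)] at this
      simp at this
    simp [this]

theorem two_le_ncard {A : Set (Fin n)} {a b : Fin n} (ha : a ∈ A) (hb : b ∈ A) (hne : a ≠ b) :
    2 ≤ A.ncard := by
  rw [← Set.ncard_pair hne]
  refine Set.ncard_le_ncard ?_ (Set.toFinite _)
  rintro _ (rfl | rfl)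
  · exact ha
  · exact hb

/-- If the pieces are revealed to `i`, then `i` learns the secret. -/
theorem AllMatched.knows (hn : 3 ≤ n) (hm : 2 ≤ m) (hmn : m ≤ n)
    (hr : FollowsScript m i pl T R Z r) (hrun : IsRun m r) (hE : AllMatched i pl T r)
    (hR : 2 ≤ R) (hZ : ∀ j x, Z j x ↔ j = i ∨ Sendable m j x) : Learns m r i := by
  have hrev : ∀ j, j ≠ i → ∀ t, T + 1 < t → t ≤ T + 1 + R → ∀ k, k ≠ j → ∀ s x,
      Holds m j (view j (hist r t)) s x → Permitted m j k x → (k = i ∨ Sendable m k x) →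
      (s, x) ∈ ((r t j).msgTo k).pieces := by
    intro j hj t h1 h2 k hk s x hx hp hz
    refine hr.reveal hrun hj h1 h2 ?_ (hE.matchedAt hn hm hmn hr hrun hj t) hk hx hp ((hZ k x).2 hz)
    exact hr.not_knows hn hm hmn hrun hj fun _ => Or.inr fun x hx => ((hZ j x).1 hx).resolve_left hj
  obtain ⟨s, hs⟩ : ∃ s, s = sharingAt r (T + 1) := ⟨_, rfl⟩
  have hiss : ∀ t, T + 2 ≤ t → IssuedAt r t s := by
    intro t ht
    obtain ⟨t, rfl⟩ : ∃ t', t = t' + 1 := ⟨t - 1, by omega⟩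
    rw [issuedAt_succ_iff, hr.sharingAt hn (by omega), hs]
  have hinit : ∀ j t x, T + 2 ≤ t → Initial m j x → Holds m j (view j (hist r t)) s x :=
    fun j t x ht hx => (holds_view ..).2 (Or.inl ⟨hiss t ht, hx⟩)
  have hgot : ∀ j t t' k x, (s, x) ∈ ((r t' k).msgTo j).pieces → t' < t →
      Holds m j (view j (hist r t)) s x :=
    fun j t t' k x hx ht => (holds_view ..).2 (Or.inr ⟨t', ht, k, hx⟩)
  -- Rounds `T + 2` and `T + 3` are used. If `m = 2`, player `d` can send directly only the
  -- subshares that belong to `i` or to itself.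
  refine ⟨T + 4, s, ?_⟩
  rcases hm.eq_or_lt with rfl | hm3
  · have hrec : ∀ d : Fin 2, Recovers {x | Holds 2 i (view i (hist r (T + 4))) s x}
        ⟨d.val, by omega⟩ := by
      intro d
      by_cases hd : (⟨d.val, by omega⟩ : Fin n) = i
      · left
        exact hinit i _ _ (by omega) hd
      · refine Or.inr ⟨d, rfl, fun l => ?_⟩
        have hown : ∀ l, Holds 2 ⟨d.val, by omega⟩ (view ⟨d.val, by omega⟩ (hist r (T + 2))) s
            (Piece.sub d l) := fun l => hinit _ _ _ le_rfl ⟨rfl, rfl⟩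
        by_cases hl : l = i
        · exact hgot i _ (T + 2) _ _ (hrev _ hd (T + 2) (by omega) (by omega) i (Ne.symm hd) s _
            (hown l) ⟨rfl, Or.inr (Or.inr ⟨rfl, hl⟩)⟩ (Or.inl rfl)) (by omega)
        by_cases hld : l = ⟨d.val, by omega⟩
        · exact hgot i _ (T + 2) _ _ (hrev _ hd (T + 2) (by omega) (by omega) i (Ne.symm hd) s _
            (hown l) ⟨rfl, Or.inl hld⟩ (Or.inl rfl)) (by omega)
        -- Any other subshare takes the route from `d` to its owner `l` and from there to `i`.
        have h1 := hgot l (T + 3) (T + 2) _ _ (hrev _ hd (T + 2) (by omega) (by omega) l hld s _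
            (hown l) ⟨rfl, Or.inr (Or.inr ⟨rfl, rfl⟩)⟩
            (Or.inr (sendable_sub.2 ⟨rfl, Or.inl rfl⟩))) (by omega)
        exact hgot i _ (T + 3) _ _ (hrev l hl (T + 3) (by omega) (by omega) i (Ne.symm hl) s _
            h1 ⟨rfl, Or.inl rfl⟩ (Or.inl rfl)) (by omega)
    exact two_le_ncard (hrec 0) (hrec 1) (by simp)
  · have huniv : {k | Recovers {x | Holds m i (view i (hist r (T + 4))) s x} k} = Set.univ := by
      ext k
      simp only [Set.mem_univ, iff_true]
      left
      by_cases hk : k = i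
      · subst hk
        exact hinit k _ _ (by omega) rfl
      · exact hgot i _ (T + 2) k _ (hrev k hk (T + 2) (by omega) (by omega) i (Ne.symm hk) s _
          (hinit k _ _ le_rfl rfl) ⟨hm3, Or.inl rfl⟩ (Or.inl rfl)) (by omega)
    rw [huniv, Set.ncard_univ, Nat.card_eq_fintype_card, Fintype.card_fin]
    exact hmn

end Scripts

/-! ### A given play replayed by scripts, as seen by `i` -/

section Simulation

variable {n m : ℕ}

theorem sharingAt_congr {r r' : Run n} {t : ℕ} (h : ∀ s < t, restarts (r s) = restarts (r' s)) :
    sharingAt r t = sharingAt r' t := by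
  induction t with
  | zero => rfl
  | succ t ih => rw [sharingAt_succ, sharingAt_succ, h t (by omega), ih fun s hs => h s (by omega)]

theorem issuedAt_congr {r r' : Run n} {t s : ℕ} (h : ∀ s < t, restarts (r s) = restarts (r' s)) :
    IssuedAt r t s ↔ IssuedAt r' t s := by
  cases t with
  | zero => simp [not_issuedAt_zero]
  | succ t =>
    rw [issuedAt_succ_iff, issuedAt_succ_iff, sharingAt_congr fun s hs => h s (by omega)]

/-- The run `r₀` for `T` rounds, followed by a round in which `i` is exposed. -/
def planRun (r₀ : Run n) (T : ℕ) (i : Fin n) (y : (Fin n → Msg n) × Bool) : Run n :=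
  fun t => if t < T then r₀ t else exposed i y

theorem planRun_lt {r₀ : Run n} {T : ℕ} {i : Fin n} {y : (Fin n → Msg n) × Bool} {t : ℕ}
    (ht : t < T) : planRun r₀ T i y t = r₀ t := if_pos ht

theorem planRun_self {r₀ : Run n} {T : ℕ} {i : Fin n} {y : (Fin n → Msg n) × Bool} :
    planRun r₀ T i y T = exposed i y := if_neg (lt_irrefl T)

theorem hist_planRun {r₀ : Run n} {T : ℕ} {i : Fin n} {y : (Fin n → Msg n) × Bool} {t : ℕ}
    (ht : t ≤ T) : hist (planRun r₀ T i y) t = hist r₀ t := by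
  unfold hist
  refine List.map_congr_left fun s hs => planRun_lt ?_
  have := List.mem_range.1 hs
  omega

/-- The history in which all players but `i` follow the script and `i` acts as in `pl`. -/
noncomputable def simHist (m : ℕ) (i : Fin n) (pl : Run n) (T R : ℕ)
    (Z : Fin n → Piece n → Prop) : ℕ → List (Profile n)
  | 0 => []
  | t + 1 => simHist m i pl T R Z t ++ [fun j => if j = i then pl t i else
      scriptMove m i pl T R Z j (view j (simHist m i pl T R Z t))]

/-- The run in which all players but `i` follow the script and `i` acts as in `pl`. -/
noncomputable def simRun (m : ℕ) (i : Fin n) (pl : Run n) (T R : ℕ)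
    (Z : Fin n → Piece n → Prop) : Run n :=
  fun t j => if j = i then pl t i else scriptMove m i pl T R Z j (view j (simHist m i pl T R Z t))

variable {i : Fin n} {pl : Run n} {T R : ℕ} {Z : Fin n → Piece n → Prop}

theorem hist_simRun (t : ℕ) : hist (simRun m i pl T R Z) t = simHist m i pl T R Z t := by
  induction t with
  | zero => rfl
  | succ t ih => rw [hist_succ, ih]; rfl

theorem simRun_self (t : ℕ) : simRun m i pl T R Z t i = pl t i := by
  simp [simRun]

theorem followsScript_simRun : FollowsScript m i pl T R Z (simRun m i pl T R Z) := by
  intro t j hj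
  rw [hist_simRun]
  simp [simRun, hj]

open Classical in
/-- The messages in a round of the simulated run. -/
theorem simRun_spec (hn : 3 ≤ n) (hm : 2 ≤ m) (hmn : m ≤ n) {r₀ : Run n} (hr₀ : IsRun m r₀)
    {y : (Fin n → Msg n) × Bool} {t : ℕ} (ht : t ≤ T) :
    ∀ j, j ≠ i →
      (simRun m i (planRun r₀ T i y) T R Z t j).asks = (planRun r₀ T i y t j).asks ∧
      ∀ k, (simRun m i (planRun r₀ T i y) T R Z t j).msgTo k =
        ⟨((planRun r₀ T i y t j).msgTo k).bit,
          ((planRun r₀ T i y t j).msgTo k).pieces.filter fun z => k = i ∨ Sendable m k z.2⟩ := by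
  induction t using Nat.strong_induction_on with
  | _ t ih =>
    set pl := planRun r₀ T i y with hpl
    set r := simRun m i pl T R Z with hr
    have ih : ∀ s < t, ∀ j, j ≠ i → (r s j).asks = (pl s j).asks ∧
        ∀ k, (r s j).msgTo k = ⟨((pl s j).msgTo k).bit,
          ((pl s j).msgTo k).pieces.filter fun z => k = i ∨ Sendable m k z.2⟩ :=
      fun s hs => ih s hs (by omega)
    have hrs : ∀ s < t, restarts (r s) = restarts (pl s) := by
      intro s hs
      unfold restarts
      congr 1
      rw [eq_iff_iff]
      refine forall_congr' fun k => ?_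
      by_cases hk : k = i
      · subst hk; rw [hr, simRun_self]
      · rw [(ih s hs k hk).1]
    -- The scripts withhold only pieces that the recipient could not pass on. So whatever `j` has to
    -- send according to the plan, it still has.
    have hhold : ∀ j s x, j ≠ i → Sendable m j x → Holds m j (view j (hist r₀ t)) s x →
        Holds m j (view j (hist r t)) s x := by
      intro j s x hj hx h
      rw [← hist_planRun (i := i) (y := y) ht, holds_view] at h
      rw [holds_view, issuedAt_congr hrs]
      refine h.imp_right ?_
      rintro ⟨t', ht', k, hk⟩
      refine ⟨t', ht', k, ?_⟩
      by_cases hki : k = i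
      · subst hki
        rw [hr, simRun_self]
        exact hk
      · rw [(ih t' ht' k hki).2 j]
        simp [hx, hk, pl]
    intro j hj
    have hk : ¬ Knows m j (view j (hist r t)) := by
      refine not_knows_of_sources hn hm hmn hj.symm fun t' ht' k z hz => ?_
      by_cases hki : k = i
      · subst hki
        rw [hr, simRun_self, hpl, planRun_lt (by omega)] at hz
        exact Or.inr (hr₀.legal_play hz).2
      · rw [(ih t' ht' k hki).2 j] at hz
        exact Or.inl ((Finset.mem_filter.1 hz).2.resolve_left hj)
    have hM : MatchedAt i pl T r j t := by
      intro s hs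
      refine ⟨fun _ => ⟨by rw [hr, simRun_self], hrs s hs⟩, fun h => by omega⟩
    have hself : (pl t j).msgTo j = Msg.empty := by
      rcases ht.eq_or_lt with rfl | ht
      · rw [hpl, planRun_self, exposed_of_ne hj, msgTo_play]
      · rw [hpl, planRun_lt ht]
        exact hr₀.msgTo_self t j
    have hf : FollowsScript m i pl T R Z r := followsScript_simRun
    rw [hf.early hj ht hk hM]
    refine ⟨rfl, fun k => ?_⟩
    rw [msgTo_play]
    split_ifs with hkj
    · subst hkj
      rw [hself]
      rfl
    · congr 1
      rw [Finset.filter_eq_self]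
      intro z hz
      obtain ⟨hz, hz'⟩ := Finset.mem_filter.1 hz
      rcases ht.eq_or_lt with rfl | ht
      · rw [hpl, planRun_self, exposed_of_ne hj, msgTo_play] at hz
        simp [Msg.empty] at hz
      · rw [hpl, planRun_lt ht] at hz
        obtain ⟨h1, h2⟩ := hr₀.legal_play hz
        exact ⟨hhold j _ _ hj ⟨k, h2⟩ h1, h2⟩

theorem restarts_simRun (hn : 3 ≤ n) (hm : 2 ≤ m) (hmn : m ≤ n) {r₀ : Run n} (hr₀ : IsRun m r₀)
    {y : (Fin n → Msg n) × Bool} {t : ℕ} (ht : t ≤ T) :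
    restarts (simRun m i (planRun r₀ T i y) T R Z t) = restarts (planRun r₀ T i y t) := by
  unfold restarts
  congr 1
  rw [eq_iff_iff]
  refine forall_congr' fun k => ?_
  by_cases hk : k = i
  · subst hk; rw [simRun_self]
  · rw [(simRun_spec hn hm hmn hr₀ ht k hk).1]

theorem msgTo_simRun (hn : 3 ≤ n) (hm : 2 ≤ m) (hmn : m ≤ n) {r₀ : Run n} (hr₀ : IsRun m r₀)
    {y : (Fin n → Msg n) × Bool} {t : ℕ} (ht : t ≤ T) (k : Fin n) :
    (simRun m i (planRun r₀ T i y) T R Z t k).msgTo i = (planRun r₀ T i y t k).msgTo i := by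
  by_cases hk : k = i
  · subst hk; rw [simRun_self]
  · rw [(simRun_spec hn hm hmn hr₀ ht k hk).2]
    simp

theorem sameTrace_simRun (hn : 3 ≤ n) (hm : 2 ≤ m) (hmn : m ≤ n) {r₀ : Run n} (hr₀ : IsRun m r₀)
    {y : (Fin n → Msg n) × Bool} {t : ℕ} (ht : t ≤ T) :
    SameTrace i (simRun m i (planRun r₀ T i y) T R Z t) (planRun r₀ T i y t) := by
  refine ⟨by rw [simRun_self], fun k _ => msgTo_simRun hn hm hmn hr₀ ht k,
    restarts_simRun hn hm hmn hr₀ ht, ?_⟩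
  refine forall₂_congr fun k hk => ?_
  rw [(simRun_spec hn hm hmn hr₀ ht k hk).1]

theorem forall₂_hist {P : Profile n → Profile n → Prop} {r r' : Run n} {t : ℕ}
    (h : ∀ s < t, P (r s) (r' s)) : List.Forall₂ P (hist r t) (hist r' t) := by
  unfold hist
  rw [List.forall₂_map_left_iff, List.forall₂_map_right_iff, List.forall₂_same]
  exact fun s hs => h s (List.mem_range.1 hs)

/-- The withheld pieces never concern messages to `i`. Thus `i` cannot distinguish the simulation
from the play `r₀` followed by an exposed round, and reacts with the same probabilities. -/
theorem outProb_simRun (hn : 3 ≤ n) (hm : 2 ≤ m) (hmn : m ≤ n) {r₀ : Run n} (hr₀ : IsRun m r₀)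
    {y : (Fin n → Msg n) × Bool} (f : View n → PMF (Move n)) :
    outProb f i [] (hist (simRun m i (planRun r₀ T i y) T R Z) (T + 1)) =
      outProb f i [] (hist r₀ T ++ [exposed i y]) := by
  rw [outProb_congr f (forall₂_hist (r' := planRun r₀ T i y) (P := SameTrace i) fun s hs =>
    sameTrace_simRun hn hm hmn hr₀ (by omega)), hist_succ, hist_planRun le_rfl, planRun_self]

/-- The profile in which the players other than `i` follow the script. -/
noncomputable def scripts (m : ℕ) (i : Fin n) (pl : Run n) (T R : ℕ) (Z : Fin n → Piece n → Prop) :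
    ∀ j, Strategy n m j := fun j => script m i pl T R Z j

theorem followsScript_of_positive {σ : Strategy n m i} {r : Run n}
    (hr : Positive (Function.update (scripts m i pl T R Z) i σ) r) :
    FollowsScript m i pl T R Z r := by
  intro t j hj
  have := hr.step t j
  rw [Function.update_of_ne hj] at this
  simpa [scripts, script] using this

theorem moveProb_eq_one {j : Fin n} (hj : j ≠ i) {r : Run n} (hr : FollowsScript m i pl T R Z r)
    (t : ℕ) : moveProb (script m i pl T R Z j).1 j [] (hist r t) = 1 := by
  induction t with
  | zero => rfl
  | succ t ih =>
    rw [hist_succ, moveProb_append_singleton, ih, one_mul, List.nil_append, hr t j hj]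
    simp [script]

/-- The scripts are deterministic and contribute the factor `1`, so only the randomness of `i`
remains. -/
theorem measure_simRun (hn : 3 ≤ n) (hm : 2 ≤ m) (hmn : m ≤ n) {r₀ : Run n} (hr₀ : IsRun m r₀)
    {y : (Fin n → Msg n) × Bool} (σ : Strategy n m i) :
    runMeasure (Function.update (scripts m i (planRun r₀ T i y) T R Z) i σ)
      {r | (hist r (T + 1)).map (canon i) =
        (hist (simRun m i (planRun r₀ T i y) T R Z) (T + 1)).map (canon i)} =
      outProb σ.1 i [] (hist r₀ T ++ [exposed i y]) := by
  have h := measure_canon_hist (Function.update (scripts m i (planRun r₀ T i y) T R Z) i σ) i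
    (hist (simRun m i (planRun r₀ T i y) T R Z) (T + 1))
  rw [hist_length, Function.update_self, outProb_simRun hn hm hmn hr₀] at h
  rw [h, Finset.prod_eq_one, mul_one]
  intro j hj
  have hj := Finset.ne_of_mem_erase hj
  rw [Function.update_of_ne hj]
  exact moveProb_eq_one hj followsScript_simRun _

theorem matchedAt_congr {r r' : Run n} {j : Fin n} {t : ℕ}
    (h : view j (hist r t) = view j (hist r' t)) :
    MatchedAt i pl T r j t ↔ MatchedAt i pl T r' j t := by
  rw [← matched_view_iff, h, matched_view_iff]

/-- In a legal run in which the others follow the script, they all see `i` act as planned if and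
only if the visible behaviour is as in the simulated run. -/
theorem allMatched_iff (hn : 3 ≤ n) (hm : 2 ≤ m) (hmn : m ≤ n) {r₀ : Run n} (hr₀ : IsRun m r₀)
    {y : (Fin n → Msg n) × Bool} (hy : y.1 i = Msg.empty) {r : Run n} (hrun : IsRun m r)
    (hr : FollowsScript m i (planRun r₀ T i y) T R Z r) :
    AllMatched i (planRun r₀ T i y) T r ↔ (hist r (T + 1)).map (canon i) =
        (hist (simRun m i (planRun r₀ T i y) T R Z) (T + 1)).map (canon i) := by
  constructor
  · intro hE
    have key : ∀ t ≤ T + 1, (hist r t).map (canon i) =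
        (hist (simRun m i (planRun r₀ T i y) T R Z) t).map (canon i) := by
      intro t
      induction t with
      | zero => intro _; rfl
      | succ t ih =>
        intro ht
        have ih := ih (by omega)
        rw [hist_succ, hist_succ, List.map_append, List.map_append, ih]
        congr 1
        simp only [List.map_cons, List.map_nil, List.cons.injEq, and_true]
        obtain ⟨j₀, hj₀⟩ := exists_ne_of_three hn i
        -- Every message to another player is vouched for by its recipient; the message to oneself
        -- is empty in legal runs, and `hy` takes care of the exposed round.
        have hmsg : (r t i).msgTo = (planRun r₀ T i y t i).msgTo := by
          funext k
          by_cases hk : k = i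
          · subst hk
            rw [hrun.msgTo_self]
            rcases (Nat.lt_succ_iff.1 ht).eq_or_lt with rfl | ht
            · rw [planRun_self, exposed_self, msgTo_play, hy]
            · rw [planRun_lt ht, hr₀.msgTo_self]
          · exact ((hE k hk t (by omega)).1 (by omega)).1
        ext1 k
        by_cases hk : k = i
        · subst hk
          rw [canon_self, canon_self, simRun_self, restarts_simRun hn hm hmn hr₀ (by omega), hmsg,
            ((hE j₀ hj₀ t (by omega)).1 (by omega)).2]
        · rw [canon_of_ne hk, canon_of_ne hk, hr t k hk, followsScript_simRun t k hk,
            view_congr_canon hk ih]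
    exact key _ le_rfl
  · intro h j hj
    rw [matchedAt_congr (view_congr_canon hj h)]
    intro s hs
    refine ⟨fun hs' => ⟨by rw [simRun_self], restarts_simRun hn hm hmn hr₀ hs'⟩, fun h => by omega⟩

end Simulation

/-! ### Rewarding a behaviour of `i` -/

section Dichotomy

variable {n m : ℕ} {i : Fin n} {u : Fin n → Run n → ℝ}

/-- Pieces may be revealed to `i`. -/
def towards (m : ℕ) (i : Fin n) (k : Fin n) (x : Piece n) : Prop := k = i ∨ Sendable m k x

/-- The prize is won by `i` alone, and only for the planned behaviour. The others never learn, as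
they receive from each other only what they could pass on. -/
theorem learners_reward (hn : 3 ≤ n) (hm : 2 ≤ m) (hmn : m ≤ n) {r₀ : Run n} (hr₀ : IsRun m r₀)
    {T : ℕ} {y : (Fin n → Msg n) × Bool} (hk₀ : ¬ Knows m i (view i (hist r₀ T)))
    {r : Run n} (hrun : IsRun m r)
    (hr : FollowsScript m i (planRun r₀ T i y) T 2 (towards m i) r) :
    (AllMatched i (planRun r₀ T i y) T r → learners m r = {i}) ∧
    (¬ AllMatched i (planRun r₀ T i y) T r → learners m r = ∅) := by
  have hothers : ∀ j, j ≠ i → ¬ Learns m r j := by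
    rintro j hj ⟨t, ht⟩
    exact hr.not_knows hn hm hmn hrun hj (fun _ => Or.inr fun x hx => hx.resolve_left hj) ht
  constructor
  · intro hE
    ext j
    simp only [learners, Set.mem_ofPred_eq, Set.mem_singleton_iff]
    constructor
    · intro h
      by_contra hj
      exact hothers j hj h
    · rintro rfl
      exact hE.knows hn hm hmn hr hrun le_rfl fun _ _ => Iff.rfl
  · intro hE
    ext j
    simp only [learners, Set.mem_ofPred_eq, Set.mem_empty_iff_false, iff_false]
    by_cases hj : j = i
    · subst hj
      -- Without a match nothing is revealed, and `i` receives at most what it got in `r₀` before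
      -- round `T`, which was not enough by `hk₀`.
      rintro ⟨t, s, hs⟩
      apply hk₀
      refine hr₀.knows_of_got hn hm hmn (s := s) (recovered_mono ?_ hs)
      intro x hx
      have hx : Holds m j (view j (hist r t)) s x := hx
      rw [holds_view] at hx
      refine hx.imp And.right ?_
      rintro ⟨t', -, k, hk⟩
      have hkj : k ≠ j := by
        rintro rfl
        rw [hrun.msgTo_self] at hk
        simp [Msg.empty] at hk
      obtain ⟨h1, ⟨h2, h3, -⟩ | ⟨h2, -⟩⟩ := hr.pieces hkj hk
      · rcases h2.eq_or_lt with rfl | h2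
        · rw [planRun_self, exposed_of_ne hkj, msgTo_play] at h3
          simp [Msg.empty] at h3
        · rw [planRun_lt h2] at h3
          exact ⟨t', h2, k, h3⟩
      · exact absurd (hr.allMatched hkj h2 h1) hE
    · exact hothers j hj

open Classical in
/-- If `i` shows some behaviour with a higher probability under `σ` than under `τ` before it
knows the secret, then it can be rewarded for this behaviour. -/
theorem exists_reward (hn : 3 ≤ n) (hm : 2 ≤ m) (hmn : m ≤ n) (hU1 : U1 m u) (hU2 : U2 m u)
    (σ τ : Strategy n m i) {r₀ : Run n} (hr₀ : IsRun m r₀) {T : ℕ}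
    {y : (Fin n → Msg n) × Bool} (hk₀ : ¬ Knows m i (view i (hist r₀ T)))
    (hlt : outProb τ.1 i [] (hist r₀ T ++ [exposed i y]) <
      outProb σ.1 i [] (hist r₀ T ++ [exposed i y])) :
    ∃ ρ : ∀ j, Strategy n m j, (∀ j, Discreet m j (ρ j).1) ∧
      expectedUtility m u i (Function.update ρ i τ) <
        expectedUtility m u i (Function.update ρ i σ) := by
  refine ⟨scripts m i (planRun r₀ T i y) T 2 (towards m i),
    fun j => discreet_script i _ _ _ _ j, ?_⟩
  set ρ := scripts m i (planRun r₀ T i y) T 2 (towards m i) with hρ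
  set E : Set (Run n) := {r | (hist r (T + 1)).map (canon i) =
    (hist (simRun m i (planRun r₀ T i y) T 2 (towards m i)) (T + 1)).map (canon i)} with hE
  have hEm : MeasurableSet E := measurableSet_hist (T + 1)
    {h | h.map (canon i) =
      (hist (simRun m i (planRun r₀ T i y) T 2 (towards m i)) (T + 1)).map (canon i)}
  have hmeas : ∀ σ' : Strategy n m i, runMeasure (Function.update ρ i σ') E =
      outProb σ'.1 i [] (hist r₀ T ++ [exposed i y]) :=
    fun σ' => measure_simRun hn hm hmn hr₀ σ'
  obtain ⟨rE, hrE, hpE⟩ := exists_positive_of_measure_ne_zero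
    (σ := Function.update ρ i σ) (A := E) (by rw [hmeas]; exact (zero_le.trans_lt hlt).ne')
  have hy : y.1 i = Msg.empty := by
    have h1 : canon i (rE T) = canon i (simRun m i (planRun r₀ T i y) T 2 (towards m i) T) := by
      have h2 : (hist rE (T + 1)).map (canon i) = _ := hrE
      rw [hist_succ, hist_succ, List.map_append, List.map_append] at h2
      simpa using (List.append_inj h2 (by simp)).2
    have h3 := (sameTrace_canon i _ _ h1).1
    rw [simRun_self, planRun_self, exposed_self, msgTo_play] at h3
    rw [← h3, hpE.isRun.msgTo_self]
  have hlearn : ∀ σ' : Strategy n m i, ∀ r, Positive (Function.update ρ i σ') r →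
      learners m r = if r ∈ E then {i} else ∅ := by
    intro σ' r hr
    have hf := followsScript_of_positive hr
    have h1 := learners_reward hn hm hmn hr₀ hk₀ hr.isRun hf
    have h2 := allMatched_iff hn hm hmn hr₀ hy hr.isRun hf
    split_ifs with h
    · exact h1.1 (h2.2 h)
    · exact h1.2 fun h' => h (h2.1 h')
  -- The strict inequality of probabilities leaves room for a run with the reward under `σ` and one
  -- without it under `τ`. To these two runs U2 is applied below.
  obtain ⟨rN, hrN, hpN⟩ := exists_positive_of_measure_ne_zero
    (σ := Function.update ρ i τ) (A := Eᶜ) (by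
      rw [prob_compl_eq_one_sub hEm, hmeas]
      exact (tsub_pos_of_lt (hlt.trans_le (outProb_le_one _ _))).ne')
  obtain ⟨w, hw⟩ := exists_value hU1
  have hww : w i ∅ < w i {i} := by
    have h1 := hlearn σ rE hpE
    rw [if_pos hrE] at h1
    have h2 := hlearn τ rN hpN
    rw [if_neg hrN] at h2
    have h3 := hU2 i rE rN hpE.isRun hpN.isRun
      (by change i ∈ learners m rE; rw [h1]; rfl)
      (by change i ∉ learners m rN; rw [h2]; simp)
    rwa [hw i _ hpE.isRun, hw i _ hpN.isRun, h1, h2] at h3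
  -- There are only two outcomes, so the utility is an increasing affine function of the probability
  -- of the rewarded behaviour.
  have hval : ∀ σ' : Strategy n m i, expectedUtility m u i (Function.update ρ i σ') =
      w i ∅ + (w i {i} - w i ∅) *
        (outProb σ'.1 i [] (hist r₀ T ++ [exposed i y])).toReal := by
    intro σ'
    rw [expectedUtility_eq hw, ← hmeas σ']
    have h1 : ∀ᵐ r ∂runMeasure (Function.update ρ i σ'), w i (learners m r) =
        w i ∅ + E.indicator (fun _ => w i {i} - w i ∅) r := by
      filter_upwards [ae_positive (Function.update ρ i σ')] with r hr
      rw [hlearn σ' r hr]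
      by_cases h : r ∈ E
      · simp [h]
      · simp [h]
    rw [integral_congr_ae h1, integral_add (integrable_const _)
      ((integrable_const _).indicator hEm), integral_indicator hEm]
    simp [Measure.real, mul_comm]
  rw [hval, hval]
  have hlt' := (ENNReal.toReal_lt_toReal (hlt.trans_le le_top).ne
    ((outProb_le_one _ _).trans_lt ENNReal.one_lt_top).ne).2 hlt
  have := mul_lt_mul_of_pos_left hlt' (sub_pos.2 hww)
  linarith

end Dichotomy

/-! ### Punishing noise, and the survival of discreet strategies -/

section Punishment

variable {n m : ℕ} {i : Fin n} {u : Fin n → Run n → ℝ}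

theorem moveProb_ne_zero_of_positive {σ : ∀ j, Strategy n m j} {r : Run n} (hr : Positive σ r)
    (j : Fin n) (t : ℕ) : moveProb (σ j).1 j [] (hist r t) ≠ 0 := by
  have := hr t
  rw [weight_eq_prod] at this
  exact Finset.prod_ne_zero_iff.1 this j (Finset.mem_univ j)

/-- A player who follows a discreet strategy is silent once it knows the secret. -/
theorem Discreet.silent {σ : ∀ j, Strategy n m j} (hσ : Discreet m i (σ i).1) {r : Run n}
    (hr : Positive σ r) {t : ℕ} (hk : Knows m i (view i (hist r t))) : Silent (r t i) :=
  hσ _ hk (moveProb_ne_zero_of_positive hr i t) _ (hr.step t i)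

/-- Pieces may be revealed to everybody but `i`. -/
def awayFrom (i : Fin n) (k : Fin n) (_ : Piece n) : Prop := k ≠ i

theorem hist_eq_of_map_canon {r r' : Run n} {t s : ℕ} (hst : s ≤ t)
    (h : (hist r t).map (canon i) = (hist r' t).map (canon i)) :
    (hist r s).map (canon i) = (hist r' s).map (canon i) := by
  rw [← hist_take r hst, ← hist_take r' hst, List.map_take, List.map_take, h]

theorem knows_simRun (hn : 3 ≤ n) (hm : 2 ≤ m) (hmn : m ≤ n) {r₀ : Run n} (hr₀ : IsRun m r₀)
    {T R : ℕ} {y : (Fin n → Msg n) × Bool} {Z : Fin n → Piece n → Prop}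
    (hk : Knows m i (view i (hist r₀ T))) :
    Knows m i (view i (hist (simRun m i (planRun r₀ T i y) T R Z) T)) := by
  obtain ⟨s, hs⟩ := hk
  refine ⟨s, recovered_mono (fun x hx => ?_) hs⟩
  have hx : Holds m i (view i (hist r₀ T)) s x := hx
  change Holds m i _ s x
  rw [holds_view] at hx ⊢
  have hrs : ∀ t < T, restarts (r₀ t) = restarts (simRun m i (planRun r₀ T i y) T R Z t) := by
    intro t ht
    rw [restarts_simRun hn hm hmn hr₀ ht.le, planRun_lt ht]
  refine hx.imp (fun h => ⟨(issuedAt_congr hrs).1 h.1, h.2⟩) ?_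
  rintro ⟨t, ht, k, hk⟩
  refine ⟨t, ht, k, ?_⟩
  rwa [msgTo_simRun hn hm hmn hr₀ ht.le, planRun_lt ht]

/-- Seeing the planned behaviour convicts `i`: it has received the same pieces as in `r₀`, hence
knows the secret, and since all others ask in round `T`, the restart reveals whether `i` asked as
well. -/
theorem FollowsScript.not_silent (hn : 3 ≤ n) (hm : 2 ≤ m) (hmn : m ≤ n) {r₀ : Run n}
    (hr₀ : IsRun m r₀) {T R : ℕ} {a : Move n} (ha : a.msgTo i = Msg.empty) (hs : ¬ Silent a)
    {Z : Fin n → Piece n → Prop} (hk : Knows m i (view i (hist r₀ T))) {r : Run n}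
    (hrun : IsRun m r) (hr : FollowsScript m i (planRun r₀ T i (a.msgTo, a.asks)) T R Z r)
    (hE : AllMatched i (planRun r₀ T i (a.msgTo, a.asks)) T r) :
    Knows m i (view i (hist r T)) ∧ ¬ Silent (r T i) := by
  have h1 := (allMatched_iff hn hm hmn hr₀ ha hrun hr).1 hE
  refine ⟨(knows_congr_canon (hist_eq_of_map_canon (Nat.le_succ T) h1)).2
    (knows_simRun hn hm hmn hr₀ hk), ?_⟩
  rw [hist_succ, hist_succ, List.map_append, List.map_append] at h1
  have h2 : canon i (r T) =
      canon i (simRun m i (planRun r₀ T i (a.msgTo, a.asks)) T R Z T) := by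
    simpa using (List.append_inj h1 (by simp)).2
  have h3 := sameTrace_canon i _ _ h2
  have h4 : (r T i).msgTo = a.msgTo := by
    rw [h3.1, simRun_self, planRun_self, exposed_self, msgTo_play]
  have h5 : restarts (r T) = a.asks := by
    rw [h3.2.2.1, restarts_simRun hn hm hmn hr₀ le_rfl, planRun_self, restarts_exposed]
  have h6 : ∀ k, k ≠ i → (r T k).asks = true := by
    rw [h3.2.2.2]
    intro k hk
    rw [(simRun_spec hn hm hmn hr₀ le_rfl k hk).1, planRun_self, exposed_of_ne hk, asks_play]
  have h7 : (r T i).asks = a.asks := by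
    have h8 := restarts_update i (r T) (r T i)
    rw [Function.update_eq_self, h5, and_iff_left h6] at h8
    exact (Bool.eq_iff_iff.2 h8).symm
  unfold Silent at hs ⊢
  rwa [h4, h7]

/-- A restart needs the request of every player, so a silent player blocks it. -/
theorem sharingAt_of_silent {r : Run n} {T : ℕ} (hs : ∀ t, T ≤ t → Silent (r t i)) {t : ℕ}
    (ht : T ≤ t) : sharingAt r t = sharingAt r T := by
  induction t, ht using Nat.le_induction with
  | base => rfl
  | succ t ht ih =>
    have : restarts (r t) ≠ true := fun h => by
      have := asks_of_restarts h i
      rw [(hs t ht).2] at this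
      simp at this
    rw [sharingAt_succ, ih, if_neg this, add_zero]

/-- If the others can still learn the secret after `i` has become silent, then they do so if all
pieces are revealed to them. -/
theorem AllMatched.exists_learns (hn : 3 ≤ n) (hm : 2 ≤ m) (hmn : m ≤ n) {r₀ : Run n}
    (hr₀ : IsRun m r₀) {T R : ℕ} (hs : ∀ t, T ≤ t → Silent (r₀ t i)) {j₀ : Fin n} (hj₀ : j₀ ≠ i)
    (hk : Knows m j₀ (view j₀ (hist r₀ R))) {y : (Fin n → Msg n) × Bool} {r : Run n}
    (hrun : IsRun m r) (hr : FollowsScript m i (planRun r₀ T i y) T R (awayFrom i) r)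
    (hE : AllMatched i (planRun r₀ T i y) T r) : ∃ j, j ≠ i ∧ Learns m r j := by
  by_contra hcon
  push Not at hcon
  have hnk : ∀ j, j ≠ i → ∀ t, ¬ Knows m j (view j (hist r t)) :=
    fun j hj t h => hcon j hj ⟨t, h⟩
  have hsh : sharingAt r₀ T = sharingAt r T := by
    refine sharingAt_congr fun t ht => ?_
    rw [((hE j₀ hj₀ t (by omega)).1 ht.le).2, planRun_lt ht]
  have hiss : ∀ t s, IssuedAt r₀ t s → IssuedAt r (T + 2 + t) s := by
    intro t s h
    rw [show T + 2 + t = (T + 1 + t) + 1 by omega, issuedAt_succ_iff]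
    cases t with
    | zero => exact absurd h (not_issuedAt_zero _ _)
    | succ t =>
      rw [issuedAt_succ_iff] at h
      have h1 : sharingAt r T ≤ sharingAt r (T + 1 + (t + 1)) := sharingAt_mono r (by omega)
      have h2 : sharingAt r₀ t ≤ sharingAt r₀ T := by
        rcases le_total t T with ht | ht
        · exact sharingAt_mono r₀ ht
        · exact (sharingAt_of_silent hs ht).le
      omega
  -- Round `t` of `r₀` is imitated in round `T + 2 + t`. In the revelation everybody sends to all
  -- players but `i` whatever is permitted, so nothing is missing; the pieces that `i` sent in `r₀`
  -- were sent before round `T` and are the same in both runs.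
  have key : ∀ t ≤ R, ∀ k, k ≠ i → ∀ s x, Holds m k (view k (hist r₀ t)) s x →
      Holds m k (view k (hist r (T + 2 + t))) s x := by
    intro t
    induction t using Nat.strong_induction_on with
    | _ t ih =>
      intro ht k hki s x hx
      rw [holds_view] at hx ⊢
      refine hx.imp (fun h => ⟨hiss t s h.1, h.2⟩) ?_
      rintro ⟨t', ht', k', hk'⟩
      by_cases hki' : k' = i
      · subst hki'
        have htT : t' < T := by
          by_contra hcon
          rw [(hs t' (by omega)).1] at hk'
          simp [Msg.empty] at hk'
        refine ⟨t', by omega, k', ?_⟩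
        rwa [((hE k hki t' (by omega)).1 htT.le).1, planRun_lt htT]
      · have hkk : k ≠ k' := by
          rintro rfl
          rw [hr₀.msgTo_self] at hk'
          simp [Msg.empty] at hk'
        obtain ⟨h1, h2⟩ := hr₀.legal_play hk'
        exact ⟨T + 2 + t', by omega, k', hr.reveal hrun hki' (by omega) (by omega)
          (hnk k' hki' _) (hE.matchedAt hn hm hmn hr hrun hki' _) hkk
          (ih t' ht' (by omega) k' hki' s x h1) h2 hki⟩
  obtain ⟨s, hs'⟩ := hk
  exact hnk j₀ hj₀ (T + 2 + R) ⟨s, recovered_mono (fun x hx => key R le_rfl j₀ hj₀ s x hx) hs'⟩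

/-- If nobody could notice that `σ` is used instead of `τ` until `τ` might be noisy, and others can
learn the secret afterwards if `σ` is used, then `τ` can be punished for being noisy. -/
theorem exists_punishment (hn : 3 ≤ n) (hm : 2 ≤ m) (hmn : m ≤ n) (hU1 : U1 m u) (hU3 : U3 m u)
    (σ τ : Strategy n m i) (hσ : Discreet m i σ.1)
    (hQ : ∀ r t, IsRun m r → ¬ Noisy m τ.1 i (hist r t) →
      outProb σ.1 i [] (hist r (t + 1)) = outProb τ.1 i [] (hist r (t + 1)))
    {ρ : ∀ j, Strategy n m j} {r₀ : Run n} (hp : Positive (Function.update ρ i σ) r₀)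
    {j₀ : Fin n} (h1 : Learns m r₀ j₀) (h2 : ¬ Learns m (haltRun m τ.1 i r₀) j₀) :
    ∃ ρ : ∀ j, Strategy n m j, (∀ j, Discreet m j (ρ j).1) ∧
      expectedUtility m u i (Function.update ρ i τ) <
        expectedUtility m u i (Function.update ρ i σ) := by
  have hr₀ := hp.isRun
  have hj₀ : j₀ ≠ i := by
    rintro rfl
    exact h2 ((learns_haltRun_self r₀).2 h1)
  obtain ⟨R, hR⟩ := h1
  -- Stopping makes a difference to `j₀`, so `τ` might be noisy before `j₀` knows the secret. Here
  -- `a` is the noisy move that is to be punished, and `R` rounds of revelation are long enough to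
  -- repeat what happened in `r₀`.
  obtain ⟨t, -, T, hT, hkT, h', hh', hne, a, ha, hsa⟩ : ∃ t < R, Noisy m τ.1 i (hist r₀ t) := by
    by_contra hcon
    push Not at hcon
    exact h2 (learns_haltRun_of_hist hcon hR)
  rw [hist_length] at hT
  rw [hist_take r₀ hT] at hkT hh'
  have hself : a.msgTo i = Msg.empty := by
    have := τ.2 _ _ ha
    cases a with
    | halt => rfl
    | play msg ask => exact this.2.1
  have hsil : ∀ t, T ≤ t → Silent (r₀ t i) := fun t ht =>
    Discreet.silent (σ := Function.update ρ i σ) (by rwa [Function.update_self]) hp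
      (knows_mono hkT ht)
  set pl := planRun r₀ T i (a.msgTo, a.asks) with hpl
  refine ⟨scripts m i pl T R (awayFrom i), fun j => discreet_script i _ _ _ _ j, ?_⟩
  refine (expectedUtility_compare hU1 hU3 _ σ τ hQ ?_).2 ?_
  -- A player who follows `σ` is silent once it knows the secret, so the punishment never sets in.
  · intro r hr j hj
    by_cases hji : j = i
    · subst hji
      exact (learns_haltRun_self r).2 hj
    · exfalso
      have hf := followsScript_of_positive hr
      obtain ⟨t, ht⟩ := hj
      refine hf.not_knows hn hm hmn hr.isRun hji (fun _ => Or.inl fun hE => ?_) ht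
      obtain ⟨h3, h4⟩ := hf.not_silent hn hm hmn hr₀ hself hsa hkT hr.isRun hE
      exact h4 (Discreet.silent (σ := Function.update _ i σ) (by rwa [Function.update_self]) hr h3)
  · have hpos : runMeasure (Function.update (scripts m i pl T R (awayFrom i)) i τ)
        {r | (hist r (T + 1)).map (canon i) =
          (hist (simRun m i pl T R (awayFrom i)) (T + 1)).map (canon i)} ≠ 0 := by
      rw [measure_simRun hn hm hmn hr₀]
      refine outProb_ne_zero (h' := h' ++ [Function.update (exposed i (a.msgTo, a.asks)) i a]) ?_ ?_
      · rw [List.map_append, List.map_append, hh']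
        simp only [List.map_cons, List.map_nil]
        congr 2
        refine (canon_update_eq_iff ..).2 ⟨by rw [exposed_self, msgTo_play], ?_⟩
        rw [restarts_update_exposed, restarts_exposed]
      · rw [moveProb_append_singleton, Function.update_self, List.nil_append]
        exact mul_ne_zero hne ((PMF.mem_support_iff ..).1 ha)
    intro hzero
    refine hpos (measure_mono_null_ae ?_ hzero)
    filter_upwards [ae_positive (Function.update (scripts m i pl T R (awayFrom i)) i τ)]
      with r hr hrE
    have hf := followsScript_of_positive hr
    have hrun := hr.isRun
    have hE := (allMatched_iff hn hm hmn hr₀ hself hrun hf).2 hrE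
    obtain ⟨h3, h4⟩ := hf.not_silent hn hm hmn hr₀ hself hsa hkT hrun hE
    obtain ⟨j, hj, hl⟩ := hE.exists_learns hn hm hmn hr₀ hsil hj₀ hR hrun hf
    have hnoisy : Noisy m τ.1 i (hist r T) := by
      refine ⟨T, by simp, ?_, hist r T, ?_, ?_, r T i, ?_, h4⟩
      · rwa [hist_take r le_rfl]
      · rw [hist_take r le_rfl]
      · simpa using moveProb_ne_zero_of_positive hr i T
      · simpa using hr.step T i
    -- In the stopped run everybody is silent from round `T` on. What is left comes from `i` or can
    -- be passed on by `j`, which is not enough.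
    refine ⟨j, hj, hl, ?_⟩
    rintro ⟨t, ht⟩
    refine not_knows_of_sources hn hm hmn hj.symm (fun t' ht' k z hz => ?_) ht
    have hz' := haltRun_pieces hz
    by_cases hk : k = i
    · subst hk
      exact Or.inr (hrun.legal_play hz').2
    · obtain ⟨-, h5 | h5⟩ := hf.pieces hk hz'
      · exact Or.inl (h5.2.2.resolve_left hj)
      · exfalso
        have : Noisy m τ.1 i (hist r t') := hnoisy.mono (by omega)
        simp [haltRun, this, Move.msgTo, Msg.empty] at hz

/-- A discreet strategy that is not at least as good as `τ` in every respect is better than `τ`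
against some discreet strategies. -/
theorem Discreet.dichotomy (hn : 3 ≤ n) (hm : 2 ≤ m) (hmn : m ≤ n) (hU1 : U1 m u) (hU2 : U2 m u)
    (hU3 : U3 m u) {σ : Strategy n m i} (hσ : Discreet m i σ.1) (τ : Strategy n m i) :
    (∀ ρ : ∀ j, Strategy n m j, expectedUtility m u i (Function.update ρ i τ) ≤
      expectedUtility m u i (Function.update ρ i σ)) ∨
    ∃ ρ : ∀ j, Strategy n m j, (∀ j, Discreet m j (ρ j).1) ∧
      expectedUtility m u i (Function.update ρ i τ) <
        expectedUtility m u i (Function.update ρ i σ) := by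
  by_contra hcon
  push Not at hcon
  obtain ⟨⟨ρ, hρ⟩, hno⟩ := hcon
  have hno' : ¬ ∃ ρ : ∀ j, Strategy n m j, (∀ j, Discreet m j (ρ j).1) ∧
      expectedUtility m u i (Function.update ρ i τ) <
        expectedUtility m u i (Function.update ρ i σ) := by
    rintro ⟨ρ, h1, h2⟩
    exact (hno ρ h1).not_gt h2
  -- No reward is possible, so the behaviours agree; and by the last step no punishment is possible,
  -- so under `σ` nobody learns after the stop.
  have hQ := fun r t => outProb_eq_of_le (τ := τ) hσ (fun r t hr hk y => by
    by_contra hlt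
    exact hno' (exists_reward hn hm hmn hU1 hU2 σ τ hr hk (not_le.1 hlt))) r t
  refine hρ.not_ge (expectedUtility_compare hU1 hU3 ρ σ τ hQ fun r hr j hj => ?_).1
  by_contra hj'
  exact hno' (exists_punishment hn hm hmn hU1 hU3 σ τ hσ hQ hr hj hj')

/-- Discreet strategies are never deleted. -/
theorem Discreet.survives (hn : 3 ≤ n) (hm : 2 ≤ m) (hmn : m ≤ n) (hU1 : U1 m u) (hU2 : U2 m u)
    (hU3 : U3 m u) (k : ℕ) : ∀ (i : Fin n) (σ : Strategy n m i), Discreet m i σ.1 →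
      σ ∈ survivors (S := Strategy n m) (expectedUtility m u) k i := by
  induction k with
  | zero => exact fun _ _ _ => Set.mem_univ _
  | succ k ih =>
    intro i σ hσ
    refine ⟨ih i σ hσ, ?_⟩
    rintro ⟨-, τ, -, ⟨ρ, -, hlt⟩, hle⟩
    -- The first alternative contradicts the strict inequality in the definition of domination. The
    -- second contradicts the weak one, as the discreet `ρ'` has survived so far.
    rcases hσ.dichotomy hn hm hmn hU1 hU2 hU3 τ with h | ⟨ρ', h1, h2⟩
    · exact (h ρ).not_gt hlt
    · exact (hle ρ' fun j _ => ih j _ (h1 j)).not_gt h2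

end Punishment

/-! ### The recommended strategy is discreet -/

section Protocol

variable {n m : ℕ} {α : unitInterval} {i j : Fin n}

theorem exists_eq_protocolAction {v : View n} {a : Move n}
    (ha : a ∈ ((recommended n m α i).1 v).support) : ∃ c b, a = protocolAction m i v c b := by
  simp only [recommended, PMF.mem_support_bind_iff, PMF.mem_support_pure_iff] at ha
  obtain ⟨c, -, b, -, rfl⟩ := ha
  exact ⟨c, b, rfl⟩

theorem clean_nil : Clean m i [] := fun t => t.elim0

theorem clean_append_singleton {v : View n} {o : Obs n} :
    Clean m i (v ++ [o]) ↔ Clean m i v ∧ Expected m i (sharing v) (current v) o := by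
  unfold Clean
  constructor
  · intro h
    refine ⟨fun t => ?_, ?_⟩
    · have h' := h ⟨t, by simp⟩
      simp only [List.get_eq_getElem] at h' ⊢
      rwa [List.take_append_of_le_length t.2.le, List.getElem_append_left t.2] at h'
    · have h' := h ⟨v.length, by simp⟩
      simpa using h'
  · rintro ⟨h1, h2⟩ ⟨t, ht⟩
    simp only [List.length_append, List.length_singleton] at ht
    rcases (Nat.lt_succ_iff.1 ht).eq_or_lt with rfl | ht'
    · simpa using h2
    · have h' := h1 ⟨t, ht'⟩
      simp only [List.get_eq_getElem] at h' ⊢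
      rwa [List.take_append_of_le_length ht'.le, List.getElem_append_left ht']

theorem Clean.current {v : View n} (h : Clean m i v) :
    ∀ t (ht : t < (current v).length),
      Expected m i (sharing v) ((_root_.current v).take t) (_root_.current v)[t] := by
  induction v using List.reverseRecOn with
  | nil => intro t ht; simp [current_nil] at ht
  | append_singleton v o ih =>
    rw [clean_append_singleton] at h
    intro t ht
    by_cases ho : o.restart = true
    · simp [current_append_singleton, ho] at ht
    · simp only [current_append_singleton, sharing_append_singleton, ho, Bool.false_eq_true,
        if_false, add_zero] at ht ⊢
      simp only [List.length_append, List.length_singleton] at ht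
      rcases (Nat.lt_succ_iff.1 ht).eq_or_lt with rfl | ht'
      · simpa using h.2
      · have := ih h.1 t ht'
        rwa [List.take_append_of_le_length ht'.le, List.getElem_append_left ht']

theorem sendAll_ne_halt {v : View n} {f : Fin n → Msg n} {ask : Bool}
    (h : sendAll m i v f ask ≠ .halt) : ∀ o ∈ v, o.own ≠ .halt := by
  unfold sendAll at h
  split_ifs at h with h1
  · exact h1
  · exact absurd rfl h

theorem protocolAction_of_not_clean {v : View n} {c b : Bool} (h : ¬ Clean m i v) :
    protocolAction m i v c b = .halt := by
  unfold protocolAction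
  exact if_neg h

theorem protocolAction_zero {v : View n} {c b : Bool} (hc : Clean m i v)
    (hv : current v = []) :
    protocolAction m i v c b = sendAll m i v (fun _ => Msg.empty) false := by
  unfold protocolAction
  simp only [if_pos hc, hv]

theorem protocolAction_one {v : View n} {c b : Bool} (hc : Clean m i v) {o₀ : Obs n}
    (hv : current v = [o₀]) :
    protocolAction m i v c b = sendAll m i v (fun j =>
        ⟨if i.val < 3 ∧ j.val = (i.val + 1) % 3 then some b
          else if i.val < 3 ∧ j.val = (i.val + 2) % 3 then some (xor c b) else none,
          dealt m (sharing v) i j⟩) false := by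
  unfold protocolAction
  simp only [if_pos hc, hv]

theorem protocolAction_two {v : View n} {c b : Bool} (hc : Clean m i v) {o₀ o₁ : Obs n}
    (hv : current v = [o₀, o₁]) :
    protocolAction m i v c b = sendAll m i v (fun j =>
        ⟨if i.val < 3 ∧ j.val = (i.val + 2) % 3 then
            some (xor (o₁.bitFrom ((i.val + 1) % 3)) (coinOf i o₁)) else none,
          if ¬ i.val < 3 ∧ j.val = i.val % 3 then contribution m (sharing v) i else ∅⟩) false := by
  unfold protocolAction
  simp only [if_pos hc, hv]

theorem protocolAction_three {v : View n} {c b : Bool} (hc : Clean m i v) {o₀ o₁ o₂ : Obs n}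
    (hv : current v = [o₀, o₁, o₂]) :
    protocolAction m i v c b = sendAll m i v (fun j =>
        ⟨if i.val < 3 ∧ ¬ j.val < 3 then some (parityOf i o₁ o₂) else none,
          if i.val < 3 ∧ (coinOf i o₁ && parityOf i o₁ o₂) = true then bundle m (sharing v) i
          else ∅⟩) false := by
  unfold protocolAction
  simp only [if_pos hc, hv]

theorem protocolAction_four {v : View n} {c b : Bool} (hc : Clean m i v) {o₀ o₁ o₂ o₃ : Obs n}
    (hv : current v = [o₀, o₁, o₂, o₃]) :
    protocolAction m i v c b =
      if wantsRestart i o₁ o₂ o₃ then sendAll m i v (fun _ => Msg.empty) true else .halt := by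
  unfold protocolAction
  simp only [if_pos hc, hv]

theorem protocolAction_five {v : View n} {c b : Bool} (hv : 5 ≤ (current v).length) :
    protocolAction m i v c b = .halt := by
  unfold protocolAction
  split_ifs
  · dsimp only
    split <;> simp_all
  · rfl

theorem length_cases {α : Type*} (w : List α) : w = [] ∨ (∃ a, w = [a]) ∨ (∃ a b, w = [a, b]) ∨
    (∃ a b c, w = [a, b, c]) ∨ (∃ a b c d, w = [a, b, c, d]) ∨ 5 ≤ w.length := by
  rcases w with _ | ⟨a, _ | ⟨b, _ | ⟨c, _ | ⟨d, _ | ⟨e, w⟩⟩⟩⟩⟩ <;> simp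

theorem protocolAction_ne_halt {v : View n} {c b : Bool} (h : protocolAction m i v c b ≠ .halt) :
    Clean m i v ∧ (∀ o ∈ v, o.own ≠ .halt) ∧ (current v).length ≤ 4 ∧
      ∀ o₀ o₁ o₂ o₃, current v = [o₀, o₁, o₂, o₃] → wantsRestart i o₁ o₂ o₃ = true := by
  have hc : Clean m i v := by
    by_contra hc
    exact h (protocolAction_of_not_clean hc)
  refine ⟨hc, ?_⟩
  rcases length_cases (current v) with hv | ⟨o₀, hv⟩ | ⟨o₀, o₁, hv⟩ | ⟨o₀, o₁, o₂, hv⟩ |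
    ⟨o₀, o₁, o₂, o₃, hv⟩ | hv
  · rw [protocolAction_zero hc hv] at h
    exact ⟨sendAll_ne_halt h, by simp [hv], by simp [hv]⟩
  · rw [protocolAction_one hc hv] at h
    exact ⟨sendAll_ne_halt h, by simp [hv], by simp [hv]⟩
  · rw [protocolAction_two hc hv] at h
    exact ⟨sendAll_ne_halt h, by simp [hv], by simp [hv]⟩
  · rw [protocolAction_three hc hv] at h
    exact ⟨sendAll_ne_halt h, by simp [hv], by simp [hv]⟩
  · rw [protocolAction_four hc hv] at h
    split_ifs at h with hw
    · refine ⟨sendAll_ne_halt h, by simp [hv], ?_⟩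
      intro _ _ _ _ h'
      rw [hv] at h'
      simp only [List.cons.injEq, and_true] at h'
      obtain ⟨rfl, rfl, rfl, rfl⟩ := h'
      exact hw
    · exact absurd rfl h
  · exact absurd (protocolAction_five hv) h

theorem length_of_asks {v : View n} {c b : Bool}
    (h : (protocolAction m i v c b).asks = true) : (current v).length = 4 := by
  have h1 : protocolAction m i v c b ≠ .halt := by
    intro h'
    simp [h', Move.asks] at h
  obtain ⟨hc, -, hl, -⟩ := protocolAction_ne_halt h1
  rcases length_cases (current v) with hv | ⟨o₀, hv⟩ | ⟨o₀, o₁, hv⟩ | ⟨o₀, o₁, o₂, hv⟩ |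
    ⟨o₀, o₁, o₂, o₃, hv⟩ | hv
  · rw [protocolAction_zero hc hv] at h
    simpa using sendAll_asks h
  · rw [protocolAction_one hc hv] at h
    simpa using sendAll_asks h
  · rw [protocolAction_two hc hv] at h
    simpa using sendAll_asks h
  · rw [protocolAction_three hc hv] at h
    simpa using sendAll_asks h
  · simp [hv]
  · omega

theorem mem_contribution {s : ℕ} {k : Fin n} {y : ℕ × Piece n} :
    y ∈ contribution m s k ↔ y.1 = s ∧ ((m = 2 ∧ (y.2 = .sub 0 k ∨ y.2 = .sub 1 k)) ∨
      (m ≠ 2 ∧ k.val < m ∧ y.2 = .share k)) := by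
  unfold contribution
  obtain ⟨y1, y2⟩ := y
  split_ifs with h1 h2
  · simp [h1]
    tauto
  · simp [h1, h2]
  · simp [h1, h2]

theorem mem_bundle {s : ℕ} {i : Fin n} {y : ℕ × Piece n} :
    y ∈ bundle m s i ↔ ∃ k : Fin n, k.val % 3 = i.val ∧ y ∈ contribution m s k := by
  simp [bundle]

theorem mem_dealt {s : ℕ} {i j : Fin n} {y : ℕ × Piece n} :
    y ∈ dealt m s i j ↔ m = 2 ∧ j ≠ i ∧ y.1 = s ∧ ∃ d : Fin 2, d.val = i.val ∧ y.2 = .sub d j := by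
  unfold dealt
  obtain ⟨y1, y2⟩ := y
  split_ifs with h
  · simp only [Finset.mem_singleton, Prod.mk.injEq]
    constructor
    · rintro ⟨rfl, rfl⟩
      exact ⟨h.1, h.2.2, rfl, _, rfl, rfl⟩
    · rintro ⟨-, -, rfl, d, hd, rfl⟩
      exact ⟨rfl, by congr 1; exact Fin.ext hd⟩
  · simp only [Finset.notMem_empty, false_iff]
    rintro ⟨h1, h2, -, d, hd, -⟩
    exact h ⟨h1, by omega, h2⟩

theorem sendable_of_mem_dealt {s : ℕ} {y : ℕ × Piece n} (h : y ∈ dealt m s j i) :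
    y.1 = s ∧ Sendable m i y.2 := by
  obtain ⟨h1, -, h2, d, -, h3⟩ := mem_dealt.1 h
  refine ⟨h2, ?_⟩
  rw [h3, sendable_sub]
  exact ⟨h1, Or.inl rfl⟩

theorem permitted_of_mem_bundle (hm : 2 ≤ m) (hi : i.val < 3) {s : ℕ} {y : ℕ × Piece n}
    (h : y ∈ bundle m s i) (j : Fin n) : y.1 = s ∧ Permitted m i j y.2 := by
  obtain ⟨k, hk, h⟩ := mem_bundle.1 h
  obtain ⟨h1, ⟨h2, h3 | h3⟩ | ⟨h2, h3, h4⟩⟩ := mem_contribution.1 h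
  · rw [h3]; exact ⟨h1, h2, Or.inr (Or.inl ⟨hi, hk⟩)⟩
  · rw [h3]; exact ⟨h1, h2, Or.inr (Or.inl ⟨hi, hk⟩)⟩
  · rw [h4]; exact ⟨h1, by omega, Or.inr ⟨hi, hk, h3⟩⟩

theorem contribution_subset_bundle {k : Fin n} (hk : k.val % 3 = i.val) (s : ℕ) :
    contribution m s k ⊆ bundle m s i := fun _ hy => mem_bundle.2 ⟨k, hk, hy⟩

theorem sendable_of_mem_contribution (hm : 2 ≤ m) (hi : i.val < 3) {k : Fin n}
    (hk : k.val % 3 = i.val) {s : ℕ} {y : ℕ × Piece n} (h : y ∈ contribution m s k) :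
    y.1 = s ∧ Sendable m i y.2 := by
  obtain ⟨h1, h2⟩ := permitted_of_mem_bundle hm hi (contribution_subset_bundle hk s h) i
  exact ⟨h1, i, h2⟩

/-- Pieces from steps `1` and `2` are meant to be passed on by their recipient. Only step `3` brings
others, and these come from leaders. -/
theorem Expected.pieces (hm : 2 ≤ m) {s : ℕ} {w : View n} {o : Obs n} (h : Expected m i s w o)
    {k : Fin n} (hk : k ≠ i) {y : ℕ × Piece n} (hy : y ∈ (o.recv k).pieces) :
    y.1 = s ∧ (Sendable m i y.2 ∨ (w.length = 3 ∧ k.val < 3 ∧ Permitted m k i y.2)) := by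
  have h := h k hk
  split at h
  · rw [h.2] at hy
    exact (sendable_of_mem_dealt hy).imp_right Or.inl
  · rw [h.2] at hy
    split_ifs at hy with h1
    · exact (sendable_of_mem_contribution hm h1.1 h1.2 hy).imp_right Or.inl
    · simp at hy
  · rename_i hw
    rcases h.2 with h | ⟨h1, h2⟩
    · simp [h] at hy
    · rw [h2] at hy
      have := permitted_of_mem_bundle hm h1 hy i
      exact ⟨this.1, Or.inr ⟨hw, h1, this.2⟩⟩
  · rw [h] at hy
    simp [Msg.empty] at hy

theorem sharingAt_add {r : Run n} {t t' : ℕ} (ht : t ≤ t') (hs : sharingAt r t = sharingAt r t') :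
    (currentAt r t').length = (currentAt r t).length + (t' - t) := by
  induction t', ht using Nat.le_induction with
  | base => simp
  | succ t' ht ih =>
    have h1 := sharingAt_mono r ht
    rw [sharingAt_succ] at hs
    have h2 : restarts (r t') ≠ true := by
      intro h
      rw [if_pos h] at hs
      omega
    rw [if_neg h2, add_zero] at hs
    rw [currentAt_succ, if_neg h2, List.length_append, ih hs]
    simp
    omega

/-- A round is determined by the number of its sharing and its step within it. -/
theorem eq_of_sharingAt_eq {r : Run n} {t t' : ℕ} (hs : sharingAt r t = sharingAt r t')
    (hl : (currentAt r t).length = (currentAt r t').length) : t = t' := by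
  rcases le_total t t' with h | h
  · have := sharingAt_add h hs
    omega
  · have := sharingAt_add h hs.symm
    omega

theorem length_current (r : Run n) (t : ℕ) :
    (current (view i (hist r t))).length = (currentAt r t).length := by
  rw [current_view, List.length_map]

theorem bundlesSeen_le {o₁ o₂ o₃ : Obs n} (h : wantsRestart i o₁ o₂ o₃ = true) :
    bundlesSeen i o₁ o₂ o₃ ≤ 1 := by
  unfold wantsRestart at h
  simp only [decide_eq_true_eq] at h
  rw [h.2]
  split_ifs <;> omega

theorem eq_of_wantsRestart {o₁ o₂ o₃ : Obs n} (h : wantsRestart i o₁ o₂ o₃ = true) {k k' : Fin n}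
    (hk : k ≠ i) (hk' : k' ≠ i) (hk3 : k.val < 3) (hk3' : k'.val < 3)
    (hp : (o₃.recv k).pieces ≠ ∅) (hp' : (o₃.recv k').pieces ≠ ∅) : k = k' := by
  have := bundlesSeen_le h
  unfold bundlesSeen at this
  rw [Finset.card_le_one] at this
  exact this k (by simp [hk, hk3, hp]) k' (by simp [hk', hk3', hp'])

/-- As long as it plays, a player who follows the protocol does not know the secret. -/
theorem not_knows_of_honest (hn : 3 ≤ n) (hm : 2 ≤ m) (hmn : m ≤ n) {r : Run n} {T : ℕ}
    (hr : ∀ t ≤ T, ∃ c b, r t i = protocolAction m i (view i (hist r t)) c b)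
    (hT : r T i ≠ .halt) : ¬ Knows m i (view i (hist r T)) := by
  obtain ⟨c, b, hcb⟩ := hr T le_rfl
  have hT' := hT
  rw [hcb] at hT'
  obtain ⟨hclean, halive, -, -⟩ := protocolAction_ne_halt hT'
  have hne : ∀ t ≤ T, r t i ≠ .halt := by
    intro t ht
    rcases ht.eq_or_lt with rfl | ht
    · exact hT
    · exact forall_own_hist.1 halive t ht
  -- That `i` did not halt in round `t + 1` certifies that round `t` was as expected.
  have hex : ∀ t < T, Expected m i (sharingAt r t) (current (view i (hist r t)))
      (observe i (r t)) := by
    intro t ht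
    obtain ⟨c', b', h'⟩ := hr (t + 1) ht
    have h1 := hne (t + 1) ht
    rw [h'] at h1
    have h2 := (protocolAction_ne_halt h1).1
    rw [hist_succ, view_append, view_singleton, clean_append_singleton, sharing_view] at h2
    exact h2.2
  have hself : ∀ t < T, (r t i).msgTo i = Msg.empty := by
    intro t ht
    obtain ⟨c', b', h'⟩ := hr t ht.le
    have := legal_protocolAction m i (view i (hist r t)) c' b'
    rw [← h'] at this
    cases hc : r t i with
    | halt => rfl
    | play msg ask =>
      rw [hc] at this
      exact this.2.1
  -- If `i` had seen the pieces of two groups in step `3`, it would have halted in the next round.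
  have huniq : ∀ t < T, (currentAt r t).length = 3 → ∀ k k' : Fin n, k ≠ i → k' ≠ i → k.val < 3 →
      k'.val < 3 → ((r t k).msgTo i).pieces ≠ ∅ → ((r t k').msgTo i).pieces ≠ ∅ → k = k' := by
    intro t ht hl k k' hk hk' hk3 hk3' hp hp'
    obtain ⟨c', b', h'⟩ := hr (t + 1) ht
    have h1 := hne (t + 1) ht
    rw [h'] at h1
    have h2 := (protocolAction_ne_halt h1).2.2.2
    obtain ⟨c₀, b₀, h₀⟩ := hr t ht.le
    have hnr : restarts (r t) ≠ true := by
      intro h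
      have h4 := asks_of_restarts h i
      rw [h₀] at h4
      have h5 := length_of_asks h4
      rw [length_current] at h5
      omega
    have h3 : current (view i (hist r (t + 1))) =
        current (view i (hist r t)) ++ [observe i (r t)] := by
      rw [current_view, current_view, currentAt_succ, if_neg hnr]
      simp
    obtain ⟨o₀, o₁, o₂, h6⟩ : ∃ o₀ o₁ o₂, current (view i (hist r t)) = [o₀, o₁, o₂] := by
      rw [← length_current (i := i)] at hl
      exact List.length_eq_three.1 hl
    rw [h6] at h3
    exact eq_of_wantsRestart (h2 _ _ _ _ h3) hk hk' hk3 hk3' hp hp'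
  rintro ⟨s, hs⟩
  -- The single source for `recovered_lt`: the only leader who sent its pieces in sharing `s`, or
  -- anybody else if there was none.
  obtain ⟨c, hc, hcs⟩ : ∃ c : Fin n, c ≠ i ∧ ∀ t < T, (currentAt r t).length = 3 →
      sharingAt r t = s → ∀ k : Fin n, k ≠ i → k.val < 3 →
        ((r t k).msgTo i).pieces ≠ ∅ → k = c := by
    by_cases hex : ∃ t < T, (currentAt r t).length = 3 ∧ sharingAt r t = s ∧ ∃ k : Fin n, k ≠ i ∧
        k.val < 3 ∧ ((r t k).msgTo i).pieces ≠ ∅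
    · obtain ⟨t, ht, hl, hts, k, hk, hk3, hp⟩ := hex
      refine ⟨k, hk, fun t' ht' hl' hts' k' hk' hk3' hp' => ?_⟩
      obtain rfl := eq_of_sharingAt_eq (hts.trans hts'.symm) (hl.trans hl'.symm)
      exact huniq t ht hl k' k hk' hk hk3' hk3 hp' hp
    · obtain ⟨c, hc⟩ := exists_ne_of_three hn i
      exact ⟨c, hc, fun t ht hl hts k hk hk3 hp => absurd ⟨t, ht, hl, hts, k, hk, hk3, hp⟩ hex⟩
  refine (recovered_lt hn hm hmn hc fun x hx => ?_).not_ge hs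
  have hx : Holds m i (view i (hist r T)) s x := hx
  rw [holds_view] at hx
  rcases hx with hx | ⟨t, ht, k, hk⟩
  · exact Or.inl hx.2
  · right
    have hki : k ≠ i := by
      rintro rfl
      rw [hself t ht] at hk
      simp [Msg.empty] at hk
    obtain ⟨h1, h2 | ⟨h2, h3, h4⟩⟩ := (hex t ht).pieces hm hki hk
    · exact Or.inl h2
    · right
      rw [length_current] at h2
      have := hcs t ht h2 h1.symm k hki h3 (Finset.ne_empty_of_mem hk)
      rwa [← this]

/-- A move that is not silent is not a halt, and a player of the protocol who has not halted does
not know the secret by `not_knows_of_honest`. -/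
theorem discreet_recommended (hn : 3 ≤ n) (hm : 2 ≤ m) (hmn : m ≤ n) (α : unitInterval)
    (i : Fin n) : Discreet m i (recommended n m α i).1 := by
  intro h hk hne a ha
  obtain ⟨r, hr⟩ := exists_run_hist h
  by_contra hs
  obtain ⟨c, b, rfl⟩ := exists_eq_protocolAction ha
  -- The move in question is appended to the history. Only the moves of `i` have to follow the
  -- protocol, so the same move may be assigned to everybody.
  set r' : Run n := Function.update r h.length
    (fun _ => protocolAction m i (view i h) c b) with hr'
  have hh : ∀ t ≤ h.length, hist r' t = hist r t := by
    intro t ht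
    unfold hist
    refine List.map_congr_left fun s hs => ?_
    have := List.mem_range.1 hs
    exact Function.update_of_ne (by omega) _ _
  have hT : r' h.length i = protocolAction m i (view i h) c b := by
    rw [hr', Function.update_self]
  have hsupp : ∀ t < h.length, r t i ∈ ((recommended n m α i).1 (view i (hist r t))).support := by
    intro t ht
    have h1 : moveProb (recommended n m α i).1 i [] (hist r (t + 1)) ≠ 0 := by
      have h2 : h = hist r (t + 1) ++ h.drop (t + 1) := by
        conv_lhs => rw [← List.take_append_drop (t + 1) h, ← hr, hist_take r (by omega), hr]
      intro h0
      apply hne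
      rw [h2]
      clear h2 hne
      generalize h.drop (t + 1) = g
      induction g using List.reverseRecOn with
      | nil => simpa using h0
      | append_singleton g p ih => rw [← List.append_assoc, moveProb_append_singleton, ih, zero_mul]
    rw [hist_succ, moveProb_append_singleton] at h1
    simpa using right_ne_zero_of_mul h1
  refine not_knows_of_honest hn hm hmn (i := i) (r := r') (T := h.length) ?_ ?_ ?_
  · intro t ht
    rcases ht.eq_or_lt with rfl | ht
    · rw [hh _ le_rfl, hr]
      exact ⟨c, b, hT⟩
    · rw [hh t ht.le, hr', Function.update_of_ne (by omega)]
      exact exists_eq_protocolAction (hsupp t ht)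
  · rw [hT]
    intro h0
    apply hs
    rw [h0]
    exact ⟨fun _ => rfl, rfl⟩
  · rwa [hh _ le_rfl, hr]

end Protocol

/-! ### One sharing of the protocol with a possibly deviating player -/

section Sessions

variable {n m : ℕ} {r : Run n} {i j k : Fin n} {T t : ℕ}

/-- A sharing begins in round `T` and is still in use after `c` rounds. -/
def Session (r : Run n) (T c : ℕ) : Prop :=
  ∀ c' ≤ c, currentAt r (T + c') = hist (fun s => r (T + s)) c'

theorem Session.mono {c c' : ℕ} (h : Session r T c) (hc : c' ≤ c) : Session r T c' :=
  fun d hd => h d (hd.trans hc)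

theorem exists_session {c : ℕ} (h : (currentAt r t).length = c) :
    ∃ T, t = T + c ∧ Session r T c := by
  induction c generalizing t with
  | zero =>
    refine ⟨t, rfl, fun c' hc' => ?_⟩
    obtain rfl : c' = 0 := by omega
    exact List.length_eq_zero_iff.1 h
  | succ c ih =>
    cases t with
    | zero => simp [currentAt_zero] at h
    | succ t =>
      rw [currentAt_succ] at h
      by_cases hr : restarts (r t) = true
      · simp [hr] at h
      · rw [if_neg hr] at h
        obtain ⟨T, rfl, hT⟩ := ih (t := t) (by simpa using h)
        refine ⟨T, rfl, fun c' hc' => ?_⟩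
        rcases hc'.eq_or_lt with rfl | hc'
        · rw [← add_assoc, currentAt_succ, if_neg hr, hT c le_rfl, hist_succ]
        · exact hT c' (by omega)

theorem Session.not_restarts {c c' : ℕ} (h : Session r T c) (hc : c' < c) :
    restarts (r (T + c')) ≠ true := by
  intro hr
  have := h (c' + 1) hc
  rw [← add_assoc, currentAt_succ, if_pos hr] at this
  simpa using congrArg List.length this

theorem Session.succ {c : ℕ} (h : Session r T c) (hr : restarts (r (T + c)) ≠ true) :
    Session r T (c + 1) := by
  intro c' hc'
  rcases hc'.eq_or_lt with rfl | hc'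
  · rw [← add_assoc, currentAt_succ, if_neg hr, h c le_rfl, hist_succ]
  · exact h c' (by omega)

theorem Session.sharingAt {c c' : ℕ} (h : Session r T c) (hc : c' ≤ c) :
    sharingAt r (T + c') = sharingAt r T := by
  induction c' with
  | zero => rfl
  | succ c' ih => rw [← add_assoc, sharingAt_succ, if_neg (h.not_restarts hc), ih (by omega)]; rfl

theorem Session.current {c c' : ℕ} (h : Session r T c) (hc : c' ≤ c) (j : Fin n) :
    current (view j (hist r (T + c'))) = view j (hist (fun s => r (T + s)) c') := by
  rw [current_view, h c' hc]
  rfl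

theorem Session.current_three (h : Session r T 3) (j : Fin n) :
    _root_.current (view j (hist r (T + 3))) =
      [observe j (r T), observe j (r (T + 1)), observe j (r (T + 2))] := h.current le_rfl j

theorem Session.current_four (h : Session r T 4) (j : Fin n) :
    _root_.current (view j (hist r (T + 4))) =
      [observe j (r T), observe j (r (T + 1)), observe j (r (T + 2)), observe j (r (T + 3))] :=
  h.current le_rfl j

/-- Player `j` follows the protocol in the run `r`. -/
def Honest (m : ℕ) (j : Fin n) (r : Run n) : Prop :=
  ∀ t, ∃ c b, r t j = protocolAction m j (view j (hist r t)) c b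

theorem Honest.clean (hj : Honest m j r) (ht : r t j ≠ .halt) :
    Clean m j (view j (hist r t)) := by
  obtain ⟨c, b, h⟩ := hj t
  rw [h] at ht
  exact (protocolAction_ne_halt ht).1

theorem Honest.alive (hj : Honest m j r) (ht : r t j ≠ .halt) :
    ∀ o ∈ view j (hist r t), o.own ≠ .halt := by
  obtain ⟨c, b, h⟩ := hj t
  rw [h] at ht
  exact (protocolAction_ne_halt ht).2.1

theorem Honest.length_of_asks (hj : Honest m j r) (ht : (r t j).asks = true) :
    (currentAt r t).length = 4 := by
  obtain ⟨c, b, h⟩ := hj t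
  rw [h] at ht
  rw [← length_current (i := j)]
  exact _root_.length_of_asks ht

/-- A restart needs all requests, and an honest player asks in step `4` only. So a single honest
player protects the sharing up to then. -/
theorem Honest.session (hj : Honest m j r) (h : Session r T 0) : Session r T 4 := by
  have key : ∀ c < 4, Session r T c → Session r T (c + 1) := by
    intro c hc hs
    refine hs.succ fun hr => ?_
    have h1 := hj.length_of_asks (asks_of_restarts hr j)
    rw [hs c le_rfl, hist_length] at h1
    omega
  exact key 3 (by omega) (key 2 (by omega) (key 1 (by omega) (key 0 (by omega) h)))

theorem Session.issued {c : ℕ} (h : Session r T c) (hc : 0 < c) :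
    Issued (view j (hist r (T + c))) (_root_.sharingAt r T) := by
  refine Or.inr ⟨by rw [sharing_view, h.sharingAt le_rfl], ?_⟩
  rw [h.current le_rfl, ← List.length_pos_iff]
  simpa using hc

/-- What an honest leader has collected after step `2`. -/
theorem Clean.holds_bundle (hn : 3 ≤ n) (hs : Session r T 3)
    (hc : Clean m i (view i (hist r (T + 3)))) (hi : i.val < 3) {y : ℕ × Piece n}
    (hy : y ∈ bundle m (sharingAt r T) i) : Holds m i (view i (hist r (T + 3))) y.1 y.2 := by
  have hiss := hs.issued (j := i) (by omega)
  have h1 := hc.current 1 (by simp [hs.current_three])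
  have h2 := hc.current 2 (by simp [hs.current_three])
  simp only [hs.current_three, List.getElem_cons_succ, List.getElem_cons_zero, sharing_view,
    hs.sharingAt le_rfl] at h1 h2
  have hgot : ∀ t < T + 3, ∀ k, y ∈ ((r t k).msgTo i).pieces →
      Holds m i (view i (hist r (T + 3))) y.1 y.2 :=
    fun t ht k hk => (holds_view ..).2 (Or.inr ⟨t, ht, k, hk⟩)
  obtain ⟨k, hk, hyk⟩ := mem_bundle.1 hy
  by_cases hki : k = i
  · subst hki
    obtain ⟨y1, y2⟩ := y
    obtain ⟨rfl, ⟨rfl, h⟩ | ⟨-, -, rfl⟩⟩ := mem_contribution.1 hyk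
    · obtain ⟨d, rfl⟩ : ∃ d, y2 = .sub d k := by
        rcases h with h | h
        · exact ⟨0, h⟩
        · exact ⟨1, h⟩
      by_cases hd : d.val = k.val
      · exact Or.inl ⟨hiss, rfl, hd⟩
      · have hdk : (⟨d.val, by omega⟩ : Fin n) ≠ k := fun h => hd (congrArg Fin.val h)
        refine hgot (T + 1) (by omega) ⟨d.val, by omega⟩ ?_
        have h3 := (h1 _ hdk).2
        change ((r (T + 1) _).msgTo k).pieces = _ at h3
        rw [h3]
        exact mem_dealt.2 ⟨rfl, hdk.symm, rfl, d, rfl, rfl⟩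
    · exact Or.inl ⟨hiss, rfl⟩
  · refine hgot (T + 2) (by omega) k ?_
    have h3 := (h2 k hki).2
    change ((r (T + 2) k).msgTo i).pieces = _ at h3
    rw [h3, if_pos ⟨hi, hk⟩]
    exact hyk

/-- Leader `j` has decided to send the pieces of its group. -/
def Fires (r : Run n) (T : ℕ) (j : Fin n) : Prop :=
  j.val < 3 ∧ (coinOf j (observe j (r (T + 1))) &&
    parityOf j (observe j (r (T + 1))) (observe j (r (T + 2)))) = true ∧ r (T + 3) j ≠ .halt

/-- The filter in `sendAll` removes nothing: a leader that has not halted has checked that it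
received all pieces of its group. -/
theorem Honest.msgTo_three (hn : 3 ≤ n) (hm : 2 ≤ m) (hj : Honest m j r) (hs : Session r T 3)
    (hne : r (T + 3) j ≠ .halt) (hk : k ≠ j) : (r (T + 3) j).msgTo k =
      ⟨if j.val < 3 ∧ ¬ k.val < 3 then
          some (parityOf j (observe j (r (T + 1))) (observe j (r (T + 2)))) else none,
        if j.val < 3 ∧ (coinOf j (observe j (r (T + 1))) &&
            parityOf j (observe j (r (T + 1))) (observe j (r (T + 2)))) = true then
          bundle m (sharingAt r T) j else ∅⟩ := by
  have hc := hj.clean hne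
  obtain ⟨c, b, h⟩ := hj (T + 3)
  rw [h, protocolAction_three hc (hs.current_three j), sendAll_eq (hj.alive hne), msgTo_play,
    if_neg hk, sharing_view, hs.sharingAt le_rfl]
  congr 1
  dsimp only
  split_ifs with h1
  · rw [Finset.filter_eq_self]
    exact fun y hy => ⟨hc.holds_bundle hn hs h1.1 hy, (permitted_of_mem_bundle hm h1.1 hy k).2⟩
  · simp

theorem Fires.pieces (hn : 3 ≤ n) (hm : 2 ≤ m) (hj : Honest m j r) (hs : Session r T 3)
    (hf : Fires r T j)
    (hk : k ≠ j) : ((r (T + 3) j).msgTo k).pieces = bundle m (sharingAt r T) j := by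
  rw [hj.msgTo_three hn hm hs hf.2.2 hk]
  exact if_pos ⟨hf.1, hf.2.1⟩

theorem fires_of_pieces (hn : 3 ≤ n) (hm : 2 ≤ m) (hj : Honest m j r) (hs : Session r T 3)
    (hk : k ≠ j)
    (h : ((r (T + 3) j).msgTo k).pieces ≠ ∅) : Fires r T j := by
  have hne : r (T + 3) j ≠ .halt := by
    intro h'
    simp [h', Move.msgTo, Msg.empty] at h
  rw [hj.msgTo_three hn hm hs hne hk] at h
  by_contra hf
  refine h (if_neg fun h' => hf ⟨h'.1, h'.2, hne⟩)

theorem bundle_ne_empty (hm : 2 ≤ m) (hj : j.val < 3) (s : ℕ) : bundle m s j ≠ ∅ := by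
  have hjj : j.val % 3 = j.val := Nat.mod_eq_of_lt hj
  rw [← Finset.nonempty_iff_ne_empty]
  by_cases h2 : m = 2
  · exact ⟨(s, .sub 0 j), mem_bundle.2 ⟨j, hjj, mem_contribution.2
      ⟨rfl, Or.inl ⟨h2, Or.inl rfl⟩⟩⟩⟩
  · exact ⟨(s, .share j), mem_bundle.2 ⟨j, hjj, mem_contribution.2
      ⟨rfl, Or.inr ⟨h2, by omega, rfl⟩⟩⟩⟩

/-- The counterpart of `Expected.pieces` for an arbitrary recipient `i`: here the honesty of the
sender limits what `i` can get. -/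
theorem Honest.pieces (hn : 3 ≤ n) (hm : 2 ≤ m) (hj : Honest m j r) (hij : i ≠ j) {y : ℕ × Piece n}
    (hy : y ∈ ((r t j).msgTo i).pieces) : y.1 = sharingAt r t ∧ (Sendable m i y.2 ∨
      ∃ T, t = T + 3 ∧ Session r T 3 ∧ Fires r T j ∧ Permitted m j i y.2) := by
  have hne : r t j ≠ .halt := by
    intro h'
    simp [h', Move.msgTo, Msg.empty] at hy
  have hc := hj.clean hne
  have hy' := hy
  obtain ⟨c, b, h⟩ := hj t
  rw [h] at hy
  rcases length_cases (current (view j (hist r t))) with hv | ⟨o₀, hv⟩ | ⟨o₀, o₁, hv⟩ |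
    ⟨o₀, o₁, o₂, hv⟩ | ⟨o₀, o₁, o₂, o₃, hv⟩ | hv
  · rw [protocolAction_zero hc hv] at hy
    simpa [Msg.empty] using sendAll_pieces hy
  · rw [protocolAction_one hc hv] at hy
    exact (sendable_of_mem_dealt (sendAll_pieces hy)).imp (fun h => by rw [h, sharing_view]) Or.inl
  · rw [protocolAction_two hc hv] at hy
    have := sendAll_pieces hy
    dsimp only at this
    split_ifs at this with h1
    · exact (sendable_of_mem_contribution hm (by omega) h1.2.symm this).imp
        (fun h => by rw [h, sharing_view]) Or.inl
    · simp at this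
  · have h3 := length_current (i := j) r t
    obtain ⟨T, rfl, hs⟩ := exists_session (c := 3) (by rw [← h3, hv]; rfl)
    have hf := fires_of_pieces hn hm hj hs hij (Finset.ne_empty_of_mem hy')
    rw [hf.pieces hn hm hj hs hij] at hy'
    obtain ⟨h4, h5⟩ := permitted_of_mem_bundle hm hf.1 hy' i
    refine ⟨by rw [h4]; exact (hs.sharingAt le_rfl).symm, Or.inr ⟨T, rfl, hs, hf, h5⟩⟩
  · rw [protocolAction_four hc hv] at hy
    split_ifs at hy
    · simpa [Msg.empty] using sendAll_pieces hy
    · simp [Move.msgTo, Msg.empty] at hy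
  · rw [protocolAction_five hv] at hy
    simp [Move.msgTo, Msg.empty] at hy

/-- A player learns the secret from honest players only if two leaders send the pieces of their
groups in the same sharing. -/
theorem exists_fires_of_learns (hn : 3 ≤ n) (hm : 2 ≤ m) (hmn : m ≤ n) (hrun : IsRun m r)
    (hr : ∀ j, j ≠ i → Honest m j r) (hl : Learns m r i) :
    ∃ T a b, a ≠ b ∧ a ≠ i ∧ b ≠ i ∧ Session r T 3 ∧ Fires r T a ∧ Fires r T b := by
  by_contra hcon
  push Not at hcon
  obtain ⟨t, s, hs⟩ := hl
  -- If no two leaders fired together, at most one leader `c` fired in sharing `s`, and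
  -- `recovered_lt` applies with this single source.
  obtain ⟨c, hc, hcs⟩ : ∃ c : Fin n, c ≠ i ∧ ∀ T, Session r T 3 → sharingAt r T = s →
      ∀ k : Fin n, k ≠ i → Fires r T k → k = c := by
    by_cases hex : ∃ T, Session r T 3 ∧ sharingAt r T = s ∧ ∃ k : Fin n, k ≠ i ∧ Fires r T k
    · obtain ⟨T, hT, hTs, k, hk, hf⟩ := hex
      refine ⟨k, hk, fun T' hT' hTs' k' hk' hf' => ?_⟩
      obtain rfl : T = T' := eq_of_sharingAt_eq (hTs.trans hTs'.symm) (by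
        rw [← Nat.add_zero T, hT 0 (by omega), ← Nat.add_zero T', hT' 0 (by omega)]
        rfl)
      by_contra hne
      exact hcon T k' k hne hk' hk hT hf' hf
    · obtain ⟨c, hc⟩ := exists_ne_of_three hn i
      exact ⟨c, hc, fun T hT hTs k hk hf => absurd ⟨T, hT, hTs, k, hk, hf⟩ hex⟩
  refine (recovered_lt hn hm hmn hc fun x hx => ?_).not_ge hs
  have hx : Holds m i (view i (hist r t)) s x := hx
  rw [holds_view] at hx
  rcases hx with hx | ⟨t, ht, k, hk⟩
  · exact Or.inl hx.2
  · right
    have hki : k ≠ i := by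
      rintro rfl
      rw [hrun.msgTo_self] at hk
      simp [Msg.empty] at hk
    obtain ⟨h1, h2 | ⟨T, rfl, h2, h3, h4⟩⟩ := (hr k hki).pieces hn hm hki.symm hk
    · exact Or.inl h2
    · right
      have := hcs T h2 (by rw [← h2.sharingAt (c' := 3) le_rfl]; exact h1.symm) k hki h3
      rwa [← this]

theorem IsRun.not_restarts (hrun : IsRun m r) (hj : r t j = .halt) {t' : ℕ} (ht : t ≤ t') :
    restarts (r t') ≠ true := by
  intro h
  have := asks_of_restarts h j
  rw [hrun.halt_succ hj ht] at this
  simp [Move.asks] at this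

/-- If an honest player does not ask for a restart in step `4`, there are no more restarts. -/
theorem Honest.not_restarts (hj : Honest m j r) (hrun : IsRun m r) (hs : Session r T 4)
    (ha : (r (T + 4) j).asks ≠ true) (ht : T ≤ t) : restarts (r t) ≠ true := by
  rcases lt_or_ge t (T + 4) with ht' | ht'
  · obtain ⟨c, rfl⟩ := Nat.exists_eq_add_of_le ht
    exact hs.not_restarts (by omega)
  · refine hrun.not_restarts (j := j) (t := T + 4) ?_ ht'
    by_contra hne
    apply ha
    obtain ⟨c, b, h⟩ := hj (T + 4)
    have hc := hj.clean hne
    rw [h, protocolAction_four hc (hs.current_four j)] at hne ⊢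
    split_ifs at hne ⊢ with hw
    · rw [sendAll_eq (sendAll_ne_halt hne)]
      rfl
    · exact absurd rfl hne

theorem Honest.wantsRestart (hj : Honest m j r) (hs : Session r T 4)
    (ha : (r (T + 4) j).asks = true) : Clean m j (view j (hist r (T + 4))) ∧
      wantsRestart j (observe j (r (T + 1))) (observe j (r (T + 2))) (observe j (r (T + 3))) =
        true := by
  have hne : r (T + 4) j ≠ .halt := by
    intro h
    simp [h, Move.asks] at ha
  refine ⟨hj.clean hne, ?_⟩
  obtain ⟨c, b, h⟩ := hj (T + 4)
  rw [h] at hne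
  exact (protocolAction_ne_halt hne).2.2.2 _ _ _ _ (hs.current_four j)

/-- If two leaders send the pieces of their groups, there are no more restarts. -/
theorem Fires.not_asks (hn : 3 ≤ n) (hm : 2 ≤ m) {a b : Fin n} (ha : Honest m a r)
    (hb : Honest m b r)
    (hab : a ≠ b) (hs : Session r T 4) (hfa : Fires r T a) (hfb : Fires r T b) :
    (r (T + 4) a).asks ≠ true := by
  intro h
  have h1 := bundlesSeen_le (ha.wantsRestart hs h).2
  unfold bundlesSeen at h1
  rw [Finset.card_le_one] at h1
  refine hab (h1 a ?_ b ?_)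
  · simp only [Finset.mem_filter, Finset.mem_univ, true_and, if_true]
    exact ⟨hfa.1, hfa.2.1⟩
  · simp only [Finset.mem_filter, Finset.mem_univ, true_and, hab.symm, if_false]
    refine ⟨hfb.1, ?_⟩
    change ((r (T + 3) b).msgTo a).pieces ≠ ∅
    rw [hfb.pieces hn hm hb (hs.mono (by omega)) hab]
    exact bundle_ne_empty hm hfb.1 _

/-- Every player belongs to one of the three groups, so the bundles together contain all
contributions: all `m` designated shares, or all subshares of both players `0` and `1`. -/
theorem knows_of_bundles (hn : 3 ≤ n) (hm : 2 ≤ m) (hmn : m ≤ n) {v : View n} {s : ℕ}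
    (h : ∀ k : Fin n, k.val < 3 → ∀ y ∈ bundle m s k, Holds m i v y.1 y.2) : Knows m i v := by
  have h' : ∀ k : Fin n, ∀ y ∈ contribution m s k, Holds m i v y.1 y.2 := by
    intro k y hy
    have hk : k.val % 3 < 3 := Nat.mod_lt _ (by omega)
    exact h ⟨k.val % 3, by omega⟩ hk y (mem_bundle.2 ⟨k, rfl, hy⟩)
  refine ⟨s, ?_⟩
  rcases hm.eq_or_lt with rfl | hm3
  · have hrec : ∀ d : Fin 2, Recovers {x | Holds 2 i v s x} (⟨d.val, by omega⟩ : Fin n) := by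
      refine fun d => Or.inr ⟨d, rfl, fun l => h' l (s, .sub d l) (mem_contribution.2
        ⟨rfl, Or.inl ⟨rfl, ?_⟩⟩)⟩
      fin_cases d
      · exact Or.inl rfl
      · exact Or.inr rfl
    exact two_le_ncard (hrec 0) (hrec 1) (by simp)
  · have hsub : (fun k : Fin m => (⟨k.val, by omega⟩ : Fin n)) '' Set.univ ⊆
        {k | Recovers {x | Holds m i v s x} k} := by
      rintro _ ⟨k, -, rfl⟩
      exact Or.inl (h' ⟨k.val, by omega⟩ (s, .share _) (mem_contribution.2
        ⟨rfl, Or.inr ⟨by omega, k.2, rfl⟩⟩))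
    refine le_trans ?_ (Set.ncard_le_ncard hsub (Set.toFinite _))
    rw [Set.ncard_image_of_injective _ fun a b h => by simpa [Fin.ext_iff] using h,
      Set.ncard_univ, Nat.card_eq_fintype_card, Fintype.card_fin]

end Sessions

/-! ### Messages of honest players in steps `0`, `1`, `2`, and the bits in them -/

section Messages

variable {n m : ℕ} {r : Run n} {i j k : Fin n} {T t : ℕ}

theorem clean_hist : Clean m j (view j (hist r t)) ↔
    ∀ s < t, Expected m j (sharingAt r s) (current (view j (hist r s))) (observe j (r s)) := by
  induction t with
  | zero => exact ⟨fun _ s hs => absurd hs (Nat.not_lt_zero s), fun _ => clean_nil⟩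
  | succ t ih =>
    rw [hist_succ, view_append, view_singleton, clean_append_singleton, ih, sharing_view]
    constructor
    · rintro ⟨h1, h2⟩ s hs
      rcases (Nat.lt_succ_iff.1 hs).eq_or_lt with rfl | hs
      · exact h2
      · exact h1 s hs
    · exact fun h => ⟨fun s hs => h s (by omega), h t (by omega)⟩

theorem Honest.ne_halt_of_le (hj : Honest m j r) {t' : ℕ} (ht : r t j ≠ .halt) (htt : t' ≤ t) :
    r t' j ≠ .halt := by
  rcases htt.eq_or_lt with rfl | htt
  · exact ht
  · exact forall_own_hist.1 (hj.alive ht) _ htt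

theorem Honest.msgTo_zero (hj : Honest m j r) (hs : Session r T 0) (k : Fin n) :
    (r T j).msgTo k = Msg.empty := by
  by_cases hne : r T j = .halt
  · rw [hne]; rfl
  have hc := hj.clean hne
  obtain ⟨c, b, h⟩ := hj T
  have hv : current (view j (hist r T)) = [] := hs.current (c' := 0) le_rfl j
  rw [h, protocolAction_zero hc hv, sendAll_eq (hj.alive hne), msgTo_play]
  simp [Msg.empty]

theorem Honest.msgTo_one (hj : Honest m j r) (hs : Session r T 1) (hne : r (T + 1) j ≠ .halt) :
    ∃ c b, r (T + 1) j = protocolAction m j (view j (hist r (T + 1))) c b ∧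
      ∀ k, k ≠ j → (r (T + 1) j).msgTo k =
      ⟨if j.val < 3 ∧ k.val = (j.val + 1) % 3 then some b
        else if j.val < 3 ∧ k.val = (j.val + 2) % 3 then some (xor c b) else none,
        dealt m (sharingAt r T) j k⟩ := by
  have hc := hj.clean hne
  obtain ⟨c, b, h⟩ := hj (T + 1)
  refine ⟨c, b, h, fun k hk => ?_⟩
  have hv : current (view j (hist r (T + 1))) = [observe j (r T)] := hs.current le_rfl j
  rw [h, protocolAction_one hc hv, sendAll_eq (hj.alive hne), msgTo_play, if_neg hk, sharing_view,
    hs.sharingAt le_rfl]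
  congr 1
  rw [Finset.filter_eq_self]
  intro y hy
  obtain ⟨h1, h2, h3, d, h4, h5⟩ := mem_dealt.1 hy
  rw [h3, h5]
  exact ⟨Or.inl ⟨hs.issued (by omega), h1, h4⟩, h1, Or.inr (Or.inr ⟨h4, rfl⟩)⟩

theorem Honest.msgTo_two (hn : 3 ≤ n) (hj : Honest m j r) (hs : Session r T 2)
    (hne : r (T + 2) j ≠ .halt) (hk : k ≠ j) : (r (T + 2) j).msgTo k =
      ⟨if j.val < 3 ∧ k.val = (j.val + 2) % 3 then
          some (xor ((observe j (r (T + 1))).bitFrom ((j.val + 1) % 3))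
            (coinOf j (observe j (r (T + 1))))) else none,
        if ¬ j.val < 3 ∧ k.val = j.val % 3 then contribution m (sharingAt r T) j else ∅⟩ := by
  have hc := hj.clean hne
  obtain ⟨c, b, h⟩ := hj (T + 2)
  have hv : current (view j (hist r (T + 2))) = [observe j (r T), observe j (r (T + 1))] :=
    hs.current le_rfl j
  rw [h, protocolAction_two hc hv, sendAll_eq (hj.alive hne), msgTo_play, if_neg hk, sharing_view,
    hs.sharingAt le_rfl]
  congr 1
  dsimp only
  by_cases hjk : ¬ j.val < 3 ∧ k.val = j.val % 3
  swap
  · rw [if_neg hjk, Finset.filter_empty]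
  rw [if_pos hjk, Finset.filter_eq_self]
  rintro ⟨y1, y2⟩ hy
  have hiss := hs.issued (j := j) (by omega)
  obtain ⟨h1, ⟨h2, h3⟩ | ⟨h2, h3, h4⟩⟩ := mem_contribution.1 hy
  · obtain ⟨d, rfl⟩ : ∃ d, y2 = .sub d j := by
      rcases h3 with h | h
      · exact ⟨0, h⟩
      · exact ⟨1, h⟩
    refine ⟨(holds_view ..).2 (Or.inr ⟨T + 1, by omega, ⟨d.val, by omega⟩, ?_⟩), h2, Or.inl rfl⟩
    have hdj : (⟨d.val, by omega⟩ : Fin n) ≠ j := by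
      intro h
      have := congrArg Fin.val h
      simp at this
      omega
    -- The subshares that `j` contributes were dealt to it in step `1`; otherwise it would have
    -- halted.
    have h5 := clean_hist.1 hc (T + 1) (by omega) _ hdj
    rw [hs.sharingAt (by omega), hs.current (by omega)] at h5
    have h6 : ((r (T + 1) ⟨d.val, by omega⟩).msgTo j).pieces = dealt m (sharingAt r T) _ j := h5.2
    rw [h6]
    exact mem_dealt.2 ⟨h2, hdj.symm, h1, d, rfl, rfl⟩
  · dsimp only at h1 h4
    subst h1 h4
    exact ⟨Or.inl ⟨hiss, rfl⟩, by omega, Or.inl rfl⟩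

/-- The bit that `x` sends to `y` in round `t`. -/
def bitAt (r : Run n) (t : ℕ) (x y : Fin n) : Bool := ((r t x).msgTo y).bit.getD false

theorem bitTo_observe (p : Profile n) (x y : Fin n) :
    (observe x p).bitTo y.val = ((p x).msgTo y).bit.getD false := by
  rw [Obs.bitTo, dif_pos y.2]
  rfl

theorem bitFrom_observe (p : Profile n) (x y : Fin n) :
    (observe x p).bitFrom y.val = ((p y).msgTo x).bit.getD false := by
  rw [Obs.bitFrom, dif_pos y.2]
  rfl

theorem coinOf_observe {x y z : Fin n} (hy : y.val = (x.val + 1) % 3)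
    (hz : z.val = (x.val + 2) % 3) :
    coinOf x (observe x (r t)) = xor (bitAt r t x y) (bitAt r t x z) := by
  rw [coinOf, ← hy, ← hz, bitTo_observe, bitTo_observe]
  rfl

theorem parityOf_observe {x y z : Fin n} (hy : y.val = (x.val + 1) % 3)
    (hz : z.val = (x.val + 2) % 3) {t' : ℕ} :
    parityOf x (observe x (r t)) (observe x (r t')) =
      xor (xor (bitAt r t z x) (bitAt r t' y x)) (coinOf x (observe x (r t))) := by
  rw [parityOf, ← hy, ← hz, bitFrom_observe, bitFrom_observe]
  rfl

end Messages

/-! ### Negating the coins of two consecutive leaders -/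

section Flip

variable {n m : ℕ} {r : Run n} {a b l i j k : Fin n} {T t : ℕ}

/-- The move with the bit that is sent to `k` negated. -/
def Move.negTo (k : Fin n) : Move n → Move n
  | .halt => .halt
  | .play msg ask => .play (Function.update msg k ⟨(msg k).bit.map not, (msg k).pieces⟩) ask

/-- The move without the pieces that are sent. -/
def Move.mute : Move n → Move n
  | .halt => .halt
  | .play msg ask => .play (fun k => ⟨(msg k).bit, ∅⟩) ask

theorem negTo_negTo (k : Fin n) (x : Move n) : (x.negTo k).negTo k = x := by
  cases x with
  | halt => rfl
  | play msg ask => simp [Move.negTo, Option.map_map, Function.comp_def]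

@[simp] theorem asks_negTo (k : Fin n) (x : Move n) : (x.negTo k).asks = x.asks := by
  cases x <;> rfl

@[simp] theorem asks_mute (x : Move n) : x.mute.asks = x.asks := by cases x <;> rfl

theorem negTo_eq_halt {x : Move n} : x.negTo k = .halt ↔ x = .halt := by
  cases x <;> simp [Move.negTo]

theorem mute_eq_halt {x : Move n} : x.mute = .halt ↔ x = .halt := by
  cases x <;> simp [Move.mute]

theorem msgTo_negTo_self (k : Fin n) (x : Move n) :
    (x.negTo k).msgTo k = ⟨(x.msgTo k).bit.map not, (x.msgTo k).pieces⟩ := by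
  cases x <;> simp [Move.negTo, Move.msgTo, Msg.empty]

theorem msgTo_negTo_of_ne (h : j ≠ k) (x : Move n) : (x.negTo k).msgTo j = x.msgTo j := by
  cases x <;> simp [Move.negTo, Move.msgTo, h]

theorem msgTo_mute (k : Fin n) (x : Move n) : x.mute.msgTo k = ⟨(x.msgTo k).bit, ∅⟩ := by
  cases x <;> simp [Move.mute, Move.msgTo, Msg.empty]

/-- The run in which, in the sharing that begins in round `T`, the coins of the leaders `a` and
`b = a⁺` show the opposite side, as seen by these two players only, up to the consequences in
step `3`. -/
def flipRun (a b : Fin n) (r : Run n) (T : ℕ) : Run n := fun t j =>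
  if t = T + 1 ∧ j = a then (r t j).negTo b
  else if t = T + 1 ∧ j = b then (r t j).negTo a
  else if t = T + 2 ∧ j = b then (r t j).negTo a
  else if t = T + 3 ∧ (j = a ∨ j = b) then (r t j).mute
  else r t j

theorem flipRun_of_ne (ha : j ≠ a) (hb : j ≠ b) : flipRun a b r T t j = r t j := by
  simp [flipRun, ha, hb]

theorem flipRun_early (ht : t ≤ T) : flipRun a b r T t = r t := by
  funext j
  simp only [flipRun]
  split_ifs <;> first | rfl | omega

theorem flipRun_one_left : flipRun a b r T (T + 1) a = (r (T + 1) a).negTo b := by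
  simp [flipRun]

theorem flipRun_one_right (hab : a ≠ b) :
    flipRun a b r T (T + 1) b = (r (T + 1) b).negTo a := by
  simp [flipRun, hab.symm]

theorem flipRun_two_left (hab : a ≠ b) : flipRun a b r T (T + 2) a = r (T + 2) a := by
  simp [flipRun, hab]

theorem flipRun_two_right : flipRun a b r T (T + 2) b = (r (T + 2) b).negTo a := by
  simp [flipRun]

theorem flipRun_three (hj : j = a ∨ j = b) :
    flipRun a b r T (T + 3) j = (r (T + 3) j).mute := by
  simp [flipRun, hj]

theorem asks_flipRun : (flipRun a b r T t j).asks = (r t j).asks := by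
  unfold flipRun
  split_ifs <;> simp

theorem restarts_flipRun : restarts (flipRun a b r T t) = restarts (r t) := by
  simp [restarts, asks_flipRun]

theorem flipRun_eq_halt : flipRun a b r T t j = .halt ↔ r t j = .halt := by
  unfold flipRun
  split_ifs <;> simp [negTo_eq_halt, mute_eq_halt]

theorem pieces_negTo (k j : Fin n) (x : Move n) :
    ((x.negTo k).msgTo j).pieces = (x.msgTo j).pieces ∧
      ((x.negTo k).msgTo j).bit.isSome = (x.msgTo j).bit.isSome := by
  by_cases h : j = k
  · subst h; simp [msgTo_negTo_self]
  · simp [msgTo_negTo_of_ne h]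

theorem pieces_flipRun (ht : t ≠ T + 3) :
    ((flipRun a b r T t j).msgTo k).pieces = ((r t j).msgTo k).pieces ∧
      ((flipRun a b r T t j).msgTo k).bit.isSome = ((r t j).msgTo k).bit.isSome := by
  unfold flipRun
  split_ifs with h1 h2 h3 h4
  · exact pieces_negTo ..
  · exact pieces_negTo ..
  · exact pieces_negTo ..
  · omega
  · exact ⟨rfl, rfl⟩

theorem msgTo_flipRun (ht : t ≠ T + 3) (ha : k ≠ a) (hb : k ≠ b) :
    (flipRun a b r T t j).msgTo k = (r t j).msgTo k := by
  unfold flipRun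
  split_ifs with h1 h2 h3 h4
  · exact msgTo_negTo_of_ne hb _
  · exact msgTo_negTo_of_ne ha _
  · exact msgTo_negTo_of_ne ha _
  · omega
  · rfl

theorem bit_flipRun_three : ((flipRun a b r T (T + 3) j).msgTo k).bit =
    ((r (T + 3) j).msgTo k).bit := by
  by_cases h : j = a ∨ j = b
  · rw [flipRun_three h, msgTo_mute]
  · rw [flipRun_of_ne (fun h' => h (Or.inl h')) (fun h' => h (Or.inr h'))]

theorem sharingAt_flipRun : sharingAt (flipRun a b r T) t = sharingAt r t :=
  sharingAt_congr fun _ _ => restarts_flipRun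

theorem Session.flipRun {T' c : ℕ} (h : Session r T' c) :
    Session (_root_.flipRun a b r T) T' c := by
  have h0 : Session (_root_.flipRun a b r T) T' 0 := by
    intro c' hc'
    obtain rfl : c' = 0 := by omega
    have h1 := h 0 (Nat.zero_le c)
    cases T' with
    | zero => rfl
    | succ T' =>
      have h2 : currentAt r (T' + 1) = [] := h1
      change currentAt (_root_.flipRun a b r T) (T' + 1) = []
      rw [currentAt_succ] at h2 ⊢
      rw [restarts_flipRun]
      split_ifs with hr
      · rfl
      · simp [hr] at h2
  induction c with
  | zero => exact h0
  | succ c ih =>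
    refine (ih (h.mono (Nat.le_succ c))).succ ?_
    rw [restarts_flipRun]
    exact h.not_restarts (Nat.lt_succ_self c)

theorem length_currentAt_flipRun : (currentAt (flipRun a b r T) t).length =
    (currentAt r t).length := by
  obtain ⟨T', hT', hs⟩ := exists_session (r := r) (t := t) rfl
  have h1 := (hs.flipRun (a := a) (b := b) (T := T)) _ le_rfl
  rw [← hT'] at h1
  rw [h1, hist_length]

theorem observe_flipRun (ht : t ≠ T + 3) (ha : k ≠ a) (hb : k ≠ b) :
    observe k (flipRun a b r T t) = observe k (r t) := by
  unfold observe
  congr 1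
  · exact flipRun_of_ne ha hb
  · funext j; exact msgTo_flipRun ht ha hb
  · exact restarts_flipRun

/-- The altered bits travel between `a` and `b` only. Before step `3` has taken place nobody else,
in particular no deviator, can notice the flip. -/
theorem view_flipRun (ht : t ≤ T + 3) (ha : k ≠ a) (hb : k ≠ b) :
    view k (hist (flipRun a b r T) t) = view k (hist r t) := by
  unfold view hist
  rw [List.map_map, List.map_map]
  refine List.map_congr_left fun s hs => ?_
  have := List.mem_range.1 hs
  exact observe_flipRun (by omega) ha hb

theorem expected_congr {s : ℕ} {w w' : View n} {o o' : Obs n} (hl : w.length = w'.length)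
    (h : ∀ k, (o.recv k).pieces = (o'.recv k).pieces ∧
      (o.recv k).bit.isSome = (o'.recv k).bit.isSome) :
    Expected m i s w o ↔ Expected m i s w' o' := by
  have he : ∀ k, o.recv k = Msg.empty ↔ o'.recv k = Msg.empty := by
    intro k
    have hx : ∀ x : Msg n, x = Msg.empty ↔ x.bit.isSome = false ∧ x.pieces = ∅ := by
      rintro ⟨b, p⟩
      simp [Msg.empty]
    rw [hx, hx, (h k).1, (h k).2]
  unfold Expected
  refine forall_congr' fun k => forall_congr' fun _ => ?_
  rw [hl]
  split
  · rw [(h k).1, (h k).2]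
  · rw [(h k).1, (h k).2]
  · rw [(h k).1, (h k).2]
  · exact he k

/-- The checks of the protocol concern the presence of bits and the pieces, but not the values of
the bits. -/
theorem clean_flipRun (ht : t ≤ T + 3) : Clean m k (view k (hist (flipRun a b r T) t)) ↔
    Clean m k (view k (hist r t)) := by
  rw [clean_hist, clean_hist]
  refine forall₂_congr fun s hs => ?_
  rw [sharingAt_flipRun]
  refine expected_congr ?_ fun j => pieces_flipRun (by omega)
  rw [length_current, length_current, length_currentAt_flipRun]

theorem holds_flipRun (ht : t ≤ T + 3) {s : ℕ} {x : Piece n} :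
    Holds m k (view k (hist (flipRun a b r T) t)) s x ↔ Holds m k (view k (hist r t)) s x := by
  rw [holds_view, holds_view, issuedAt_congr fun _ _ => restarts_flipRun]
  refine or_congr_right (exists_congr fun t' => and_congr_right fun ht' => ?_)
  rw [exists_congr]
  intro j
  rw [(pieces_flipRun (by omega)).1]

theorem sendAll_flipRun (ht : t ≤ T + 3) {f : Fin n → Msg n} {ask : Bool} :
    sendAll m k (view k (hist (flipRun a b r T) t)) f ask =
      sendAll m k (view k (hist r t)) f ask := by
  unfold sendAll
  simp only [holds_flipRun ht]
  congr 1
  rw [eq_iff_iff, forall_own_hist, forall_own_hist]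
  refine forall₂_congr fun s _ => ?_
  rw [not_iff_not, flipRun_eq_halt]

theorem negTo_sendAll {v : View n} {f : Fin n → Msg n} {ask : Bool} (hk : k ≠ j) :
    (sendAll m j v f ask).negTo k =
      sendAll m j v (Function.update f k ⟨(f k).bit.map not, (f k).pieces⟩) ask := by
  unfold sendAll
  split_ifs with h
  · simp only [Move.negTo, Move.play.injEq, and_true]
    funext x
    by_cases hx : x = k
    · subst hx; simp [hk]
    · simp [hx]
  · rfl

theorem mute_sendAll {v : View n} {f : Fin n → Msg n} {ask : Bool} :
    (sendAll m j v f ask).mute = sendAll m j v (fun k => ⟨(f k).bit, ∅⟩) ask := by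
  unfold sendAll
  split_ifs with h
  · simp only [Move.mute, Move.play.injEq, and_true]
    funext x
    by_cases hx : x = j
    · subst hx; simp [Msg.empty]
    · simp [hx]
  · rfl

/-- The bit to `j⁻` is `c ⊕ d`. To leave it unchanged while `d` is negated, `c` has to be negated
too. -/
theorem negTo_protocolAction_next {v : View n} {c d : Bool} (hc : Clean m j v) {o₀ : Obs n}
    (hv : current v = [o₀]) (hj : j.val < 3) (hk : k.val = (j.val + 1) % 3) :
    (protocolAction m j v c d).negTo k = protocolAction m j v (!c) (!d) := by
  rw [protocolAction_one hc hv, protocolAction_one hc hv, negTo_sendAll (by omega)]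
  congr 1
  funext x
  by_cases hx : x = k
  · subst hx
    simp [hj, hk]
  · have hx' : x.val ≠ (j.val + 1) % 3 := fun h => hx (Fin.ext (h.trans hk.symm))
    simp [hx, hx']

/-- Here `d` is kept, so negating `c ⊕ d` means negating `c`. -/
theorem negTo_protocolAction_prev {v : View n} {c d : Bool} (hc : Clean m j v) {o₀ : Obs n}
    (hv : current v = [o₀]) (hj : j.val < 3) (hk : k.val = (j.val + 2) % 3) :
    (protocolAction m j v c d).negTo k = protocolAction m j v (!c) d := by
  rw [protocolAction_one hc hv, protocolAction_one hc hv, negTo_sendAll (by omega)]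
  congr 1
  funext x
  by_cases hx : x = k
  · subst hx
    have h1 : (j.val < 3 ∧ x.val = (j.val + 1) % 3) = False := by
      rw [eq_iff_iff, iff_false]; omega
    have h2 : (j.val < 3 ∧ x.val = (j.val + 2) % 3) = True := eq_true ⟨hj, hk⟩
    simp only [Function.update_self, h1, h2, if_true, if_false]
    simp
  · have hx' : x.val ≠ (j.val + 2) % 3 := fun h => hx (Fin.ext (h.trans hk.symm))
    simp [hx, hx']

end Flip

/-! ### How the flip changes the probability of a history -/

section FlipWeight

variable {n m : ℕ} {α : unitInterval} {r : Run n} {a b l i j k : Fin n} {T t : ℕ}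

theorem coin_half (d d' : Bool) : coin half d = coin half d' := by
  have : ∀ d, coin half d = ENNReal.ofReal (1 / 2) := by
    intro d
    rw [coin, PMF.ofFintype_apply]
    congr 1
    cases d <;> norm_num [half]
  rw [this, this]

theorem recommended_apply_of_eq {v : View n} {c d : Bool}
    (h : ∀ c' d', protocolAction m j v c' d' = protocolAction m j v c d) :
    (recommended n m α j).1 v (protocolAction m j v c d) = 1 := by
  have : (recommended n m α j).1 v = PMF.pure (protocolAction m j v c d) := by
    change (coin α).bind _ = _
    simp only [h, PMF.bind_const]
  rw [this]
  simp

/-- The two messages of a leader in step `1` reveal both random bits, so the probability of its move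
is that of one pair of bits. -/
theorem protocolAction_injective (hn : 3 ≤ n) {v : View n} {c d c' d' : Bool} (hc : Clean m j v)
    (hv : ∀ o ∈ v, o.own ≠ .halt) {o₀ : Obs n} (hcur : current v = [o₀]) (hj : j.val < 3)
    (h : protocolAction m j v c d = protocolAction m j v c' d') : c = c' ∧ d = d' := by
  rw [protocolAction_one hc hcur, protocolAction_one hc hcur, sendAll_eq hv, sendAll_eq hv] at h
  simp only [Move.play.injEq, and_true] at h
  obtain ⟨y, hy⟩ : ∃ y : Fin n, y.val = (j.val + 1) % 3 := ⟨⟨(j.val + 1) % 3, by omega⟩, rfl⟩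
  obtain ⟨z, hz⟩ : ∃ z : Fin n, z.val = (j.val + 2) % 3 := ⟨⟨(j.val + 2) % 3, by omega⟩, rfl⟩
  have h1 := congrFun h y
  have h2 := congrFun h z
  have hyj : y ≠ j := by omega
  have hzj : z ≠ j := by omega
  have e1 : (j.val < 3 ∧ y.val = (j.val + 1) % 3) = True := eq_true ⟨hj, hy⟩
  have e2 : (j.val < 3 ∧ z.val = (j.val + 1) % 3) = False := by rw [eq_iff_iff, iff_false]; omega
  have e3 : (j.val < 3 ∧ z.val = (j.val + 2) % 3) = True := eq_true ⟨hj, hz⟩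
  simp only [hyj, hzj, e1, e2, e3, if_true, if_false, Msg.mk.injEq, Option.some.injEq] at h1 h2
  obtain ⟨rfl, -⟩ := h1
  refine ⟨?_, rfl⟩
  have := h2.1
  revert this
  cases c <;> cases c' <;> cases d <;> simp

theorem recommended_apply_one (hn : 3 ≤ n) {v : View n} {c d : Bool} (hc : Clean m j v)
    (hv : ∀ o ∈ v, o.own ≠ .halt) {o₀ : Obs n} (hcur : current v = [o₀]) (hj : j.val < 3) :
    (recommended n m α j).1 v (protocolAction m j v c d) = coin α c * coin half d := by
  classical
  have hinj : ∀ c' d', protocolAction m j v c d = protocolAction m j v c' d' ↔ c = c' ∧ d = d' :=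
    fun c' d' => ⟨protocolAction_injective hn hc hv hcur hj, by rintro ⟨rfl, rfl⟩; rfl⟩
  simp only [recommended, PMF.bind_apply, PMF.pure_apply, hinj, tsum_bool]
  cases c <;> cases d <;> simp

theorem honest_of_positive {σ : ∀ j, Strategy n m j} (hj : σ j = recommended n m α j)
    (hr : Positive σ r) : Honest m j r := by
  intro t
  have := hr.step t j
  rw [hj] at this
  exact exists_eq_protocolAction this

theorem Fires.alive (hj : Honest m j r) (hf : Fires r T j) {c : ℕ} (hc : c ≤ 3) :
    r (T + c) j ≠ .halt := hj.ne_halt_of_le hf.2.2 (by omega)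

theorem bitAt_neg (h : ((r t j).msgTo k).bit.isSome = true) {r' : Run n}
    (hr : r' t j = (r t j).negTo k) : bitAt r' t j k = !bitAt r t j k := by
  unfold bitAt
  rw [hr, msgTo_negTo_self]
  obtain ⟨x, hx⟩ := Option.isSome_iff_exists.1 h
  simp [hx]

/-- Two consecutive leaders `a` and `b = a⁺` send the pieces of their groups. -/
structure Duo (m : ℕ) (a b : Fin n) (r : Run n) (T : ℕ) : Prop where
  next : b.val = (a.val + 1) % 3
  left : Honest m a r
  right : Honest m b r
  session : Session r T 3
  fires_left : Fires r T a
  fires_right : Fires r T b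

theorem Duo.ne (h : Duo m a b r T) : a ≠ b := by
  rintro rfl
  have := h.next
  omega

theorem Duo.next_right (h : Duo m a b r T) (hl : l.val = (a.val + 2) % 3) :
    l.val = (b.val + 1) % 3 := by
  have := h.next
  omega

theorem Duo.prev_right (h : Duo m a b r T) : a.val = (b.val + 2) % 3 := by
  have := h.next
  have := h.fires_left.1
  omega

theorem Duo.bit_left (h : Duo m a b r T) :
    bitAt (flipRun a b r T) (T + 1) a b = !bitAt r (T + 1) a b := by
  refine bitAt_neg ?_ flipRun_one_left
  obtain ⟨c, d, -, hm⟩ := h.left.msgTo_one (h.session.mono (by omega))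
    (h.fires_left.alive h.left (by omega))
  rw [hm b h.ne.symm, if_pos ⟨h.fires_left.1, h.next⟩]
  rfl

theorem Duo.bit_right (h : Duo m a b r T) :
    bitAt (flipRun a b r T) (T + 1) b a = !bitAt r (T + 1) b a := by
  refine bitAt_neg ?_ (flipRun_one_right h.ne)
  obtain ⟨c, d, -, hm⟩ := h.right.msgTo_one (h.session.mono (by omega))
    (h.fires_right.alive h.right (by omega))
  have h1 := h.prev_right
  rw [hm a h.ne, if_neg (by omega), if_pos ⟨h.fires_right.1, h1⟩]
  rfl

theorem Duo.bit_two (hn : 3 ≤ n) (h : Duo m a b r T) :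
    bitAt (flipRun a b r T) (T + 2) b a = !bitAt r (T + 2) b a := by
  refine bitAt_neg ?_ flipRun_two_right
  rw [h.right.msgTo_two hn (h.session.mono (by omega))
    (h.fires_right.alive h.right (by omega)) h.ne, if_pos ⟨h.fires_right.1, h.prev_right⟩]
  rfl

theorem bitAt_flipRun_of_ne (ht : t ≠ T + 3) (ha : k ≠ a) (hb : k ≠ b) :
    bitAt (flipRun a b r T) t j k = bitAt r t j k := by
  rw [bitAt, msgTo_flipRun ht ha hb, bitAt]

theorem bitAt_flipRun_of_ne' (ha : j ≠ a) (hb : j ≠ b) :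
    bitAt (flipRun a b r T) t j k = bitAt r t j k := by
  rw [bitAt, flipRun_of_ne ha hb, bitAt]

theorem Duo.coin_left (hn : 3 ≤ n) (h : Duo m a b r T) :
    coinOf a (observe a (flipRun a b r T (T + 1))) = !coinOf a (observe a (r (T + 1))) := by
  obtain ⟨l, hl⟩ : ∃ l : Fin n, l.val = (a.val + 2) % 3 := ⟨⟨(a.val + 2) % 3, by omega⟩, rfl⟩
  have h1 := h.next
  rw [coinOf_observe h.next hl, coinOf_observe h.next hl, h.bit_left,
    bitAt_flipRun_of_ne (by omega) (by omega) (by omega), Bool.not_xor]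

theorem Duo.coin_right (hn : 3 ≤ n) (h : Duo m a b r T) :
    coinOf b (observe b (flipRun a b r T (T + 1))) = !coinOf b (observe b (r (T + 1))) := by
  obtain ⟨l, hl⟩ : ∃ l : Fin n, l.val = (a.val + 2) % 3 := ⟨⟨(a.val + 2) % 3, by omega⟩, rfl⟩
  have h1 := h.next
  rw [coinOf_observe (h.next_right hl) h.prev_right, coinOf_observe (h.next_right hl) h.prev_right,
    h.bit_right, bitAt_flipRun_of_ne (by omega) (by omega) (by omega), Bool.xor_not]

/-- The two negations, of the bit from `b` in step `2` and of the coin of `a`, cancel. -/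
theorem Duo.parity_left (hn : 3 ≤ n) (h : Duo m a b r T) :
    parityOf a (observe a (flipRun a b r T (T + 1))) (observe a (flipRun a b r T (T + 2))) =
      parityOf a (observe a (r (T + 1))) (observe a (r (T + 2))) := by
  obtain ⟨l, hl⟩ : ∃ l : Fin n, l.val = (a.val + 2) % 3 := ⟨⟨(a.val + 2) % 3, by omega⟩, rfl⟩
  have h1 := h.next
  rw [parityOf_observe h.next hl, parityOf_observe h.next hl, h.coin_left hn, h.bit_two hn,
    bitAt_flipRun_of_ne' (by omega) (by omega)]
  simp

/-- For `b` it is the bit from `a` in step `1` and its own coin that cancel; the bit of the third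
leader is untouched. -/
theorem Duo.parity_right (hn : 3 ≤ n) (h : Duo m a b r T) :
    parityOf b (observe b (flipRun a b r T (T + 1))) (observe b (flipRun a b r T (T + 2))) =
      parityOf b (observe b (r (T + 1))) (observe b (r (T + 2))) := by
  obtain ⟨l, hl⟩ : ∃ l : Fin n, l.val = (a.val + 2) % 3 := ⟨⟨(a.val + 2) % 3, by omega⟩, rfl⟩
  have h1 := h.next
  rw [parityOf_observe (h.next_right hl) h.prev_right,
    parityOf_observe (h.next_right hl) h.prev_right, h.coin_right hn, h.bit_left,
    bitAt_flipRun_of_ne' (j := l) (by omega) (by omega)]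
  simp

/-- In its message to the third leader, `a` combines its own coin and the bit from `b`. Both are
negated, so the unchanged message is what the protocol prescribes after the flip. -/
theorem Duo.two_left (hn : 3 ≤ n) (h : Duo m a b r T) (c d : Bool) : flipRun a b r T (T + 2) a =
    protocolAction m a (view a (hist (flipRun a b r T) (T + 2))) c d := by
  have hne := h.fires_left.alive h.left (c := 2) (by omega)
  have hc := h.left.clean hne
  obtain ⟨c', d', hr⟩ := h.left (T + 2)
  have hv := (h.session.mono (c' := 2) (by omega)).current
    le_rfl a
  have hv' := ((h.session.flipRun (a := a) (b := b) (T := T)).mono (c' := 2) (by omega)).current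
    le_rfl a
  have h1 := h.next
  rw [flipRun_two_left h.ne, hr, protocolAction_two hc hv,
    protocolAction_two ((clean_flipRun (by omega)).2 hc) hv', sendAll_flipRun (by omega),
    sharing_view,
    sharing_view, sharingAt_flipRun]
  congr 1
  funext x
  have hbit : ∀ o : Obs n, o.bitFrom ((a.val + 1) % 3) = o.bitFrom b.val := fun o => by rw [← h1]
  have h2 := h.coin_left hn
  have h3 := h.bit_right
  simp only [hbit]
  change Msg.mk (if _ then some (xor ((observe a (r (T + 1))).bitFrom b.val)
    (coinOf a (observe a (r (T + 1))))) else none) _ = Msg.mk (if _ then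
    some (xor ((observe a (flipRun a b r T (T + 1))).bitFrom b.val)
    (coinOf a (observe a (flipRun a b r T (T + 1))))) else none) _
  rw [h2, bitFrom_observe, bitFrom_observe]
  change Msg.mk (if _ then some (xor (bitAt r (T + 1) b a) _) else none) _ =
    Msg.mk (if _ then some (xor (bitAt (flipRun a b r T) (T + 1) b a) _) else none) _
  rw [h3, Bool.not_xor_not]

/-- The message of `b` to `a` contains one negated term, the coin of `b`. Hence `flipRun` negates
it. -/
theorem Duo.two_right (hn : 3 ≤ n) (h : Duo m a b r T) (c d : Bool) : flipRun a b r T (T + 2) b =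
    protocolAction m b (view b (hist (flipRun a b r T) (T + 2))) c d := by
  obtain ⟨l, hl⟩ : ∃ l : Fin n, l.val = (a.val + 2) % 3 := ⟨⟨(a.val + 2) % 3, by omega⟩, rfl⟩
  have hne := h.fires_right.alive h.right (c := 2) (by omega)
  have hc := h.right.clean hne
  obtain ⟨c', d', hr⟩ := h.right (T + 2)
  have hv := (h.session.mono (c' := 2) (by omega)).current
    le_rfl b
  have hv' := ((h.session.flipRun (a := a) (b := b) (T := T)).mono (c' := 2) (by omega)).current
    le_rfl b
  have h1 := h.next_right hl
  have h2 := h.prev_right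
  rw [flipRun_two_right, hr, protocolAction_two hc hv,
    protocolAction_two ((clean_flipRun (by omega)).2 hc) hv', sendAll_flipRun (by omega),
    sharing_view,
    sharing_view, sharingAt_flipRun, negTo_sendAll h.ne]
  congr 1
  funext x
  have hbit : ∀ o : Obs n, o.bitFrom ((b.val + 1) % 3) = o.bitFrom l.val := fun o => by rw [← h1]
  have h3 := h.coin_right hn
  have h4 : ∀ x : Fin n, x.val = (b.val + 2) % 3 ↔ x = a := fun x => by
    rw [← h2, Fin.ext_iff]
  have h5 : ¬ (¬ b.val < 3 ∧ x.val = b.val % 3) := fun h' => h'.1 h.fires_right.1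
  have h6 : ¬ (¬ b.val < 3 ∧ a.val = b.val % 3) := fun h' => h'.1 h.fires_right.1
  have h7 : bitAt (flipRun a b r T) (T + 1) l b = bitAt r (T + 1) l b :=
    bitAt_flipRun_of_ne' (by omega) (by omega)
  simp only [hbit, h4, h5, h6, if_false]
  by_cases hx : x = a
  · subst hx
    have hb3 := h.fires_right.1
    simp only [Function.update_self, hb3, true_and, if_true, Option.map_some]
    congr 2
    rw [h3, bitFrom_observe, bitFrom_observe]
    change (!(xor (bitAt r (T + 1) l b) _)) = xor (bitAt (flipRun x b r T) (T + 1) l b) _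
    rw [h7, Bool.xor_not]
  · rw [Function.update_of_ne hx]
    simp only [hx, h5, and_false, if_false]

/-- Still `p = 1`, but the coin is now `0`: the protocol sends the same bits and no pieces, which is
what `Move.mute` does. -/
theorem Duo.three (hn : 3 ≤ n) (h : Duo m a b r T) (hj : j = a ∨ j = b) (c d : Bool) :
    flipRun a b r T (T + 3) j =
      protocolAction m j (view j (hist (flipRun a b r T) (T + 3))) c d := by
  have key : Honest m j r → Fires r T j →
      coinOf j (observe j (flipRun a b r T (T + 1))) = !coinOf j (observe j (r (T + 1))) →
      parityOf j (observe j (flipRun a b r T (T + 1))) (observe j (flipRun a b r T (T + 2))) =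
        parityOf j (observe j (r (T + 1))) (observe j (r (T + 2))) →
      flipRun a b r T (T + 3) j =
        protocolAction m j (view j (hist (flipRun a b r T) (T + 3))) c d := by
    intro hh hf h1 h2
    have hc := hh.clean hf.2.2
    obtain ⟨c', d', hr⟩ := hh (T + 3)
    rw [flipRun_three hj, hr, protocolAction_three hc (h.session.current_three j),
      protocolAction_three ((clean_flipRun (by omega)).2 hc) (h.session.flipRun.current_three j),
      sendAll_flipRun (by omega), mute_sendAll]
    congr 1
    funext x
    have h3 := hf.2.1
    rw [h2, h1]
    simp only [Bool.and_eq_true] at h3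
    simp [h3.1]
  rcases hj with rfl | rfl
  · exact key h.left h.fires_left (h.coin_left hn) (h.parity_left hn)
  · exact key h.right h.fires_right (h.coin_right hn) (h.parity_right hn)

theorem protocolAction_congr {v : View n} {o₀ o₁ : Obs n} {w : View n}
    (hv : current v = o₀ :: o₁ :: w) (c d c' d' : Bool) :
    protocolAction m j v c d = protocolAction m j v c' d' := by
  unfold protocolAction
  rw [hv]
  rcases w with _ | ⟨o₂, _ | ⟨o₃, _ | ⟨o₄, w⟩⟩⟩ <;> rfl

theorem coinOf_protocolAction (hn : 3 ≤ n) (hj : Honest m j r) (hs : Session r T 1)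
    (hj3 : j.val < 3)
    (hne : r (T + 1) j ≠ .halt) : ∃ d, r (T + 1) j = protocolAction m j (view j (hist r (T + 1)))
      (coinOf j (observe j (r (T + 1)))) d := by
  obtain ⟨c, d, h1, h2⟩ := hj.msgTo_one hs hne
  obtain ⟨y, hy⟩ : ∃ y : Fin n, y.val = (j.val + 1) % 3 := ⟨⟨(j.val + 1) % 3, by omega⟩, rfl⟩
  obtain ⟨z, hz⟩ : ∃ z : Fin n, z.val = (j.val + 2) % 3 := ⟨⟨(j.val + 2) % 3, by omega⟩, rfl⟩
  have e1 : (j.val < 3 ∧ y.val = (j.val + 1) % 3) = True := eq_true ⟨hj3, hy⟩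
  have e2 : (j.val < 3 ∧ z.val = (j.val + 1) % 3) = False := by rw [eq_iff_iff, iff_false]; omega
  have e3 : (j.val < 3 ∧ z.val = (j.val + 2) % 3) = True := eq_true ⟨hj3, hz⟩
  refine ⟨d, ?_⟩
  rw [coinOf_observe hy hz, bitAt, bitAt, h2 y (by omega), h2 z (by omega)]
  simp only [e1, e2, e3, if_true, if_false, Option.getD_some]
  rw [h1]
  congr 1
  cases c <;> cases d <;> rfl

/-- The flip replaces a coin `true` by `false`; the auxiliary bit is fair, so it does not matter
whether it is negated. The product form avoids dividing by `α`. -/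
theorem Duo.one (hn : 3 ≤ n) (h : Duo m a b r T) (hj : j = a ∨ j = b) :
    (recommended n m α j).1 (view j (hist r (T + 1))) (flipRun a b r T (T + 1) j) * coin α true =
      (recommended n m α j).1 (view j (hist r (T + 1))) (r (T + 1) j) * coin α false := by
  have hs : Session r T 1 := h.session.mono (by omega)
  have key : ∀ x d', flipRun a b r T (T + 1) j = (r (T + 1) j).negTo x → Honest m j r →
      Fires r T j → (∀ d, (protocolAction m j (view j (hist r (T + 1))) true d).negTo x =
        protocolAction m j (view j (hist r (T + 1))) false (xor d d')) →
      (recommended n m α j).1 (view j (hist r (T + 1))) (flipRun a b r T (T + 1) j) *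
        coin α true = (recommended n m α j).1 (view j (hist r (T + 1))) (r (T + 1) j) *
          coin α false := by
    intro x d' hx hh hf hneg
    have hne := hf.alive hh (c := 1) (by omega)
    obtain ⟨d, hd⟩ := coinOf_protocolAction hn hh hs hf.1 hne
    have hco : coinOf j (observe j (r (T + 1))) = true := by
      have := hf.2.1
      simp only [Bool.and_eq_true] at this
      exact this.1
    rw [hco] at hd
    have hv : current (view j (hist r (T + 1))) = [observe j (r T)] := hs.current le_rfl j
    rw [hx, hd, hneg, recommended_apply_one hn (hh.clean hne) (hh.alive hne) hv hf.1,
      recommended_apply_one hn (hh.clean hne) (hh.alive hne) hv hf.1, coin_half (xor d d') d]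
    ring
  have hclean : ∀ {j}, Honest m j r → Fires r T j → Clean m j (view j (hist r (T + 1))) ∧
      current (view j (hist r (T + 1))) = [observe j (r T)] :=
    fun hh hf => ⟨hh.clean (hf.alive hh (by omega)), hs.current le_rfl _⟩
  rcases hj with rfl | rfl
  · refine key b true flipRun_one_left h.left h.fires_left fun d => ?_
    obtain ⟨h1, h2⟩ := hclean h.left h.fires_left
    rw [negTo_protocolAction_next h1 h2 h.fires_left.1 h.next]
    simp
  · refine key a false (flipRun_one_right h.ne) h.right h.fires_right fun d => ?_
    obtain ⟨h1, h2⟩ := hclean h.right h.fires_right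
    rw [negTo_protocolAction_prev h1 h2 h.fires_right.1 h.prev_right]
    simp

theorem weight_hist_succ (σ : ∀ j, Strategy n m j) (r : Run n) (t : ℕ) :
    weight σ (hist r (t + 1)) = weight σ (hist r t) * stepProb σ (hist r t) (r t) := by
  rw [hist_succ, weight_append_singleton]

/-- Flipping the coins of two leaders changes the probability by a factor of `((1 - α) / α) ^ 2`. -/
theorem Duo.weight (hn : 3 ≤ n) (h : Duo m a b r T) {σ : ∀ j, Strategy n m j}
    (ha : σ a = recommended n m α a) (hb : σ b = recommended n m α b) :
    weight σ (hist (flipRun a b r T) (T + 4)) * coin α true ^ 2 =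
      weight σ (hist r (T + 4)) * coin α false ^ 2 := by
  have h0 : hist (flipRun a b r T) (T + 1) = hist r (T + 1) := by
    unfold hist
    refine List.map_congr_left fun s hs => flipRun_early ?_
    have := List.mem_range.1 hs
    omega
  have h1 : stepProb σ (hist r (T + 1)) (flipRun a b r T (T + 1)) * coin α true ^ 2 =
      stepProb σ (hist r (T + 1)) (r (T + 1)) * coin α false ^ 2 := by
    unfold stepProb
    have hmem : b ∈ Finset.univ.erase a := Finset.mem_erase.2 ⟨h.ne.symm, Finset.mem_univ b⟩
    rw [← Finset.mul_prod_erase _ _ (Finset.mem_univ a), ← Finset.mul_prod_erase _ _ hmem,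
      ← Finset.mul_prod_erase _ _ (Finset.mem_univ a), ← Finset.mul_prod_erase _ _ hmem]
    have hp : ∏ x ∈ (Finset.univ.erase a).erase b,
        (σ x).1 (view x (hist r (T + 1))) (flipRun a b r T (T + 1) x) =
        ∏ x ∈ (Finset.univ.erase a).erase b, (σ x).1 (view x (hist r (T + 1))) (r (T + 1) x) := by
      refine Finset.prod_congr rfl fun x hx => ?_
      simp only [Finset.mem_erase, Finset.mem_univ, and_true] at hx
      rw [flipRun_of_ne hx.2 hx.1]
    rw [hp, ha, hb]
    have e1 := h.one (α := α) hn (Or.inl rfl)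
    have e2 := h.one (α := α) hn (Or.inr rfl)
    have hmul : ∀ X Y X' Y' P A B : ENNReal, X * A = X' * B → Y * A = Y' * B →
        X * (Y * P) * A ^ 2 = X' * (Y' * P) * B ^ 2 := by
      intro X Y X' Y' P A B h1 h2
      calc X * (Y * P) * A ^ 2 = (X * A) * (Y * A) * P := by ring
        _ = _ := by rw [h1, h2]; ring
    exact hmul _ _ _ _ _ _ _ e1 e2
  -- In steps `2` and `3` the moves of `a` and `b` are determined and have probability `1` in both
  -- runs; for the others local states and moves are the same.
  have h23 : ∀ t, t = T + 2 ∨ t = T + 3 →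
      stepProb σ (hist (flipRun a b r T) t) (flipRun a b r T t) = stepProb σ (hist r t) (r t) := by
    intro t ht
    refine Finset.prod_congr rfl fun x _ => ?_
    by_cases hx : x = a ∨ x = b
    · have hx' : σ x = recommended n m α x ∧ Honest m x r := by
        rcases hx with rfl | rfl
        · exact ⟨ha, h.left⟩
        · exact ⟨hb, h.right⟩
      have hflip : flipRun a b r T t x =
          protocolAction m x (view x (hist (flipRun a b r T) t)) false false := by
        rcases ht with rfl | rfl
        · rcases hx with rfl | rfl
          · exact h.two_left hn ..
          · exact h.two_right hn ..
        · exact h.three hn hx ..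
      have hcur : ∀ r' : Run n, Session r' T 3 → ∃ o₀ o₁ w,
          current (view x (hist r' t)) = o₀ :: o₁ :: w := by
        intro r' hs
        rcases ht with rfl | rfl
        · exact ⟨_, _, _, hs.current (by omega) x⟩
        · exact ⟨_, _, _, hs.current_three x⟩
      obtain ⟨o₀, o₁, w, hc⟩ := hcur _ h.session
      obtain ⟨o₀', o₁', w', hc'⟩ := hcur _ (h.session.flipRun (a := a) (b := b) (T := T))
      obtain ⟨c, d, hr⟩ := hx'.2 t
      rw [hx'.1, hflip, hr, recommended_apply_of_eq fun _ _ => protocolAction_congr hc' ..,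
        recommended_apply_of_eq fun _ _ => protocolAction_congr hc ..]
    · push Not at hx
      rw [view_flipRun (by omega) hx.1 hx.2, flipRun_of_ne hx.1 hx.2]
  rw [weight_hist_succ σ _ (T + 3), weight_hist_succ σ _ (T + 2), weight_hist_succ σ _ (T + 1),
    h23 _ (Or.inl rfl), h23 _ (Or.inr rfl), h0, weight_hist_succ σ r (T + 3),
    weight_hist_succ σ r (T + 2), weight_hist_succ σ r (T + 1)]
  calc _ = _root_.weight σ (hist r (T + 1)) *
          (stepProb σ (hist r (T + 1)) (flipRun a b r T (T + 1)) * coin α true ^ 2) *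
          stepProb σ (hist r (T + 2)) (r (T + 2)) *
            stepProb σ (hist r (T + 3)) (r (T + 3)) := by ring
    _ = _ := by rw [h1]; ring

end FlipWeight

/-! ### The success of a deviation is rare compared with its failure -/

section Deviation

variable {n m : ℕ} {α : unitInterval} {r r' : Run n} {a b l i j k : Fin n} {T T' t : ℕ}

theorem hist_congr (h : ∀ s < t, r s = r' s) : hist r t = hist r' t :=
  List.map_congr_left fun s hs => h s (List.mem_range.1 hs)

theorem Session.congr (hs : Session r T 0) (h : ∀ s < T, r s = r' s) : Session r' T 0 := by
  intro c hc
  obtain rfl : c = 0 := by omega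
  have := hs 0 le_rfl
  rw [Nat.add_zero, currentAt, hist_congr h] at this
  exact this

theorem Session.restarts_pred (hs : Session r (T + 1) 0) : restarts (r T) = true := by
  have : currentAt r (T + 1) = [] := hs 0 le_rfl
  rw [currentAt_succ] at this
  by_contra h
  simp [h] at this

/-- Every sharing but the first begins right after a restart, so there is only one last sharing. -/
theorem Session.eq_of_not_restarts (hs : Session r T 0) (hs' : Session r T' 0)
    (h : ∀ t, T ≤ t → restarts (r t) ≠ true) (h' : ∀ t, T' ≤ t → restarts (r t) ≠ true) :
    T = T' := by
  rcases lt_trichotomy T T' with hlt | rfl | hlt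
  · obtain ⟨T', rfl⟩ : ∃ t, T' = t + 1 := ⟨T' - 1, by omega⟩
    exact absurd hs'.restarts_pred (h T' (by omega))
  · rfl
  · obtain ⟨T, rfl⟩ : ∃ t, T = t + 1 := ⟨T - 1, by omega⟩
    exact absurd hs.restarts_pred (h' T (by omega))

theorem Fires.holds (hn : 3 ≤ n) (hm : 2 ≤ m) (hk : Honest m k r) (hs : Session r T 3)
    (hf : Fires r T k) (j : Fin n) {y : ℕ × Piece n} (hy : y ∈ bundle m (sharingAt r T) k) :
    Holds m j (view j (hist r (T + 4))) y.1 y.2 := by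
  by_cases hjk : j = k
  · subst hjk
    exact holds_mono ((hk.clean hf.2.2).holds_bundle hn hs hf.1 hy) (Nat.le_succ _)
  · refine (holds_view ..).2 (Or.inr ⟨T + 3, by omega, k, ?_⟩)
    rw [hf.pieces hn hm hk hs hjk]
    exact hy

/-- A player who asks for a restart although `p = 1` and it has not sent pieces has received the
pieces of some group. -/
theorem exists_bundle_of_asks (hj : Honest m j r) (hs : Session r T 4)
    (ha : (r (T + 4) j).asks = true)
    (hp : (if j.val < 3 then parityOf j (observe j (r (T + 1))) (observe j (r (T + 2)))
      else (observe j (r (T + 3))).bitFrom 0) = true)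
    (hc : j.val < 3 → coinOf j (observe j (r (T + 1))) = false) :
    ∃ k : Fin n, k ≠ j ∧ k.val < 3 ∧ ((r (T + 3) k).msgTo j).pieces ≠ ∅ ∧
      ((r (T + 3) k).msgTo j).pieces = bundle m (sharingAt r T) k := by
  obtain ⟨hcl, hw⟩ := hj.wantsRestart hs ha
  unfold wantsRestart at hw
  simp only [hp, if_true, decide_eq_true_eq] at hw
  have hpos : 0 < bundlesSeen j (observe j (r (T + 1))) (observe j (r (T + 2)))
      (observe j (r (T + 3))) := by rw [hw.2]; exact Nat.one_pos
  obtain ⟨k, hk⟩ := Finset.card_pos.1 hpos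
  simp only [Finset.mem_filter, Finset.mem_univ, true_and] at hk
  obtain ⟨hk3, hk⟩ := hk
  by_cases hkj : k = j
  · rw [if_pos hkj] at hk
    rw [hc (by rw [← hkj]; exact hk3)] at hk
    simp at hk
  · rw [if_neg hkj] at hk
    refine ⟨k, hkj, hk3, hk, ?_⟩
    have h1 := clean_hist.1 hcl (T + 3) (by omega) k hkj
    rw [hs.sharingAt (by omega), hs.current (by omega)] at h1
    have h2 : _ ∨ _ := h1.2
    exact (h2.resolve_left hk).2

/-- If everybody else asks for a restart in the flipped run, then they know the secret in the
original run. -/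
theorem Duo.knows (hn : 3 ≤ n) (hm : 2 ≤ m) (hmn : m ≤ n) (h : Duo m a b r T) (hai : a ≠ i)
    (hbi : b ≠ i) (hr : ∀ j, j ≠ i → Honest m j r) (hr' : ∀ j, j ≠ i → Honest m j r')
    (heq : ∀ t < T + 4, r' t = flipRun a b r T t)
    (hask : ∀ j, j ≠ i → (r' (T + 4) j).asks = true) :
    ∀ j, j ≠ i → Knows m j (view j (hist r (T + 4))) := by
  have h0 : Session r' T 0 := (h.session.flipRun.mono (Nat.zero_le 3)).congr fun s hs =>
    (heq s (by omega)).symm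
  have hs' : Session r' T 4 := (hr' a hai).session h0
  have hsh : sharingAt r' T = sharingAt r T :=
    sharingAt_congr fun s hs => by rw [heq s (by omega), restarts_flipRun]
  obtain ⟨l, hl⟩ : ∃ l : Fin n, l.val = (a.val + 2) % 3 := ⟨⟨(a.val + 2) % 3, by omega⟩, rfl⟩
  have hb3 := h.next
  have ha3 := h.fires_left.1
  have hl3 : ∀ k : Fin n, k.val < 3 → k ≠ a → k ≠ b → k = l := by
    intro k h1 h2 h3
    omega
  have hla : l ≠ a := by omega
  have hlb : l ≠ b := by omega
  -- After the flip `j` has `p = 1` and, if it is a leader, its own coin is `0`. It asks for a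
  -- restart, so it has received the pieces of one group, and these can come only from the third
  -- leader `l`, who may be `i`.
  have hlead : ∀ j, j ≠ i → j ≠ l → ((r (T + 3) l).msgTo j).pieces =
      bundle m (sharingAt r T) l := by
    intro j hj hjl
    have hpc : (if j.val < 3 then parityOf j (observe j (r' (T + 1))) (observe j (r' (T + 2)))
        else (observe j (r' (T + 3))).bitFrom 0) = true ∧
        (j.val < 3 → coinOf j (observe j (r' (T + 1))) = false) := by
      rw [heq _ (by omega), heq _ (by omega), heq _ (by omega)]
      by_cases hj3 : j.val < 3
      · rw [if_pos hj3]
        by_cases hja : j = a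
        · subst hja
          have h1 := h.fires_left.2.1
          rw [Bool.and_eq_true] at h1
          rw [h.parity_left hn, h.coin_left hn, h1.1, h1.2]
          exact ⟨rfl, fun _ => rfl⟩
        · obtain rfl : j = b := by
            by_contra hjb
            exact hjl (hl3 j hj3 hja hjb)
          have h1 := h.fires_right.2.1
          rw [Bool.and_eq_true] at h1
          rw [h.parity_right hn, h.coin_right hn, h1.1, h1.2]
          exact ⟨rfl, fun _ => rfl⟩
      · refine ⟨?_, fun h => absurd h hj3⟩
        rw [if_neg hj3]
        have hja : j ≠ a := by rintro rfl; exact hj3 ha3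
        -- A player who is not a leader relies on the reported bits. The one from `a` survives the
        -- flip, and the request for a restart shows that the other two agree with it.
        have h1 : (observe j (flipRun a b r T (T + 3))).bitFrom a.val = true := by
          rw [bitFrom_observe, bit_flipRun_three, h.left.msgTo_three hn hm h.session
            h.fires_left.2.2 hja, if_pos ⟨ha3, hj3⟩]
          have h1 := h.fires_left.2.1
          rw [Bool.and_eq_true] at h1
          exact h1.2
        have h2 := ((hr' j hj).wantsRestart hs' (hask j hj)).2
        unfold wantsRestart at h2
        simp only [hj3, if_false, false_or, decide_eq_true_eq] at h2
        rw [heq _ (by omega), heq _ (by omega), heq _ (by omega)] at h2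
        have h3 := h2.1
        have h4 : a.val = 0 ∨ a.val = 1 ∨ a.val = 2 := by omega
        rcases h4 with h4 | h4 | h4
        · rw [← h4]; exact h1
        · rw [← h3.1, ← h4]; exact h1
        · rw [← h3.2, ← h4]; exact h1
    obtain ⟨k, hkj, hk3, hne, hk⟩ := exists_bundle_of_asks (hr' j hj) hs' (hask j hj) hpc.1 hpc.2
    have hkab : ∀ x, x = a ∨ x = b → k ≠ x := by
      rintro x hx rfl
      rw [heq _ (by omega), flipRun_three hx, msgTo_mute] at hne
      exact hne rfl
    have hka := hkab a (Or.inl rfl)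
    have hkb := hkab b (Or.inr rfl)
    obtain rfl := hl3 k hk3 hka hkb
    rwa [heq _ (by omega), flipRun_of_ne hka hkb, hsh] at hk
  intro j hj
  refine knows_of_bundles hn hm hmn (s := sharingAt r T) fun k hk3 y hy => ?_
  by_cases hka : k = a
  · subst hka
    exact h.fires_left.holds hn hm h.left h.session j hy
  by_cases hkb : k = b
  · subst hkb
    exact h.fires_right.holds hn hm h.right h.session j hy
  obtain rfl := hl3 k hk3 hka hkb
  by_cases hjk : j = k
  · subst hjk
    have hf : Fires r T j := fires_of_pieces hn hm (hr j hj) h.session hla.symm (by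
      rw [hlead a hai hla.symm]
      exact bundle_ne_empty hm hk3 _)
    exact hf.holds hn hm (hr j hj) h.session j hy
  · refine (holds_view ..).2 (Or.inr ⟨T + 3, by omega, k, ?_⟩)
    rw [hlead j hj hjk]
    exact hy

/-- If somebody else does not ask for a restart in the flipped run, then there are no more restarts
and the deviator does not learn the secret. -/
theorem Duo.not_learns (hn : 3 ≤ n) (hm : 2 ≤ m) (hmn : m ≤ n) (h : Duo m a b r T)
    (hrun : IsRun m r') (hr' : ∀ j, j ≠ i → Honest m j r')
    (heq : ∀ t < T + 4, r' t = flipRun a b r T t) (hj : j ≠ i)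
    (hask : (r' (T + 4) j).asks ≠ true) :
    Session r' T 0 ∧ (∀ t, T ≤ t → restarts (r' t) ≠ true) ∧ ¬ Learns m r' i := by
  have h0 : Session r' T 0 := (h.session.flipRun.mono (Nat.zero_le 3)).congr fun s hs =>
    (heq s (by omega)).symm
  have hres : ∀ t, T ≤ t → restarts (r' t) ≠ true := fun t ht =>
    (hr' j hj).not_restarts hrun ((hr' j hj).session h0) hask ht
  refine ⟨h0, hres, fun hl => ?_⟩
  obtain ⟨T', a', b', hab', ha', hb', hs', hfa, hfb⟩ :=
    exists_fires_of_learns hn hm hmn hrun hr' hl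
  have h4 : Session r' T' 4 := (hr' a' ha').session (hs'.mono (Nat.zero_le 3))
  have hna := Fires.not_asks hn hm (hr' a' ha') (hr' b' hb') hab' h4 hfa hfb
  -- Two firing leaders end the sequence of sharings too, so both sharings are the last one. There
  -- `a` and `b` do not fire after the flip, and a single leader is left.
  obtain rfl : T = T' := h0.eq_of_not_restarts (hs'.mono (Nat.zero_le 3)) hres fun t ht =>
    (hr' a' ha').not_restarts hrun h4 hna ht
  have hno : ∀ x, Fires r' T x → x ≠ a ∧ x ≠ b := by
    intro x hx
    have h1 := hx.2.1
    rw [Bool.and_eq_true, heq _ (by omega)] at h1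
    constructor
    · rintro rfl
      have h2 := h.fires_left.2.1
      rw [Bool.and_eq_true] at h2
      rw [h.coin_left hn, h2.1] at h1
      simp at h1
    · rintro rfl
      have h2 := h.fires_right.2.1
      rw [Bool.and_eq_true] at h2
      rw [h.coin_right hn, h2.1] at h1
      simp at h1
  have h1 := hno _ hfa
  have h2 := hno _ hfb
  have h3 := h.next
  have h5 := h.fires_left.1
  have h6 := hfa.1
  have h7 := hfb.1
  omega

theorem hist_eq_iff : hist r t = hist r' t ↔ ∀ s < t, r s = r' s := by
  refine ⟨fun h s hs => ?_, hist_congr⟩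
  have h1 := hist_getElem r hs
  simp only [h] at h1
  rw [← h1, hist_getElem r' hs]

/-- Negations can be undone. Muting cannot, but in step `3` the moves of `a` and `b` are functions
of the history. -/
theorem Duo.injective (h : Duo m a b r T) (h' : Duo m a b r' T)
    (heq : ∀ t < T + 4, flipRun a b r T t = flipRun a b r' T t) : ∀ t < T + 4, r t = r' t := by
  have hneg : ∀ x (p q : Move n), p.negTo x = q.negTo x → p = q := by
    intro x p q hpq
    rw [← negTo_negTo x p, hpq, negTo_negTo]
  have hother : ∀ t < T + 4, ∀ j, j ≠ a → j ≠ b → r t j = r' t j := by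
    intro t ht j ha hb
    have := congrFun (heq t ht) j
    rwa [flipRun_of_ne ha hb, flipRun_of_ne ha hb] at this
  have h3 : ∀ t < T + 3, r t = r' t := by
    intro t ht
    by_cases h1 : t ≤ T
    · have := heq t (by omega)
      rwa [flipRun_early h1, flipRun_early h1] at this
    funext j
    have hj := congrFun (heq t (by omega)) j
    by_cases ha : j = a
    · subst ha
      obtain rfl | rfl : t = T + 1 ∨ t = T + 2 := by omega
      · rw [flipRun_one_left, flipRun_one_left] at hj
        exact hneg _ _ _ hj
      · rwa [flipRun_two_left h.ne, flipRun_two_left h.ne] at hj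
    by_cases hb : j = b
    · subst hb
      obtain rfl | rfl : t = T + 1 ∨ t = T + 2 := by omega
      · rw [flipRun_one_right h.ne, flipRun_one_right h.ne] at hj
        exact hneg _ _ _ hj
      · rw [flipRun_two_right, flipRun_two_right] at hj
        exact hneg _ _ _ hj
    exact hother t (by omega) j ha hb
  intro t ht
  by_cases h1 : t < T + 3
  · exact h3 t h1
  obtain rfl : t = T + 3 := by omega
  have hh : hist r (T + 3) = hist r' (T + 3) := hist_congr h3
  have hact : ∀ j, Honest m j r → Honest m j r' → r (T + 3) j = r' (T + 3) j := by
    intro j hj hj'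
    obtain ⟨c, d, hr⟩ := hj (T + 3)
    obtain ⟨c', d', hr'⟩ := hj' (T + 3)
    rw [hr, hr', hh]
    exact protocolAction_congr (h'.session.current_three j) ..
  funext j
  by_cases ha : j = a
  · subst ha; exact hact _ h.left h'.left
  by_cases hb : j = b
  · subst hb; exact hact _ h.right h'.right
  exact hother _ (by omega) j ha hb

/-- The histories after which `i` might have gained from a deviation: the leaders `a` and `a⁺` have
sent the pieces of their groups, but somebody else does not know the secret. -/
def gains (m : ℕ) (σ : ∀ j, Strategy n m j) (i a : Fin n) : Set (List (Profile n)) :=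
  {h | ∃ r T b, Positive σ r ∧ Duo m a b r T ∧ b ≠ i ∧
    (∃ j, j ≠ i ∧ ¬ Knows m j (view j (hist r (T + 4)))) ∧ h = hist r (T + 4)}

/-- Each gainful history is mapped to its flipped history, whose weight is known from `Duo.weight`.
After flipped histories `i` almost surely fails, and different ones almost surely exclude each
other, even if they have different lengths. -/
theorem tsum_gains_le (hn : 3 ≤ n) (hm : 2 ≤ m) (hmn : m ≤ n) {σ : ∀ j, Strategy n m j}
    (hσ : ∀ j, j ≠ i → σ j = recommended n m α j) (ha : a ≠ i) :
    (∑' h : gains m σ i a, weight σ h.1) * coin α false ^ 2 ≤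
      runMeasure σ {r | ¬ Learns m r i} * coin α true ^ 2 := by
  classical
  choose R T b hpos hduo hbi hkn hh using fun h : gains m σ i a => h.2
  have hhon : ∀ {r}, Positive σ r → ∀ j, j ≠ i → Honest m j r :=
    fun hr j hj => honest_of_positive (hσ j hj) hr
  set C : gains m σ i a → Set (Run n) := fun h =>
    {r | hist r (T h + 4) = hist (flipRun a (b h) (R h) (T h)) (T h + 4)} with hC
  have hCm : ∀ h, MeasurableSet (C h) := fun h => measurableSet_hist _ {_}
  have hCw : ∀ h, runMeasure σ (C h) * coin α true ^ 2 = weight σ h.1 * coin α false ^ 2 := by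
    intro h
    rw [hC, weight_eq σ (hist_length _ _), (hduo h).weight hn (hσ a ha) (hσ _ (hbi h)), ← hh h]
  have hCp : ∀ h r, Positive σ r → r ∈ C h → Session r (T h) 0 ∧
      (∀ t, T h ≤ t → restarts (r t) ≠ true) ∧ ¬ Learns m r i := by
    intro h r hr hrC
    have heq := hist_eq_iff.1 hrC
    obtain ⟨j, hj, hnk⟩ := hkn h
    obtain ⟨j', hj', hask⟩ : ∃ j, j ≠ i ∧ (r (T h + 4) j).asks ≠ true := by
      by_contra hcon
      push Not at hcon
      exact hnk ((hduo h).knows hn hm hmn ha (hbi h) (hhon (hpos h)) (hhon hr) heq hcon j hj)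
    exact (hduo h).not_learns hn hm hmn hr.isRun (hhon hr) heq hj' hask
  -- A run that passes through two flipped histories has a unique last sharing, so `T` and then `b`
  -- are the same, and the flip is injective.
  have hdisj : Pairwise (Function.onFun (AEDisjoint (runMeasure σ)) C) := by
    intro h h' hne
    refine measure_mono_null_ae (t := ∅) ?_ measure_empty
    filter_upwards [ae_positive σ] with r hr hrC
    exfalso
    obtain ⟨h1, h2⟩ : r ∈ C h ∧ r ∈ C h' := hrC
    obtain ⟨s1, n1, -⟩ := hCp h r hr h1
    obtain ⟨s2, n2, -⟩ := hCp h' r hr h2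
    have hT : T h = T h' := s1.eq_of_not_restarts s2 n1 n2
    have hb : b h = b h' := Fin.ext ((hduo h).next.trans (hduo h').next.symm)
    have e1 := hist_eq_iff.1 h1
    have e2 := hist_eq_iff.1 h2
    have d1 := hduo h
    have d2 := hduo h'
    rw [← hT, ← hb] at e2 d2
    have := d1.injective d2 fun t ht => (e1 t ht).symm.trans (e2 t ht)
    apply hne
    apply Subtype.ext
    rw [hh h, hh h', ← hT, hist_congr this]
  rw [← ENNReal.tsum_mul_right]
  simp only [← hCw]
  rw [ENNReal.tsum_mul_right]
  gcongr
  refine (tsum_meas_le_meas_iUnion_of_disjoint₀ (runMeasure σ)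
    (fun h => (hCm h).nullMeasurableSet) hdisj).trans (measure_mono_ae ?_)
  filter_upwards [ae_positive σ] with r hr hrC
  obtain ⟨h, hrh⟩ := Set.mem_iUnion.1 hrC
  exact (hCp h r hr hrh).2.2

/-- The probability that `i` learns the secret and somebody else does not. -/
theorem measure_gain_le (hn : 3 ≤ n) (hm : 2 ≤ m) (hmn : m ≤ n) {σ : ∀ j, Strategy n m j}
    (hσ : ∀ j, j ≠ i → σ j = recommended n m α j) :
    runMeasure σ {r | Learns m r i ∧ ∃ j, ¬ Learns m r j} * coin α false ^ 2 ≤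
      n * (runMeasure σ {r | ¬ Learns m r i} * coin α true ^ 2) := by
  have hsub : runMeasure σ {r | Learns m r i ∧ ∃ j, ¬ Learns m r j} ≤
      ∑ a ∈ Finset.univ.erase i, ∑' h : gains m σ i a, weight σ h.1 := by
    have h1 : {r | Learns m r i ∧ ∃ j, ¬ Learns m r j} ≤ᵐ[runMeasure σ]
        ⋃ a ∈ Finset.univ.erase i, ⋃ h : gains m σ i a, {r | hist r h.1.length = h.1} := by
      filter_upwards [ae_positive σ] with r hr hrl
      obtain ⟨hl, j, hj⟩ : Learns m r i ∧ ∃ j, ¬ Learns m r j := hrl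
      have hhon : ∀ j, j ≠ i → Honest m j r := fun j hj => honest_of_positive (hσ j hj) hr
      have hji : j ≠ i := by rintro rfl; exact hj hl
      obtain ⟨T, a, b, hab, ha, hb, hs, hfa, hfb⟩ :=
        exists_fires_of_learns hn hm hmn hr.isRun hhon hl
      have key : ∀ a b, a ≠ i → Duo m a b r T → b ≠ i →
          r ∈ ⋃ a ∈ Finset.univ.erase i, ⋃ h : gains m σ i a, {r | hist r h.1.length = h.1} := by
        intro a b ha hd hb
        simp only [Set.mem_iUnion]
        refine ⟨a, Finset.mem_erase.2 ⟨ha, Finset.mem_univ a⟩, ⟨hist r (T + 4), r, T, b, hr, hd, hb,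
          ⟨j, hji, fun hk => hj ⟨_, hk⟩⟩, rfl⟩, ?_⟩
        change hist r (hist r (T + 4)).length = hist r (T + 4)
        rw [hist_length]
      have h1 := hfa.1
      have h2 := hfb.1
      -- Any two of the three leaders are cyclically adjacent, in one order or the other.
      obtain h3 | h3 : b.val = (a.val + 1) % 3 ∨ a.val = (b.val + 1) % 3 := by omega
      · exact key a b ha ⟨h3, hhon a ha, hhon b hb, hs, hfa, hfb⟩ hb
      · exact key b a hb ⟨h3, hhon b hb, hhon a ha, hs, hfb, hfa⟩ ha
    refine (measure_mono_ae h1).trans ((measure_biUnion_finset_le _ _).trans ?_)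
    exact Finset.sum_le_sum fun a _ => measure_iUnion_le _
  calc _ ≤ (∑ a ∈ Finset.univ.erase i, ∑' h : gains m σ i a, weight σ h.1) *
        coin α false ^ 2 := by gcongr
    _ = ∑ a ∈ Finset.univ.erase i, (∑' h : gains m σ i a, weight σ h.1) * coin α false ^ 2 :=
        Finset.sum_mul ..
    _ ≤ ∑ a ∈ Finset.univ.erase i, runMeasure σ {r | ¬ Learns m r i} * coin α true ^ 2 :=
        Finset.sum_le_sum fun a ha => tsum_gains_le hn hm hmn hσ (Finset.ne_of_mem_erase ha)
    _ ≤ ∑ a : Fin n, runMeasure σ {r | ¬ Learns m r i} * coin α true ^ 2 :=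
        Finset.sum_le_sum_of_subset (Finset.erase_subset _ _)
    _ = _ := by simp

end Deviation

/-! ### The choice of `α` and the Nash property -/

section Equilibrium

variable {n m : ℕ} {α : unitInterval} {u : Fin n → Run n → ℝ}

theorem exists_pos_le {ι : Type*} [Finite ι] {f : ι → ℝ} (hf : ∀ x, 0 < f x) :
    ∃ δ > 0, ∀ x, δ ≤ f x := by
  cases isEmpty_or_nonempty ι
  · exact ⟨1, one_pos, fun x => isEmptyElim x⟩
  · obtain ⟨x, hx⟩ := Finite.exists_min f
    exact ⟨f x, hf x, hx⟩

theorem coin_true : (coin α true).toReal = α := by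
  rw [coin, PMF.ofFintype_apply, if_pos rfl, ENNReal.toReal_ofReal α.2.1]

theorem coin_false : (coin α false).toReal = 1 - α := by
  rw [coin, PMF.ofFintype_apply, if_neg (by simp),
    ENNReal.toReal_ofReal (by linarith [α.2.2])]

/-- A deviation does not pay if the gain in the rare case that it succeeds does not make up for the
loss in the case that it fails. -/
theorem expectedUtility_deviation_le (hn : 3 ≤ n) (hm : 2 ≤ m) (hmn : m ≤ n) {i : Fin n}
    {w : Fin n → Set (Fin n) → ℝ} (hw : ∀ i r, IsRun m r → u i r = w i (learners m r))
    {M δ : ℝ} (hM : ∀ S, w i S ≤ M)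
    (hδ : ∀ r, IsRun m r → ¬ Learns m r i → w i (learners m r) ≤ w i Set.univ - δ)
    (hα : (α : ℝ) ≤ 1 / 2) (hα' : 4 * (n * (M - w i Set.univ)) * α ≤ δ) (τ : Strategy n m i) :
    expectedUtility m u i (Function.update (recommended n m α) i τ) ≤ w i Set.univ := by
  set σ := Function.update (recommended n m α) i τ with hσ
  have hgain := measure_gain_le (i := i) (σ := σ) (α := α) hn hm hmn fun j hj => by
    rw [hσ, Function.update_of_ne hj]
  set N : Set (Run n) := {r | ¬ Learns m r i} with hN
  set B : Set (Run n) := {r | Learns m r i ∧ ∃ j, ¬ Learns m r j} with hB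
  have hNm : MeasurableSet N := (measurableSet_learns i).compl
  have hBm : MeasurableSet B := by
    refine (measurableSet_learns i).inter ?_
    have : {r : Run n | ∃ j, ¬ Learns m r j} = ⋃ j, {r | Learns m r j}ᶜ := by
      ext r
      simp
    change MeasurableSet {r : Run n | ∃ j, ¬ Learns m r j}
    rw [this]
    exact MeasurableSet.iUnion fun j => (measurableSet_learns j).compl
  have hreal : (runMeasure σ).real B * (1 - α) ^ 2 ≤ n * ((runMeasure σ).real N * (α : ℝ) ^ 2) := by
    have h1 := ENNReal.toReal_mono (by finiteness [PMF.apply_ne_top (coin α) true]) hgain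
    simpa [ENNReal.toReal_mul, coin_true, coin_false, Measure.real] using h1
  rw [expectedUtility_eq hw]
  -- The gain over honest play is at most `M - w i Set.univ` if `i` learns and somebody else does
  -- not, there is none if all learn, and `i` loses at least `δ` if it does not learn.
  have hle : ∫ r, w i (learners m r) ∂runMeasure σ ≤
      ∫ r, (w i Set.univ + B.indicator (fun _ => M - w i Set.univ) r) -
        N.indicator (fun _ => δ) r ∂runMeasure σ := by
    refine integral_mono_ae (integrable_value _ _) ?_ ?_
    · exact ((integrable_const _).add ((integrable_const _).indicator hBm)).sub
        ((integrable_const _).indicator hNm)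
    · filter_upwards [ae_positive σ] with r hr
      by_cases hl : Learns m r i
      · have h1 : r ∉ N := fun h => h hl
        by_cases hall : ∃ j, ¬ Learns m r j
        · have h2 : r ∈ B := ⟨hl, hall⟩
          simpa [h1, h2] using hM _
        · have h2 : r ∉ B := fun h => hall h.2
          push Not at hall
          have h3 : learners m r = Set.univ := Set.eq_univ_of_forall hall
          simp [h1, h2, h3]
      · have h1 : r ∈ N := hl
        have h2 : r ∉ B := fun h => hl h.1
        simpa [h1, h2] using hδ r hr.isRun hl
  refine hle.trans ?_
  rw [integral_sub ((integrable_const _).add ((integrable_const _).indicator hBm))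
    ((integrable_const _).indicator hNm), integral_add (integrable_const _)
    ((integrable_const _).indicator hBm), integral_indicator hBm, integral_indicator hNm]
  simp only [integral_const, probReal_univ, smul_eq_mul, measureReal_restrict_apply_univ]
  set x := (runMeasure σ).real N with hx
  set y := (runMeasure σ).real B with hy
  have hx0 : 0 ≤ x := measureReal_nonneg
  have hy0 : 0 ≤ y := measureReal_nonneg
  have hMb : 0 ≤ M - w i Set.univ := sub_nonneg.2 (hM _)
  have hα0 : (0 : ℝ) ≤ α := α.2.1
  -- From `α ≤ 1 / 2` come `(1 - α) ^ 2 ≥ 1 / 4` and the crude bound `α ^ 2 ≤ α`. This makes the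
  -- condition on `α` linear.
  have h1 : y ≤ 4 * n * (x * α) := by
    have h2 : y * (1 / 4) ≤ y * (1 - α) ^ 2 := by
      refine mul_le_mul_of_nonneg_left ?_ hy0
      nlinarith
    have h3 : (n : ℝ) * (x * (α : ℝ) ^ 2) ≤ n * (x * α) := by
      refine mul_le_mul_of_nonneg_left (mul_le_mul_of_nonneg_left ?_ hx0) (Nat.cast_nonneg n)
      nlinarith
    linarith
  have h4 := mul_le_mul_of_nonneg_right h1 hMb
  have h5 := mul_le_mul_of_nonneg_left hα' hx0
  nlinarith

theorem exists_isNash (hn : 3 ≤ n) (hm : 2 ≤ m) (hmn : m ≤ n) (hU1 : U1 m u) (hU2 : U2 m u)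
    (hall : ∀ α : unitInterval, 0 < (α : ℝ) →
      ∀ᵐ r ∂runMeasure (recommended n m α), ∀ i, Learns m r i) :
    ∃ αStar : ℝ, 0 < αStar ∧ ∀ α : unitInterval, 0 < (α : ℝ) → (α : ℝ) < αStar →
      IsNash (S := Strategy n m) (expectedUtility m u) (recommended n m α) := by
  obtain ⟨w, hw⟩ := exists_value hU1
  -- Honest play with `α = 1` provides a legal run in which everybody learns, as needed to apply U2.
  obtain ⟨r₁, hrun₁, hr₁⟩ : ∃ r, IsRun m r ∧ learners m r = Set.univ := by
    obtain ⟨r, h1, h2⟩ := ((ae_positive _).and (hall 1 (by simp))).exists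
    exact ⟨r, h1.isRun, Set.eq_univ_of_forall h2⟩
  have hδ : ∀ i, ∃ δ > 0, ∀ r, IsRun m r → ¬ Learns m r i →
      w i (learners m r) ≤ w i Set.univ - δ := by
    intro i
    obtain ⟨δ, h1, h2⟩ := exists_pos_le
      (ι := {S : Set (Fin n) // ∃ r, IsRun m r ∧ ¬ Learns m r i ∧ learners m r = S})
      (f := fun S => w i Set.univ - w i S.1) (by
        rintro ⟨_, r, hr, hl, rfl⟩
        have h3 := hU2 i r₁ r hrun₁ hr (by change i ∈ learners m r₁; rw [hr₁]; trivial) hl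
        rw [hw i _ hrun₁, hw i _ hr, hr₁] at h3
        exact sub_pos.2 h3)
    refine ⟨δ, h1, fun r hr hl => ?_⟩
    have := h2 ⟨_, r, hr, hl, rfl⟩
    dsimp only at this
    linarith
  choose δ hδ0 hδ using hδ
  have hM : ∀ i, ∃ M, ∀ S, w i S ≤ M := fun i => by
    obtain ⟨S, hS⟩ := Finite.exists_max (w i)
    exact ⟨_, hS⟩
  choose M hM using hM
  -- The summand `1` keeps the denominator positive when there is nothing to gain.
  have hpos : ∀ i, 0 < 4 * (n * (M i - w i Set.univ) + 1) := fun i => by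
    have := mul_nonneg (Nat.cast_nonneg (α := ℝ) n) (sub_nonneg.2 (hM i Set.univ))
    linarith
  obtain ⟨ε, hε, hεle⟩ := exists_pos_le (f := fun i : Fin n =>
    δ i / (4 * (n * (M i - w i Set.univ) + 1))) fun i => div_pos (hδ0 i) (hpos i)
  refine ⟨min (1 / 2) ε, lt_min (by norm_num) hε, fun α hα0 hα i τ => ?_⟩
  have hrec : expectedUtility m u i (recommended n m α) = w i Set.univ := by
    rw [expectedUtility_eq hw]
    have : ∀ᵐ r ∂runMeasure (recommended n m α), w i (learners m r) = w i Set.univ := by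
      filter_upwards [hall α hα0] with r hr
      rw [show learners m r = Set.univ from Set.eq_univ_of_forall hr]
    rw [integral_congr_ae this]
    simp
  rw [hrec]
  refine expectedUtility_deviation_le hn hm hmn hw (hM i) (hδ i)
    (hα.le.trans (min_le_left _ _)) ?_ τ
  have h1 : (α : ℝ) ≤ δ i / (4 * (n * (M i - w i Set.univ) + 1)) :=
    (hα.le.trans (min_le_right _ _)).trans (hεle i)
  rw [le_div_iff₀ (hpos i)] at h1
  linarith

end Equilibrium

/-! ### Play in which everybody follows the protocol -/

section HonestPlay

variable {n m : ℕ} {α : unitInterval} {r : Run n} {i j k : Fin n} {T t : ℕ}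

/-- The play has followed the protocol and a sharing begins. -/
def Fresh (m : ℕ) (h : List (Profile n)) : Prop :=
  ∀ j, current (view j h) = [] ∧ Clean m j (view j h) ∧ ∀ o ∈ view j h, o.own ≠ .halt

/-- All leaders throw `true` in the sharing that begins in round `T`. -/
def AllCoins (r : Run n) (T : ℕ) : Prop :=
  ∀ j : Fin n, j.val < 3 → coinOf j (observe j (r (T + 1))) = true

/-- All players have followed the protocol and nobody has stopped. -/
def Regular (m : ℕ) (r : Run n) (t : ℕ) : Prop :=
  ∀ j, Clean m j (view j (hist r t)) ∧ ∀ s < t, r s j ≠ .halt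

theorem fresh_nil : Fresh (n := n) m [] :=
  fun _ => ⟨rfl, clean_nil, by simp [view]⟩

theorem fresh_hist (hn : 3 ≤ n) : Fresh m (hist r T) ↔ Session r T 0 ∧ Regular m r T := by
  have hs : (∀ j : Fin n, current (view j (hist r T)) = []) ↔ Session r T 0 := by
    constructor
    · intro h c hc
      obtain rfl : c = 0 := by omega
      have := h ⟨0, by omega⟩
      rw [current_view, List.map_eq_nil_iff] at this
      exact this
    · exact fun h j => h.current (c' := 0) le_rfl j
  rw [← hs]
  unfold Fresh Regular
  simp only [forall_own_hist, forall_and]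

theorem Honest.ne_halt (hj : Honest m j r) (hc : Clean m j (view j (hist r t)))
    (ha : ∀ s < t, r s j ≠ .halt) (hl : (currentAt r t).length ≤ 3) : r t j ≠ .halt := by
  obtain ⟨c, b, h⟩ := hj t
  rw [← length_current (i := j)] at hl
  have ha' := forall_own_hist.2 ha
  rw [h]
  rcases length_cases (current (view j (hist r t))) with hv | ⟨o₀, hv⟩ | ⟨o₀, o₁, hv⟩ |
    ⟨o₀, o₁, o₂, hv⟩ | ⟨o₀, o₁, o₂, o₃, hv⟩ | hv
  · rw [protocolAction_zero hc hv, sendAll_eq ha']; simp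
  · rw [protocolAction_one hc hv, sendAll_eq ha']; simp
  · rw [protocolAction_two hc hv, sendAll_eq ha']; simp
  · rw [protocolAction_three hc hv, sendAll_eq ha']; simp
  · simp [hv] at hl
  · omega

theorem Regular.succ (h : Regular m r t) (hne : ∀ j, r t j ≠ .halt)
    (hex : ∀ j, Expected m j (sharingAt r t) (current (view j (hist r t))) (observe j (r t))) :
    Regular m r (t + 1) := by
  intro j
  refine ⟨clean_hist.2 fun s hs => ?_, fun s hs => ?_⟩
  · rcases (Nat.lt_succ_iff.1 hs).eq_or_lt with rfl | hs
    · exact hex j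
    · exact clean_hist.1 (h j).1 s hs
  · rcases (Nat.lt_succ_iff.1 hs).eq_or_lt with rfl | hs
    · exact hne j
    · exact (h j).2 s hs

theorem Regular.ne_halt (hr : ∀ j, Honest m j r) {c : ℕ} (hs : Session r T c) (hc : c ≤ 3)
    (h : Regular m r (T + c)) (j : Fin n) : r (T + c) j ≠ .halt := by
  refine (hr j).ne_halt (h j).1 (h j).2 ?_
  rw [hs c le_rfl, hist_length]
  exact hc

/-- In each of the steps `0` to `3` the messages of honest players pass the checks of honest
players, so nobody has a reason to halt before step `4`. -/
theorem regular_of_fresh (hn : 3 ≤ n) (hm : 2 ≤ m) (hr : ∀ j, Honest m j r)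
    (h : Fresh m (hist r T)) : Session r T 4 ∧ Regular m r (T + 4) := by
  rw [fresh_hist hn] at h
  have hs : Session r T 4 := (hr ⟨0, by omega⟩).session h.1
  refine ⟨hs, ?_⟩
  have h1 : Regular m r (T + 1) := by
    refine h.2.succ (Regular.ne_halt hr h.1 (by omega) h.2) fun j => ?_
    have hcur : current (view j (hist r T)) = [] := hs.current (c' := 0) (by omega) j
    rw [hcur]
    exact fun k _ => (hr k).msgTo_zero h.1 j
  have h2 : Regular m r (T + 2) := by
    have hne := Regular.ne_halt hr (hs.mono (by omega)) (by omega) h1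
    refine h1.succ hne fun j => ?_
    rw [hs.current (by omega), hs.sharingAt (by omega)]
    intro k hk
    obtain ⟨c, b, -, hmsg⟩ := (hr k).msgTo_one (hs.mono (by omega)) (hne k)
    change (((r (T + 1) k).msgTo j).bit.isSome = true ↔ j.val < 3 ∧ k.val < 3) ∧
      ((r (T + 1) k).msgTo j).pieces = dealt m (sharingAt r T) k j
    rw [hmsg j hk.symm]
    refine ⟨?_, rfl⟩
    split_ifs with e1 e2
    · simp; omega
    · simp; omega
    · simp; omega
  have h3 : Regular m r (T + 3) := by
    have hne := Regular.ne_halt hr (hs.mono (by omega)) (by omega) h2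
    refine h2.succ hne fun j => ?_
    rw [hs.current (by omega), hs.sharingAt (by omega)]
    intro k hk
    change (((r (T + 2) k).msgTo j).bit.isSome = true ↔
        j.val < 3 ∧ k.val < 3 ∧ k.val = (j.val + 1) % 3) ∧
      ((r (T + 2) k).msgTo j).pieces =
        if j.val < 3 ∧ k.val % 3 = j.val then contribution m (sharingAt r T) k else ∅
    rw [(hr k).msgTo_two hn (hs.mono (by omega)) (hne k) hk.symm]
    constructor
    · dsimp only
      split_ifs with e1
      · simp; omega
      · simp; omega
    · dsimp only
      congr 1
      rw [eq_iff_iff]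
      omega
  have hne := Regular.ne_halt hr (hs.mono (by omega)) (by omega) h3
  refine h3.succ hne fun j => ?_
  rw [hs.current (by omega), hs.sharingAt (by omega)]
  intro k hk
  change (((r (T + 3) k).msgTo j).bit.isSome = true ↔ ¬ j.val < 3 ∧ k.val < 3) ∧
    (((r (T + 3) k).msgTo j).pieces = ∅ ∨
      (k.val < 3 ∧ ((r (T + 3) k).msgTo j).pieces = bundle m (sharingAt r T) k))
  rw [(hr k).msgTo_three hn hm (hs.mono (by omega)) (hne k) hk.symm]
  constructor
  · dsimp only
    split_ifs with e1
    · simp; omega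
    · simp; omega
  · dsimp only
    split_ifs with e1
    · exact Or.inr ⟨e1.1, rfl⟩
    · exact Or.inl rfl

/-- The bit `p` in the sharing that begins in round `T`. -/
def parityAt (r : Run n) (T : ℕ) : Bool :=
  (Finset.univ.filter fun k : Fin n =>
    k.val < 3 ∧ coinOf k (observe k (r (T + 1))) = true).card % 2 = 1

theorem filter_leaders {a b c : Fin n} (ha : a.val = 0) (hb : b.val = 1) (hc : c.val = 2)
    (P : Fin n → Prop) [DecidablePred P] :
    (Finset.univ.filter fun k : Fin n => k.val < 3 ∧ P k) =
      (if P a then {a} else ∅) ∪ (if P b then {b} else ∅) ∪ (if P c then {c} else ∅) := by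
  ext k
  have h : k.val < 3 ↔ k = a ∨ k = b ∨ k = c := by omega
  simp only [Finset.mem_filter, Finset.mem_univ, true_and, Finset.mem_union, h]
  constructor
  · rintro ⟨rfl | rfl | rfl, hP⟩ <;> simp [hP]
  · rintro ((hk | hk) | hk) <;> split_ifs at hk with hP <;> simp at hk <;> subst hk <;> simp [hP]

theorem card_leaders {a b c : Fin n} (ha : a.val = 0) (hb : b.val = 1) (hc : c.val = 2)
    (P : Fin n → Prop) [DecidablePred P] :
    (Finset.univ.filter fun k : Fin n => k.val < 3 ∧ P k).card =
      (if P a then 1 else 0) + (if P b then 1 else 0) + (if P c then 1 else 0) := by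
  have hab : a ≠ b := by omega
  have hac : a ≠ c := by omega
  have hbc : b ≠ c := by omega
  rw [filter_leaders ha hb hc]
  split_ifs <;> simp [hab, hac, hbc, Finset.card_insert_of_notMem]

/-- The part `c_(z,-)` that `z` sent to `y` masks the coin of `y` in step `2`. It cancels against
the part `c_(z,+)` that `z` sent to `j`, leaving the sum of the three coins. -/
theorem parityOf_eq (hn : 3 ≤ n) (hr : ∀ j, Honest m j r) (hs : Session r T 4)
    (hreg : Regular m r (T + 4)) (hj : j.val < 3) :
    parityOf j (observe j (r (T + 1))) (observe j (r (T + 2))) = parityAt r T := by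
  obtain ⟨y, hy⟩ : ∃ y : Fin n, y.val = (j.val + 1) % 3 := ⟨⟨(j.val + 1) % 3, by omega⟩, rfl⟩
  obtain ⟨z, hz⟩ : ∃ z : Fin n, z.val = (j.val + 2) % 3 := ⟨⟨(j.val + 2) % 3, by omega⟩, rfl⟩
  have h1 : bitAt r (T + 2) y j = xor (bitAt r (T + 1) z y) (coinOf y (observe y (r (T + 1)))) := by
    have hz' : (y.val + 1) % 3 = z.val := by omega
    rw [bitAt, (hr y).msgTo_two hn (hs.mono (by omega)) ((hreg y).2 _ (by omega)) (by omega),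
      if_pos ⟨by omega, by omega⟩, hz', bitFrom_observe]
    rfl
  have h2 : coinOf z (observe z (r (T + 1))) = xor (bitAt r (T + 1) z j) (bitAt r (T + 1) z y) :=
    coinOf_observe (by omega) (by omega)
  have h3 : parityOf j (observe j (r (T + 1))) (observe j (r (T + 2))) =
      xor (xor (coinOf z (observe z (r (T + 1)))) (coinOf y (observe y (r (T + 1)))))
        (coinOf j (observe j (r (T + 1)))) := by
    rw [parityOf_observe hy hz, h1, h2]
    cases bitAt r (T + 1) z j <;> cases bitAt r (T + 1) z y <;> simp
  rw [h3, parityAt]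
  obtain h | h | h : j.val = 0 ∨ j.val = 1 ∨ j.val = 2 := by omega
  · rw [card_leaders (a := j) (b := y) (c := z) h (by omega) (by omega)]
    cases coinOf z (observe z (r (T + 1))) <;> cases coinOf y (observe y (r (T + 1))) <;>
      cases coinOf j (observe j (r (T + 1))) <;> rfl
  · rw [card_leaders (a := z) (b := j) (c := y) (by omega) h (by omega)]
    cases coinOf z (observe z (r (T + 1))) <;> cases coinOf y (observe y (r (T + 1))) <;>
      cases coinOf j (observe j (r (T + 1))) <;> rfl
  · rw [card_leaders (a := y) (b := z) (c := j) (by omega) (by omega) h]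
    cases coinOf z (observe z (r (T + 1))) <;> cases coinOf y (observe y (r (T + 1))) <;>
      cases coinOf j (observe j (r (T + 1))) <;> rfl

theorem bundlesSeen_eq (hn : 3 ≤ n) (hm : 2 ≤ m) (hr : ∀ j, Honest m j r) (hs : Session r T 4)
    (hreg : Regular m r (T + 4)) (j : Fin n) :
    bundlesSeen j (observe j (r (T + 1))) (observe j (r (T + 2))) (observe j (r (T + 3))) =
      (Finset.univ.filter fun k : Fin n => k.val < 3 ∧
        (coinOf k (observe k (r (T + 1))) && parityAt r T) = true).card := by
  unfold bundlesSeen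
  congr 1
  ext k
  simp only [Finset.mem_filter, Finset.mem_univ, true_and]
  refine and_congr_right fun hk3 => ?_
  by_cases hkj : k = j
  · subst hkj
    rw [if_pos rfl, parityOf_eq hn hr hs hreg hk3]
  · rw [if_neg hkj]
    change ((r (T + 3) k).msgTo j).pieces ≠ ∅ ↔ _
    rw [(hr k).msgTo_three hn hm (hs.mono (by omega)) ((hreg k).2 _ (by omega)) (Ne.symm hkj),
      parityOf_eq hn hr hs hreg hk3]
    dsimp only
    split_ifs with h
    · exact ⟨fun _ => h.2, fun _ => bundle_ne_empty hm hk3 _⟩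
    · exact ⟨fun h' => absurd rfl h', fun h' => absurd ⟨hk3, h'⟩ h⟩

/-- If the number of coins showing `1` is even, `p = 0` and no group is revealed; if it is one, `p =
1` and one group is revealed. Only with three coins does the number of groups differ from what a
restart requires. -/
theorem wantsRestart_iff (hn : 3 ≤ n) (hm : 2 ≤ m) (hr : ∀ j, Honest m j r) (hs : Session r T 4)
    (hreg : Regular m r (T + 4)) (j : Fin n) :
    wantsRestart j (observe j (r (T + 1))) (observe j (r (T + 2))) (observe j (r (T + 3))) = true ↔
      ¬ AllCoins r T := by
  obtain ⟨a, ha⟩ : ∃ a : Fin n, a.val = 0 := ⟨⟨0, by omega⟩, rfl⟩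
  obtain ⟨b, hb⟩ : ∃ b : Fin n, b.val = 1 := ⟨⟨1, by omega⟩, rfl⟩
  obtain ⟨c, hc⟩ : ∃ c : Fin n, c.val = 2 := ⟨⟨2, by omega⟩, rfl⟩
  have hbits : ¬ j.val < 3 → ∀ k : Fin n, k.val < 3 →
      (observe j (r (T + 3))).bitFrom k.val = parityAt r T := by
    intro hj k hk
    rw [bitFrom_observe, (hr k).msgTo_three hn hm (hs.mono (by omega)) ((hreg k).2 _ (by omega))
      (by omega), if_pos ⟨hk, hj⟩, parityOf_eq hn hr hs hreg hk]
    rfl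
  have hall : AllCoins r T ↔ coinOf a (observe a (r (T + 1))) = true ∧
      coinOf b (observe b (r (T + 1))) = true ∧ coinOf c (observe c (r (T + 1))) = true := by
    constructor
    · exact fun h => ⟨h a (by omega), h b (by omega), h c (by omega)⟩
    · rintro ⟨h1, h2, h3⟩ k hk
      obtain rfl | rfl | rfl : k = a ∨ k = b ∨ k = c := by omega
      · exact h1
      · exact h2
      · exact h3
  have hp : (if j.val < 3 then parityOf j (observe j (r (T + 1))) (observe j (r (T + 2)))
      else (observe j (r (T + 3))).bitFrom 0) = parityAt r T := by
    split_ifs with hj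
    · exact parityOf_eq hn hr hs hreg hj
    · rw [← ha]; exact hbits hj a (by omega)
  have heq : j.val < 3 ∨ ((observe j (r (T + 3))).bitFrom 1 = parityAt r T ∧
      (observe j (r (T + 3))).bitFrom 2 = parityAt r T) := by
    by_cases hj : j.val < 3
    · exact Or.inl hj
    · right
      rw [← hb, ← hc]
      exact ⟨hbits hj b (by omega), hbits hj c (by omega)⟩
  unfold wantsRestart
  simp only [hp, decide_eq_true_eq, heq, true_and, bundlesSeen_eq hn hm hr hs hreg]
  rw [card_leaders ha hb hc, hall, parityAt, card_leaders ha hb hc]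
  cases coinOf a (observe a (r (T + 1))) <;> cases coinOf b (observe b (r (T + 1))) <;>
    cases coinOf c (observe c (r (T + 1))) <;> simp

/-- Unless all coins show `true`, the next sharing begins. -/
theorem fresh_succ (hn : 3 ≤ n) (hm : 2 ≤ m) (hr : ∀ j, Honest m j r)
    (h : Fresh m (hist r T)) (hc : ¬ AllCoins r T) : Fresh m (hist r (T + 5)) := by
  obtain ⟨hs, hreg⟩ := regular_of_fresh hn hm hr h
  have hact : ∀ j, r (T + 4) j = .play (fun _ => Msg.empty) true := by
    intro j
    obtain ⟨c, b, h⟩ := hr j (T + 4)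
    rw [h, protocolAction_four (hreg j).1 (hs.current_four j),
      if_pos ((wantsRestart_iff hn hm hr hs hreg j).2 hc),
      sendAll_eq (forall_own_hist.2 (hreg j).2)]
    simp [Msg.empty]
  rw [fresh_hist hn]
  constructor
  · intro c hc
    obtain rfl : c = 0 := by omega
    have hres : restarts (r (T + 4)) = true := by
      unfold restarts
      simp [hact]
    change currentAt r (T + 4 + 1) = []
    rw [currentAt_succ, if_pos hres]
  · refine hreg.succ (fun j => by rw [hact]; simp) fun j => ?_
    rw [hs.current le_rfl]
    intro k hk
    change (r (T + 4) k).msgTo j = Msg.empty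
    rw [hact]
    rfl

/-- If all coins show `true`, everybody learns the secret and stops. -/
theorem AllCoins.finish (hn : 3 ≤ n) (hm : 2 ≤ m) (hmn : m ≤ n) (hr : ∀ j, Honest m j r)
    (h : Fresh m (hist r T)) (hc : AllCoins r T) (j : Fin n) :
    r (T + 4) j = .halt ∧ Learns m r j := by
  obtain ⟨hs, hreg⟩ := regular_of_fresh hn hm hr h
  constructor
  · obtain ⟨c, b, h⟩ := hr j (T + 4)
    rw [h, protocolAction_four (hreg j).1 (hs.current_four j), if_neg]
    rw [wantsRestart_iff hn hm hr hs hreg j]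
    exact not_not.2 hc
  · refine ⟨T + 4, knows_of_bundles hn hm hmn (s := sharingAt r T) fun k hk y hy => ?_⟩
    obtain ⟨a, ha⟩ : ∃ a : Fin n, a.val = 0 := ⟨⟨0, by omega⟩, rfl⟩
    obtain ⟨b, hb⟩ : ∃ b : Fin n, b.val = 1 := ⟨⟨1, by omega⟩, rfl⟩
    obtain ⟨c, hc'⟩ : ∃ c : Fin n, c.val = 2 := ⟨⟨2, by omega⟩, rfl⟩
    have hf : Fires r T k := by
      refine ⟨hk, ?_, (hreg k).2 _ (by omega)⟩
      rw [hc k hk, parityOf_eq hn hr hs hreg hk, parityAt, card_leaders ha hb hc',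
        hc a (by omega), hc b (by omega), hc c (by omega)]
      rfl
    exact hf.holds hn hm (hr k) (hs.mono (by omega)) j hy

theorem runningTime_eq (hn : 3 ≤ n) (hm : 2 ≤ m) (hmn : m ≤ n) (hr : ∀ j, Honest m j r)
    (h : Fresh m (hist r T)) (hc : AllCoins r T) : runningTime r = ((T + 5 : ℕ) : ENNReal) := by
  obtain ⟨hs, hreg⟩ := regular_of_fresh hn hm hr h
  refine le_antisymm ?_ ?_
  · exact iInf₂_le (T + 4) fun j => (hc.finish hn hm hmn hr h j).1
  · refine le_iInf₂ fun t ht => ?_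
    have : T + 4 ≤ t := by
      by_contra hlt
      exact (hreg ⟨0, by omega⟩).2 t (by omega) (ht _)
    exact_mod_cast Nat.succ_le_succ this

end HonestPlay

/-! ### The geometric number of sharings -/

section RunningTime

variable {n m : ℕ} {α : unitInterval} {r : Run n} {j : Fin n} {T t : ℕ}

/-- The probability that the play begins with `g` and that a profile in `P` follows. -/
theorem measure_hist_eq_and_mem (σ : ∀ j, Strategy n m j) (r : Run n) (t : ℕ)
    (P : Set (Profile n)) :
    runMeasure σ {r' | hist r' t = hist r t ∧ r' t ∈ P} =
      weight σ (hist r t) * stepMeasure σ (hist r t) P := by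
  have h1 : {r' : Run n | hist r' t = hist r t ∧ r' t ∈ P} =
      ⋃ p ∈ P, {r' | hist r' (t + 1) ∈ ({hist r t ++ [p]} : Set (List (Profile n)))} := by
    ext r'
    simp only [Set.mem_ofPred_eq, Set.mem_iUnion, hist_succ, Set.mem_singleton_iff,
      List.append_singleton_inj, exists_prop]
    constructor
    · exact fun h => ⟨_, h.2, h.1, rfl⟩
    · rintro ⟨p, hp, h, rfl⟩
      exact ⟨h, hp⟩
  have h2 : stepMeasure σ (hist r t) P = ∑' p : P, stepMeasure σ (hist r t) {p.1} := by
    rw [← measure_biUnion P.to_countable (fun p _ q _ hpq => by simpa using hpq)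
      (fun p _ => MeasurableSet.of_discrete), Set.biUnion_of_singleton]
  rw [h1, measure_biUnion P.to_countable, h2, ← ENNReal.tsum_mul_left]
  · refine tsum_congr fun p => ?_
    rw [stepMeasure_singleton, ← weight_append_singleton]
    exact weight_eq σ (by simp)
  · intro p _ q _ hpq
    refine Set.disjoint_left.2 fun r' hp hq => hpq ?_
    have := (Set.mem_singleton_iff.1 hp).symm.trans (Set.mem_singleton_iff.1 hq)
    simpa using this
  · exact fun p _ => measurableSet_hist _ _

/-- Conditioning on the history: the hypothesis concerns only histories that occur with positive
probability, and the remaining ones are null. -/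
theorem measure_step (σ : ∀ j, Strategy n m j) (t : ℕ) (S : Set (List (Profile n)))
    (P : Set (Profile n)) {c : ENNReal}
    (h : ∀ r, Positive σ r → hist r t ∈ S → stepMeasure σ (hist r t) P = c) :
    runMeasure σ {r | hist r t ∈ S ∧ r t ∈ P} = c * runMeasure σ {r | hist r t ∈ S} := by
  have h1 : {r : Run n | hist r t ∈ S ∧ r t ∈ P} =
      ⋃ g ∈ S, {r | hist r t = g ∧ r t ∈ P} := by
    ext r; simp
  have h2 : {r : Run n | hist r t ∈ S} = ⋃ g ∈ S, {r | hist r t = g} := by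
    ext r; simp
  have hd : ∀ Q : List (Profile n) → Set (Run n), (∀ g, Q g ⊆ {r | hist r t = g}) →
      S.PairwiseDisjoint Q := fun Q hQ g _ g' _ hne =>
    Set.disjoint_left.2 fun r hg hg' => hne ((hQ g hg).symm.trans (hQ g' hg'))
  have hm : ∀ g, MeasurableSet {r : Run n | hist r t = g} := fun g => measurableSet_hist t {g}
  have hmP : ∀ g ∈ S, MeasurableSet {r : Run n | hist r t = g ∧ r t ∈ P} := fun g _ =>
    (hm g).inter (measurable_pi_apply t (MeasurableSet.of_discrete (s := P)))
  rw [h1, h2, measure_biUnion S.to_countable (hd _ fun g r hr => hr.1) hmP,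
    measure_biUnion S.to_countable (hd _ fun g r hr => hr) fun g _ => hm g,
    ← ENNReal.tsum_mul_left]
  refine tsum_congr fun g => ?_
  by_cases hg : ∃ r, Positive σ r ∧ hist r t = g.1
  · obtain ⟨r, hr, hrg⟩ := hg
    have hS := g.2
    rw [← hrg] at hS ⊢
    rw [measure_hist_eq_and_mem, h r hr hS, weight_eq σ (hist_length r t), mul_comm]
  · have h0 : runMeasure σ {r | hist r t = g.1} = 0 := by
      rw [← nonpos_iff_eq_zero, ← ae_iff.1 (ae_positive σ)]
      exact measure_mono fun r hr hp => hg ⟨r, hp, hr⟩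
    rw [h0, mul_zero]
    exact measure_mono_null (fun r hr => hr.1) h0

theorem coinOf_protocolAction_self (hn : 3 ≤ n) {v : View n} (hc : Clean m j v)
    (hv : ∀ o ∈ v, o.own ≠ .halt) {o₀ : Obs n} (hcur : current v = [o₀]) (hj : j.val < 3)
    (c b : Bool) (recv : Fin n → Msg n) (restart : Bool) :
    coinOf j ⟨protocolAction m j v c b, recv, restart⟩ = c := by
  obtain ⟨y, hy⟩ : ∃ y : Fin n, y.val = (j.val + 1) % 3 := ⟨⟨(j.val + 1) % 3, by omega⟩, rfl⟩
  obtain ⟨z, hz⟩ : ∃ z : Fin n, z.val = (j.val + 2) % 3 := ⟨⟨(j.val + 2) % 3, by omega⟩, rfl⟩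
  have hyj : y ≠ j := by omega
  have hzj : z ≠ j := by omega
  have e1 : (j.val < 3 ∧ y.val = (j.val + 1) % 3) = True := eq_true ⟨hj, hy⟩
  have e2 : (j.val < 3 ∧ z.val = (j.val + 1) % 3) = False := by rw [eq_iff_iff, iff_false]; omega
  have e3 : (j.val < 3 ∧ z.val = (j.val + 2) % 3) = True := eq_true ⟨hj, hz⟩
  rw [coinOf, ← hy, ← hz, Obs.bitTo, Obs.bitTo, dif_pos y.2, dif_pos z.2,
    protocolAction_one hc hcur, sendAll_eq hv]
  simp only [Move.msgTo, hyj, hzj, e1, e2, e3, if_true, if_false, Option.getD_some, Fin.eta]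
  cases c <;> cases b <;> rfl

/-- The profiles in which all leaders throw `true`. -/
def allTrue (n : ℕ) : Set (Profile n) :=
  {p | ∀ j : Fin n, j.val < 3 → coinOf j (observe j p) = true}

theorem stepMeasure_allTrue (hn : 3 ≤ n) (h : List (Profile n))
    (hh : ∀ j : Fin n, Clean m j (view j h) ∧ (∀ o ∈ view j h, o.own ≠ .halt) ∧
      ∃ o₀, current (view j h) = [o₀]) :
    stepMeasure (recommended n m α) h (allTrue n) = ENNReal.ofReal α ^ 3 := by
  have hset : allTrue n = Set.univ.pi fun j : Fin n =>
      {a | j.val < 3 → coinOf j ⟨a, fun _ => Msg.empty, false⟩ = true} := by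
    ext p
    simp only [Set.mem_pi, Set.mem_univ, true_imp_iff]
    rfl
  -- A coin is a function of the own move alone, so received messages and restart are filled with
  -- dummies. This makes `allTrue n` a product set.
  have hcoin : ∀ j : Fin n, ((recommended n m α j).1 (view j h)).toMeasure
      {a | j.val < 3 → coinOf j ⟨a, fun _ => Msg.empty, false⟩ = true} =
        if j.val < 3 then ENNReal.ofReal α else 1 := by
    intro j
    split_ifs with hj
    · obtain ⟨h1, h2, o₀, h3⟩ := hh j
      have hm : ∀ c b, protocolAction m j (view j h) c b ∈
          {a | j.val < 3 → coinOf j ⟨a, fun _ => Msg.empty, false⟩ = true} ↔ c = true := by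
        intro c b
        rw [Set.mem_ofPred_eq, coinOf_protocolAction_self hn h1 h2 h3 hj]
        exact ⟨fun h => h hj, fun h _ => h⟩
      change ((coin α).bind fun c => (coin half).bind fun b =>
        PMF.pure (protocolAction m j (view j h) c b)).toMeasure _ = _
      rw [PMF.toMeasure_bind_apply _ _ _ MeasurableSet.of_discrete]
      have key : ∀ c, ((coin half).bind fun b =>
          PMF.pure (protocolAction m j (view j h) c b)).toMeasure
          {a | j.val < 3 → coinOf j ⟨a, fun _ => Msg.empty, false⟩ = true} =
          if c = true then 1 else 0 := by
        intro c
        rw [PMF.toMeasure_bind_apply _ _ _ MeasurableSet.of_discrete]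
        have : ∀ b, (PMF.pure (protocolAction m j (view j h) c b)).toMeasure
            {a | j.val < 3 → coinOf j ⟨a, fun _ => Msg.empty, false⟩ = true} =
            if c = true then 1 else 0 := by
          intro b
          rw [PMF.toMeasure_pure_apply _ _ MeasurableSet.of_discrete]
          simp only [hm]
        simp only [this, ENNReal.tsum_mul_right, PMF.tsum_coe, one_mul]
      simp only [key, tsum_bool]
      simp [coin]
    · have : {a : Move n | j.val < 3 → coinOf j ⟨a, fun _ => Msg.empty, false⟩ = true} =
          Set.univ := Set.eq_univ_of_forall fun a h => absurd h hj
      rw [this]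
      exact measure_univ
  obtain ⟨a, ha⟩ : ∃ a : Fin n, a.val = 0 := ⟨⟨0, by omega⟩, rfl⟩
  obtain ⟨b, hb⟩ : ∃ b : Fin n, b.val = 1 := ⟨⟨1, by omega⟩, rfl⟩
  obtain ⟨c, hc⟩ : ∃ c : Fin n, c.val = 2 := ⟨⟨2, by omega⟩, rfl⟩
  have hcard := card_leaders ha hb hc fun _ => True
  simp only [and_true, if_true] at hcard
  rw [stepMeasure, hset, Measure.pi_pi]
  simp only [hcoin]
  rw [Finset.prod_ite, Finset.prod_const, Finset.prod_const_one, hcard, mul_one]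

/-- If a new sharing begins in round `5 * l`, then one begins in every earlier round `5 * k`. -/
theorem fresh_of_le (hn : 3 ≤ n) (hm : 2 ≤ m) (hmn : m ≤ n) (hr : ∀ j, Honest m j r) {l : ℕ}
    (h : Fresh m (hist r (5 * l))) :
    ∀ k ≤ l, Fresh m (hist r (5 * k)) ∧ (k < l → ¬ AllCoins r (5 * k)) := by
  intro k
  induction k with
  | zero =>
    intro _
    refine ⟨fresh_nil, fun hl hc => ?_⟩
    exact (((fresh_hist hn).1 h).2 ⟨0, by omega⟩).2 (5 * 0 + 4) (by omega)
      (hc.finish hn hm hmn hr fresh_nil _).1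
  | succ k ih =>
    intro hk
    obtain ⟨h1, h2⟩ := ih (by omega)
    have h3 : Fresh m (hist r (5 * (k + 1))) := fresh_succ hn hm hr h1 (h2 hk)
    refine ⟨h3, fun hl hc => ?_⟩
    exact (((fresh_hist hn).1 h).2 ⟨0, by omega⟩).2 (5 * (k + 1) + 4) (by omega)
      (hc.finish hn hm hmn hr h3 _).1

theorem measure_fresh (hn : 3 ≤ n) (hm : 2 ≤ m) (hmn : m ≤ n) (k : ℕ) :
    runMeasure (recommended n m α) {r | Fresh m (hist r (5 * k))} =
      (1 - ENNReal.ofReal α ^ 3) ^ k := by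
  induction k with
  | zero =>
    have : {r : Run n | Fresh m (hist r (5 * 0))} = Set.univ :=
      Set.eq_univ_of_forall fun r => fresh_nil
    rw [this, measure_univ, pow_zero]
  | succ k ih =>
    -- The coins are thrown in step `1`, after `5 * k + 1` rounds, one round after the sharing
    -- begins.
    have hdrop : ∀ r : Run n, (hist r (5 * k + 1)).dropLast = hist r (5 * k) := fun r => by
      rw [hist_succ, List.dropLast_concat]
    have hS : {r : Run n | hist r (5 * k + 1) ∈ {h | Fresh m h.dropLast}} =
        {r | Fresh m (hist r (5 * k))} := by
      ext r
      simp only [Set.mem_ofPred_eq, hdrop]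
    have hstep := measure_step (recommended n m α) (5 * k + 1) {h | Fresh m h.dropLast}
      (allTrue n)ᶜ (c := 1 - ENNReal.ofReal α ^ 3) fun r hr hf => by
        have hhon : ∀ j, Honest m j r := fun j => honest_of_positive rfl hr
        rw [Set.mem_ofPred_eq, hdrop] at hf
        obtain ⟨hs, hreg⟩ := regular_of_fresh hn hm hhon hf
        rw [prob_compl_eq_one_sub MeasurableSet.of_discrete, stepMeasure_allTrue hn]
        intro j
        exact ⟨clean_hist.2 fun s hs => clean_hist.1 (hreg j).1 s (by omega),
          forall_own_hist.2 fun s hs => (hreg j).2 s (by omega), _,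
          hs.current (c' := 1) (by omega) j⟩
    rw [hS, ih] at hstep
    rw [pow_succ', ← hstep]
    refine measure_congr ?_
    filter_upwards [ae_positive (recommended n m α)] with r hr
    have hhon : ∀ j, Honest m j r := fun j => honest_of_positive rfl hr
    refine propext ⟨fun h => ?_, fun h => ?_⟩
    · obtain ⟨h1, h2⟩ := fresh_of_le hn hm hmn hhon h k (by omega)
      refine ⟨?_, h2 (by omega)⟩
      rw [hdrop]
      exact h1
    · have h1 : Fresh m (hist r (5 * k + 1)).dropLast := h.1
      rw [hdrop] at h1
      exact fresh_succ hn hm hhon h1 h.2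

/-- Almost surely there is a sharing in which all coins show `true`. -/
theorem ae_exists_allCoins (hn : 3 ≤ n) (hm : 2 ≤ m) (hmn : m ≤ n) (hα : 0 < (α : ℝ)) :
    ∀ᵐ r ∂runMeasure (recommended n m α), ∃ k, Fresh m (hist r (5 * k)) ∧ AllCoins r (5 * k) := by
  -- Going on forever is at most as likely as reaching sharing `k`, for each `k`, and this
  -- probability tends to `0` as `α > 0`.
  have h0 : runMeasure (recommended n m α) {r | ∀ k, Fresh m (hist r (5 * k))} = 0 := by
    have hlt : 1 - ENNReal.ofReal α ^ 3 < 1 :=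
      ENNReal.sub_lt_self ENNReal.one_ne_top one_ne_zero
        (pow_ne_zero _ (ENNReal.ofReal_pos.2 hα).ne')
    refine le_antisymm (ge_of_tendsto' (ENNReal.tendsto_pow_atTop_nhds_zero_of_lt_one hlt)
      fun k => ?_) bot_le
    rw [← measure_fresh hn hm hmn]
    exact measure_mono fun r hr => hr k
  filter_upwards [ae_positive (recommended n m α), measure_eq_zero_iff_ae_notMem.1 h0] with r hr hr0
  by_contra! hcon
  refine hr0 fun k => ?_
  induction k with
  | zero => exact fresh_nil
  | succ k ih => exact fresh_succ hn hm (fun j => honest_of_positive rfl hr) ih (hcon k ih)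

theorem ae_learns (hn : 3 ≤ n) (hm : 2 ≤ m) (hmn : m ≤ n) (hα : 0 < (α : ℝ)) :
    ∀ᵐ r ∂runMeasure (recommended n m α), ∀ i, Learns m r i := by
  filter_upwards [ae_positive (recommended n m α), ae_exists_allCoins hn hm hmn hα] with r hr hk i
  obtain ⟨k, hf, hc⟩ := hk
  exact (hc.finish hn hm hmn (fun j => honest_of_positive rfl hr) hf i).2

theorem lintegral_runningTime (hn : 3 ≤ n) (hm : 2 ≤ m) (hmn : m ≤ n) (hα : 0 < (α : ℝ)) :
    ∫⁻ r, runningTime r ∂runMeasure (recommended n m α) = ENNReal.ofReal (5 / (α : ℝ) ^ 3) := by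
  -- The running time is five times the number of sharings begun, so its expectation is a sum of
  -- tail probabilities, which is a geometric series.
  have hsum : ∀ᵐ r ∂runMeasure (recommended n m α), runningTime r =
      ∑' k, {r : Run n | Fresh m (hist r (5 * k))}.indicator (fun _ => (5 : ENNReal)) r := by
    filter_upwards [ae_positive (recommended n m α), ae_exists_allCoins hn hm hmn hα]
      with r hr hk
    have hhon : ∀ j, Honest m j r := fun j => honest_of_positive rfl hr
    obtain ⟨k, hf, hc⟩ := hk
    rw [runningTime_eq hn hm hmn hhon hf hc, tsum_eq_sum (s := Finset.range (k + 1))]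
    · rw [Finset.sum_congr rfl (g := fun _ => 5) fun l hl => ?_]
      · rw [Finset.sum_const, Finset.card_range, nsmul_eq_mul]
        push_cast
        ring
      · exact Set.indicator_of_mem (s := {r : Run n | Fresh m (hist r (5 * l))})
          (fresh_of_le hn hm hmn hhon hf l (Nat.lt_succ_iff.1 (Finset.mem_range.1 hl))).1 _
    · intro l hl
      refine Set.indicator_of_notMem (fun h => ?_) _
      rw [Finset.mem_range] at hl
      exact (fresh_of_le hn hm hmn hhon h k (by omega)).2 (by omega) hc
  have hmeas : ∀ k, MeasurableSet {r : Run n | Fresh m (hist r (5 * k))} := fun k =>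
    measurableSet_hist (5 * k) {h | Fresh m h}
  rw [lintegral_congr_ae hsum,
    lintegral_tsum fun k => (measurable_const.indicator (hmeas k)).aemeasurable]
  simp only [lintegral_indicator_const (hmeas _), measure_fresh hn hm hmn]
  have hle : ENNReal.ofReal α ^ 3 ≤ 1 :=
    pow_le_one₀ bot_le (ENNReal.ofReal_le_one.2 α.2.2)
  rw [ENNReal.tsum_mul_left, ENNReal.tsum_geometric,
    ENNReal.sub_sub_cancel ENNReal.one_ne_top hle, ENNReal.ofReal_div_of_pos (by positivity),
    ENNReal.ofReal_pow hα.le, div_eq_mul_inv]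
  simp

end RunningTime

theorem mainTheorem2 (m n : ℕ) (hn : 3 ≤ n) (hm : 2 ≤ m) (hmn : m ≤ n)
    (u : Fin n → Run n → ℝ) (hU1 : U1 m u) (hU2 : U2 m u) (hU3 : U3 m u) :
    ∃ αStar : ℝ, 0 < αStar ∧ ∀ α : unitInterval, 0 < (α : ℝ) → (α : ℝ) < αStar →
      IsPractical (expectedUtility m u) (recommended n m α) ∧
      (∀ᵐ r ∂runMeasure (recommended n m α), ∀ i, Learns m r i) ∧
      ∫⁻ r, runningTime r ∂runMeasure (recommended n m α) =
        ENNReal.ofReal (5 / (α : ℝ) ^ 3) := by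
  obtain ⟨αStar, h0, hNash⟩ := exists_isNash hn hm hmn hU1 hU2 fun α hα => ae_learns hn hm hmn hα
  refine ⟨αStar, h0, fun α hα hlt => ⟨⟨hNash α hα hlt, fun i => Set.mem_iInter.2 fun k => ?_⟩,
    ae_learns hn hm hmn hα, lintegral_runningTime hn hm hmn hα⟩⟩
  exact Discreet.survives hn hm hmn hU1 hU2 hU3 k i _ (discreet_recommended hn hm hmn α i)
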